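/- Let $(p_k)_{k\in\mathbb N}$ be a probability distribution with $p_k>0$ for infinitely many $k$. In the Poissonized Karlin occupancy scheme the balls $1,2,\ldots$ are thrown independently into boxes $1,2,\ldots$, each ball hitting box $k$ with probability $p_k$; the $n$th ball is thrown at time $S_n$, where $S_n$ is a sum of $n$ independent exponential random variables of unit mean, and $(S_n)_{n\in\mathbb N}$ is independent of the boxes hit by the balls. For $j\in\mathbb N$ and $t\ge 0$ let $K_j(t)$ be the number of boxes containing at least $j$ balls at time $t$. Put $\rho(t):=\#\{k\in\mathbb N: 1/p_k\le t\}$ for $t>0$ (with $1/0=\infty$). Write $x(t)\sim y(t)$ for $\lim_{t\to\infty}x(t)/y(t)=1$. Assume that $\rho$ belongs to de Haan's class $\Pi$ with auxiliary function $\ell$, that is, for all $c>0$, $$\lim_{t\to\infty}\frac{\rho(c t)-\rho(t)}{\ell(t)}=\log c.$$ (a) If $\ell(t)\sim(\log t)^\beta\, l(\log t)$ as $t\to\infty$ for some $\beta>0$ and some $l$ slowly varying at $\infty$, then $\ell(t)\to\infty$ as $t\to\infty$ and, for each $j\in\mathbb N$, $$\limsup_{t\to\infty}\frac{K_j(t)-\mathbb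 E K_j(t)}{(\mathrm{Var}\,K_j(t)\,\log \mathrm{Var}\,K_j(t))^{1/2}}=\Big(\frac{2}{\beta}\Big)^{1/2}\quad\text{a.s.}$$ (b) If $\ell(t)\sim\exp(\sigma(\log t)^\lambda)$ as $t\to\infty$ for some $\sigma>0$ and $\lambda\in(0,1)$, then $\ell(t)\to\infty$ as $t\to\infty$ and, for each $j\in\mathbb N$, $$\limsup_{t\to\infty}\frac{K_j(t)-\mathbb E K_j(t)}{(\mathrm{Var}\,K_j(t)\,\log\log \mathrm{Var}\,K_j(t))^{1/2}}=\Big(\frac{2}{\lambda}\Big)^{1/2}\quad\text{a.s.}$$ (c) If $\lim_{t\to\infty}\ell(t)=\infty$ (in particular, in both cases above), then, for each $j\in\mathbb N$, as $t\to\infty$, $$\mathbb E K_j(t)\sim\rho(t)\quad\text{and}\quad \mathrm{Var}\,K_j(t)\sim\Big(\log 2-\sum_{k=1}^{j-1}\frac{(2k-1)!}{(k!)^2\,2^{2k}}\Big)\ell(t).$$ -/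

import Mathlib

open MeasureTheory ProbabilityTheory Filter Topology Asymptotics

namespace Karlin

/-- `p` is a discrete probability distribution on the boxes (labelled by `ℕ`) which charges
infinitely many boxes. -/
structure IsBoxDistribution (p : ℕ → ℝ) : Prop where
  nonneg : ∀ k, 0 ≤ p k
  hasSum_one : HasSum p 1
  infinite_support : {k | 0 < p k}.Infinite

/-- The counting function `ρ(t) = #{k : 1 / p k ≤ t}`, where `1 / 0 = ∞`, so that only boxes with
`p k > 0` are counted. -/
noncomputable def rho (p : ℕ → ℝ) (t : ℝ) : ℝ :=
  ({k : ℕ | 0 < p k ∧ 1 / p k ≤ t}.ncard : ℝ)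

/-- `f` belongs to de Haan's class `Π` with the auxiliary function `ℓ`. -/
def DeHaanPi (f ℓ : ℝ → ℝ) : Prop :=
  ∀ c : ℝ, 0 < c → Tendsto (fun t => (f (c * t) - f t) / ℓ t) atTop (𝓝 (Real.log c))

/-- Slow variation at `∞`: positive and measurable on a half-line `[X, ∞)`, with
`L (c x) / L x → 1` as `x → ∞` for every `c > 0`. -/
structure IsSlowlyVarying (L : ℝ → ℝ) : Prop where
  pos_measurable : ∃ X : ℝ, (∀ x, X ≤ x → 0 < L x) ∧ Measurable (fun x : Set.Ici X => L x)
  tendsto_ratio : ∀ c : ℝ, 0 < c → Tendsto (fun x => L (c * x) / L x) atTop (𝓝 1)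

/-- The random input of the Poissonized occupancy scheme. Balls are labelled by `n = 0, 1, 2, …`;
`box n` is the box hit by ball `n`, and `gap n` is the waiting time between ball `n - 1` (time `0`
if `n = 0`) and ball `n`. The boxes are i.i.d. with law `p`, the waiting times are i.i.d.
exponential with mean one, and the two sequences are independent. -/
structure IsPoissonizedScheme {Ω : Type*} [MeasurableSpace Ω] (P : Measure Ω) (p : ℕ → ℝ)
    (box : ℕ → Ω → ℕ) (gap : ℕ → Ω → ℝ) : Prop where
  measurable_box : ∀ n, Measurable (box n)
  measurable_gap : ∀ n, Measurable (gap n)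
  law_box : ∀ n k, P {ω | box n ω = k} = ENNReal.ofReal (p k)
  law_gap : ∀ n, P.map (gap n) = expMeasure 1
  indep_box : iIndepFun box P
  indep_gap : iIndepFun gap P
  indep_box_gap : IndepFun (fun ω n => box n ω) (fun ω n => gap n ω) P

/-- The time at which ball `n` is thrown. -/
def throwTime {Ω : Type*} (gap : ℕ → Ω → ℝ) (n : ℕ) (ω : Ω) : ℝ :=
  ∑ i ∈ Finset.range (n + 1), gap i ω

/-- The number of balls in box `k` at time `t`. (Almost surely only finitely many balls have been
thrown by any time `t`, so that `ncard` is the true number.) -/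
noncomputable def ballCount {Ω : Type*} (box : ℕ → Ω → ℕ) (gap : ℕ → Ω → ℝ) (k : ℕ) (t : ℝ)
    (ω : Ω) : ℕ :=
  {n : ℕ | throwTime gap n ω ≤ t ∧ box n ω = k}.ncard

/-- `K_j(t)`, the number of boxes which contain at least `j` balls at time `t`. -/
noncomputable def K {Ω : Type*} (box : ℕ → Ω → ℕ) (gap : ℕ → Ω → ℝ) (j : ℕ) (t : ℝ) (ω : Ω) : ℝ :=
  ({k : ℕ | j ≤ ballCount box gap k t ω}.ncard : ℝ)

end Karlin

/-! Throwing the balls at the points of a unit Poisson process makes the box counts independent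
Poisson processes with rates `p k`. Hence `K_j(t)` is a sum of independent indicators, box `k` being
counted with probability `poisGe j (p k * t)`. The proof needs this in one form only: for fixed `j`,
the σ-algebras generated by the events "box `k` has less than `j` balls at time `t`", `t` real, are
independent over `k` (`iIndep_fullAlgebra`). These events are nested in `t`, so it suffices to know
their joint probabilities with one time per box. Both these probabilities and the expected product
of Poisson probabilities solve the equation obtained by conditioning on the first ball, and the
solution is unique by a contraction argument (`measureReal_lateSet`).

Mean and variance are sums `∑ G (p k * t)`, which equal `∫ G'(x) ρ(t/x) dx`. Subtracting `G(∞)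
ρ(t)`, dividing by `ℓ t` and passing to the limit under a Potter-type bound gives `∫ G'(x) (-log x)
dx` (`tendsto_tsum_of_hasDerivAt`). For the mean `G(∞) = 1` and `ℓ = o(ρ)`, so the mean is
asymptotic to `ρ`. For the variance `G(∞) = 0`, so it is asymptotic to a constant times `ℓ`; the
constant is `∫ poisVar j x / x dx`, computed by recursion on `j`.

The limsup statements come from one law of the iterated logarithm with normalisation `√(2 V(t) log
log t)`, `V` the variance (`ae_eventually_le`, `ae_frequently_ge`). The fluctuation at time `t` is
essentially produced by boxes with `p k * t` in a fixed window `(a, 1/a]`. Times that are far apart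
on the logarithmic scale therefore see disjoint sets of boxes and behave as independent trials.
About `log t` such trials occur before `t`, whence `log log t`, regardless of how slowly `V` grows.
For the upper half, Bernstein's inequality and Borel–Cantelli handle a grid of equally spaced
logarithmic times, and chaining fills the gaps. For the lower half, exponential tilting gives a
matching lower bound for the window sums, to which the second Borel–Cantelli lemma applies.

It remains to express `log log t` through `V`: `log V ~ β log log t` in the first case and `log log
V ~ λ log log t` in the second, which turns the factor `2` into `2 / β` and `2 / λ`
(`ae_limsup_eq`). -/

open scoped ENNReal

/-! ### Poisson probabilities, their derivatives and their tails. -/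

namespace Karlin

/-- The Poisson weight `e^{-x} x^j / j!`. -/
noncomputable def poisWeight (j : ℕ) (x : ℝ) : ℝ := Real.exp (-x) * x ^ j / (Nat.factorial j : ℝ)

/-- The probability that a Poisson variable with mean `x` is less than `j`. -/
noncomputable def poisLt (j : ℕ) (x : ℝ) : ℝ := ∑ i ∈ Finset.range j, poisWeight i x

/-- The probability that a Poisson variable with mean `x` is at least `j`. -/
noncomputable def poisGe (j : ℕ) (x : ℝ) : ℝ := 1 - poisLt j x

lemma poisWeight_nonneg (j : ℕ) {x : ℝ} (hx : 0 ≤ x) : 0 ≤ poisWeight j x := by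
  unfold poisWeight; positivity

lemma poisWeight_pos (j : ℕ) {x : ℝ} (hx : 0 < x) : 0 < poisWeight j x := by
  unfold poisWeight; positivity

lemma poisLt_zero (x : ℝ) : poisLt 0 x = 0 := by simp [poisLt]

lemma poisLt_succ (j : ℕ) (x : ℝ) : poisLt (j + 1) x = poisLt j x + poisWeight j x := by
  simp [poisLt, Finset.sum_range_succ]

lemma poisGe_succ (j : ℕ) (x : ℝ) : poisGe (j + 1) x = poisGe j x - poisWeight j x := by
  rw [poisGe, poisLt_succ, poisGe]; ring

lemma continuous_poisWeight (j : ℕ) : Continuous (poisWeight j) := by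
  unfold poisWeight; fun_prop

lemma continuous_poisLt (j : ℕ) : Continuous (poisLt j) := by
  unfold poisLt
  exact continuous_finsetSum _ fun i _ => continuous_poisWeight i

lemma continuous_poisGe (j : ℕ) : Continuous (poisGe j) :=
  continuous_const.sub (continuous_poisLt j)

lemma hasDerivAt_poisWeight_zero (x : ℝ) : HasDerivAt (poisWeight 0) (-poisWeight 0 x) x := by
  have : poisWeight 0 = fun x => Real.exp (-x) := by ext; simp [poisWeight]
  rw [this]
  simpa using (hasDerivAt_neg x).exp

lemma hasDerivAt_poisWeight_succ (j : ℕ) (x : ℝ) :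
    HasDerivAt (poisWeight (j + 1)) (poisWeight j x - poisWeight (j + 1) x) x := by
  have h : HasDerivAt (poisWeight (j + 1)) _ x :=
    (((hasDerivAt_neg x).exp).mul (hasDerivAt_pow (j + 1) x)).div_const _
  convert h using 1
  unfold poisWeight
  have h1 : ((j + 1).factorial : ℝ) = (j + 1) * j.factorial := by
    push_cast [Nat.factorial_succ]; ring
  rw [h1]
  have : (j.factorial : ℝ) ≠ 0 := by positivity
  have : ((j : ℝ) + 1) ≠ 0 := by positivity
  push_cast
  field_simp
  ring

lemma hasDerivAt_poisLt_succ (j : ℕ) (x : ℝ) :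
    HasDerivAt (poisLt (j + 1)) (-poisWeight j x) x := by
  induction j with
  | zero =>
    have : poisLt 1 = poisWeight 0 := by ext; simp [poisLt]
    rw [zero_add, this]; exact hasDerivAt_poisWeight_zero x
  | succ j ih =>
    have : poisLt (j + 1 + 1) = fun x => poisLt (j + 1) x + poisWeight (j + 1) x := by
      ext; rw [poisLt_succ]
    rw [this]
    exact (ih.add (hasDerivAt_poisWeight_succ j x)).congr_deriv (by ring)

/-- Written with `j - 1` because a ball lowers the demand of its box by one, as in `demandAfter`.
The truncation at `j = 0` is harmless: both terms vanish. -/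
lemma hasDerivAt_poisLt (j : ℕ) (x : ℝ) :
    HasDerivAt (poisLt j) (poisLt (j - 1) x - poisLt j x) x := by
  cases j with
  | zero =>
    have : poisLt 0 = fun _ => 0 := by ext; simp [poisLt]
    simpa [this] using hasDerivAt_const x (0 : ℝ)
  | succ j =>
    convert hasDerivAt_poisLt_succ j x using 1
    rw [poisLt_succ, Nat.add_sub_cancel]; ring

lemma hasDerivAt_poisGe_succ (j : ℕ) (x : ℝ) :
    HasDerivAt (poisGe (j + 1)) (poisWeight j x) x := by
  exact ((hasDerivAt_poisLt_succ j x).const_sub 1).congr_deriv (neg_neg _)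

lemma poisLt_at_zero {j : ℕ} (hj : 1 ≤ j) : poisLt j 0 = 1 := by
  obtain ⟨j, rfl⟩ : ∃ i, j = i + 1 := ⟨j - 1, by omega⟩
  unfold poisLt
  rw [Finset.sum_range_succ']
  simp [poisWeight]

lemma poisGe_at_zero {j : ℕ} (hj : 1 ≤ j) : poisGe j 0 = 0 := by simp [poisGe, poisLt_at_zero hj]

lemma poisLt_nonneg (j : ℕ) {x : ℝ} (hx : 0 ≤ x) : 0 ≤ poisLt j x :=
  Finset.sum_nonneg fun i _ => poisWeight_nonneg i hx

lemma poisLt_le_one (j : ℕ) {x : ℝ} (hx : 0 ≤ x) : poisLt j x ≤ 1 := by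
  have h : ∑ i ∈ Finset.range j, x ^ i / (Nat.factorial i : ℝ) ≤ Real.exp x :=
    Real.sum_le_exp_of_nonneg hx j
  have : poisLt j x = Real.exp (-x) * ∑ i ∈ Finset.range j, x ^ i / (Nat.factorial i : ℝ) := by
    unfold poisLt poisWeight
    rw [Finset.mul_sum]
    exact Finset.sum_congr rfl fun i _ => by ring
  rw [this]
  calc _ ≤ Real.exp (-x) * Real.exp x := by gcongr
    _ = 1 := by rw [← Real.exp_add]; simp

lemma poisGe_nonneg (j : ℕ) {x : ℝ} (hx : 0 ≤ x) : 0 ≤ poisGe j x := by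
  have := poisLt_le_one j hx; unfold poisGe; linarith

lemma poisGe_le_one (j : ℕ) {x : ℝ} (hx : 0 ≤ x) : poisGe j x ≤ 1 := by
  have := poisLt_nonneg j hx; unfold poisGe; linarith

lemma one_sub_poisGe (j : ℕ) (x : ℝ) : 1 - poisGe j x = poisLt j x := by unfold poisGe; ring

lemma poisGe_le_self {j : ℕ} (hj : 1 ≤ j) {x : ℝ} (hx : 0 ≤ x) : poisGe j x ≤ x := by
  have h1 : poisWeight 0 x ≤ poisLt j x := by
    unfold poisLt
    exact Finset.single_le_sum (f := fun i => poisWeight i x)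
      (fun i _ => poisWeight_nonneg i hx) (by simp; omega)
  have h2 : 1 - x ≤ poisWeight 0 x := by
    have := Real.add_one_le_exp (-x)
    simp only [poisWeight, pow_zero, Nat.factorial_zero, Nat.cast_one, div_one, mul_one]
    linarith
  unfold poisGe; linarith

/-- Half of the exponential pays for the power, since `(x / 2) ^ j / j! ≤ exp (x / 2)`. The factors
`2 ^ i` then add up to less than `2 ^ j` in `poisLt_le`. -/
lemma poisWeight_le (j : ℕ) {x : ℝ} (hx : 0 ≤ x) :
    poisWeight j x ≤ 2 ^ j * Real.exp (-(x / 2)) := by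
  have h := Real.pow_div_factorial_le_exp (x / 2) (by positivity) j
  have h2 : poisWeight j x = 2 ^ j * (Real.exp (-x) * ((x / 2) ^ j / (Nat.factorial j : ℝ))) := by
    unfold poisWeight; rw [div_pow]; field_simp
  rw [h2]
  calc _ ≤ 2 ^ j * (Real.exp (-x) * Real.exp (x / 2)) := by gcongr
    _ = _ := by rw [← Real.exp_add]; ring_nf

lemma poisLt_le (j : ℕ) {x : ℝ} (hx : 0 ≤ x) :
    poisLt j x ≤ 2 ^ j * Real.exp (-(x / 2)) := by
  induction j with
  | zero => rw [poisLt_zero]; positivity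
  | succ j ih =>
    rw [poisLt_succ, pow_succ]
    have := poisWeight_le j hx
    linarith

end Karlin

/-! ### Conditioning on the first ball. -/

namespace Karlin

/-- The number of balls in box `k` at time `t`, as an extended real number and as a function of the
input sequences. -/
noncomputable def count (k : ℕ) (t : ℝ) (x : (ℕ → ℕ) × (ℕ → ℝ)) : ℝ≥0∞ :=
  ∑' n, Set.indicator {x : (ℕ → ℕ) × (ℕ → ℝ) | ∑ i ∈ Finset.range (n + 1), x.2 i ≤ t ∧ x.1 n = k}
    (fun _ => 1) x

/-- The input sequences without the first ball. -/
def dropFirst (x : (ℕ → ℕ) × (ℕ → ℝ)) : (ℕ → ℕ) × (ℕ → ℝ) :=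
  (fun n => x.1 (n + 1), fun n => x.2 (n + 1))

/-- The numbers of balls still admissible after a ball fell into box `b` at time `s`. -/
noncomputable def demandAfter (t : ℕ → ℝ) (j : ℕ → ℕ) (y : ℕ × ℝ) (k : ℕ) : ℕ :=
  if y.2 ≤ t k ∧ y.1 = k then j k - 1 else j k

/-- The inputs for which each box `k ∈ A` contains less than `j k` balls at time `t k`. -/
def lateSet (A : Finset ℕ) (t : ℕ → ℝ) (j : ℕ → ℕ) : Set ((ℕ → ℕ) × (ℕ → ℝ)) :=
  {x | ∀ k ∈ A, count k (t k) x < j k}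

lemma count_eq (k : ℕ) (t : ℝ) (x : (ℕ → ℕ) × (ℕ → ℝ)) :
    count k t x = (if x.2 0 ≤ t ∧ x.1 0 = k then 1 else 0) + count k (t - x.2 0) (dropFirst x) := by
  unfold count
  rw [tsum_eq_zero_add' ENNReal.summable]
  congr 1
  · simp [Set.indicator_apply]
  · refine tsum_congr fun n => ?_
    simp only [Set.indicator_apply, Set.mem_ofPred_eq, dropFirst]
    simp only [Finset.sum_range_succ' _ (n + 1), le_sub_iff_add_le]

/-- True for `j = 0` as well, where both sides are false. This justifies the truncated subtraction
in `demandAfter`. -/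
lemma one_add_lt_iff (c : ℝ≥0∞) (j : ℕ) : 1 + c < j ↔ c < (j - 1 : ℕ) := by
  cases j with
  | zero => simp
  | succ j =>
    rw [Nat.add_sub_cancel, Nat.cast_succ, add_comm]
    exact ENNReal.add_lt_add_iff_right (by simp)

/-- The scheme restarts when the first ball is thrown: all times move back by its waiting time, and
only the demand of the box which it hits in time changes. -/
lemma mem_lateSet_iff (A : Finset ℕ) (t : ℕ → ℝ) (j : ℕ → ℕ) (x : (ℕ → ℕ) × (ℕ → ℝ)) :
    x ∈ lateSet A t j ↔ dropFirst x ∈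
      lateSet A (fun k => t k - x.2 0) (demandAfter t j (x.1 0, x.2 0)) := by
  refine forall₂_congr fun k _ => ?_
  rw [count_eq, demandAfter]
  split_ifs with h
  · exact one_add_lt_iff _ _
  · rw [zero_add]

lemma measurable_count_sub (k : ℕ) (t : ℝ) :
    Measurable fun z : (ℕ × ℝ) × ((ℕ → ℕ) × (ℕ → ℝ)) => count k (t - z.1.2) z.2 := by
  unfold count
  refine Measurable.tsum fun n => ?_
  have : (fun z : (ℕ × ℝ) × ((ℕ → ℕ) × (ℕ → ℝ)) =>
      Set.indicator {x : (ℕ → ℕ) × (ℕ → ℝ) |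
        ∑ i ∈ Finset.range (n + 1), x.2 i ≤ t - z.1.2 ∧ x.1 n = k} (fun _ => (1 : ℝ≥0∞)) z.2) =
      Set.indicator {z : (ℕ × ℝ) × ((ℕ → ℕ) × (ℕ → ℝ)) |
        ∑ i ∈ Finset.range (n + 1), z.2.2 i ≤ t - z.1.2 ∧ z.2.1 n = k} (fun _ => 1) := by
    ext z; simp [Set.indicator_apply]
  rw [this]
  refine measurable_const.indicator ?_
  rw [Set.ofPred_and]
  refine (measurableSet_le ?_ ?_).inter (measurableSet_eq_fun ?_ ?_)
  · exact Finset.measurable_sum _ fun i _ => by fun_prop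
  all_goals fun_prop

lemma measurable_count (k : ℕ) (t : ℝ) : Measurable (count k t) := by
  have := (measurable_count_sub k t).comp
    (f := fun x : (ℕ → ℕ) × (ℕ → ℝ) => (((0, 0) : ℕ × ℝ), x)) (by fun_prop)
  simpa [Function.comp_def] using this

lemma measurable_demandAfter (t : ℕ → ℝ) (j : ℕ → ℕ) (k : ℕ) :
    Measurable fun y : ℕ × ℝ => demandAfter t j y k := by
  unfold demandAfter
  refine Measurable.ite ?_ measurable_const measurable_const
  exact (measurableSet_le measurable_snd measurable_const).inter
    (measurableSet_eq_fun measurable_fst measurable_const)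

lemma measurableSet_lateSet_step (A : Finset ℕ) (t : ℕ → ℝ) (j : ℕ → ℕ) :
    MeasurableSet {z : (ℕ × ℝ) × ((ℕ → ℕ) × (ℕ → ℝ)) |
      z.2 ∈ lateSet A (fun k => t k - z.1.2) (demandAfter t j z.1)} := by
  have : {z : (ℕ × ℝ) × ((ℕ → ℕ) × (ℕ → ℝ)) |
      z.2 ∈ lateSet A (fun k => t k - z.1.2) (demandAfter t j z.1)} =
      ⋂ k ∈ A, {z | count k (t k - z.1.2) z.2 < (demandAfter t j z.1 k : ℝ≥0∞)} := by
    ext; simp [lateSet]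
  rw [this]
  refine Finset.measurableSet_biInter _ fun k _ =>
    measurableSet_lt (measurable_count_sub k _) ?_
  exact (measurable_from_top (f := fun n : ℕ => (n : ℝ≥0∞))).comp
    ((measurable_demandAfter t j k).comp measurable_fst)

section

variable {Ω : Type*} [MeasurableSpace Ω] {P : Measure Ω}

lemma comap_prodMk_eq_generateFrom {Ω α β : Type*} [MeasurableSpace α] [MeasurableSpace β]
    (f : Ω → α) (g : Ω → β) :
    MeasurableSpace.comap (fun ω => (f ω, g ω)) Prod.instMeasurableSpace =
      MeasurableSpace.generateFrom {s | ∃ u ∈ Set.image2 (· ×ˢ ·) {s : Set α | MeasurableSet s}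
        {t : Set β | MeasurableSet t}, (fun ω => (f ω, g ω)) ⁻¹' u = s} := by
  rw [← generateFrom_prod, MeasurableSpace.comap_generateFrom]
  rfl

/-- Two independent pairs with independent components can be regrouped. -/
lemma IndepFun.prodMk_prodMk_of_prod {α β γ δ : Type*} [MeasurableSpace α] [MeasurableSpace β]
    [MeasurableSpace γ] [MeasurableSpace δ] [IsProbabilityMeasure P] {X₀ : Ω → α} {X₁ : Ω → β}
    {Y₀ : Ω → γ} {Y₁ : Ω → δ} (hX₀ : Measurable X₀) (hX₁ : Measurable X₁) (hY₀ : Measurable Y₀)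
    (hY₁ : Measurable Y₁) (hX : IndepFun X₀ X₁ P) (hY : IndepFun Y₀ Y₁ P)
    (hXY : IndepFun (fun ω => (X₀ ω, X₁ ω)) (fun ω => (Y₀ ω, Y₁ ω)) P) :
    IndepFun (fun ω => (X₀ ω, Y₀ ω)) (fun ω => (X₁ ω, Y₁ ω)) P := by
  have key : ∀ (a : Set α) (b : Set β) (c : Set γ) (d : Set δ), MeasurableSet a →
      MeasurableSet b → MeasurableSet c → MeasurableSet d →
      P ((fun ω => (X₀ ω, Y₀ ω)) ⁻¹' (a ×ˢ c) ∩ (fun ω => (X₁ ω, Y₁ ω)) ⁻¹' (b ×ˢ d)) =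
        P (X₀ ⁻¹' a) * P (X₁ ⁻¹' b) * (P (Y₀ ⁻¹' c) * P (Y₁ ⁻¹' d)) := by
    intro a b c d ha hb hc hd
    rw [← hX.measure_inter_preimage_eq_mul _ _ ha hb, ← hY.measure_inter_preimage_eq_mul _ _ hc hd]
    have := hXY.measure_inter_preimage_eq_mul _ _ (ha.prod hb) (hc.prod hd)
    have e1 : X₀ ⁻¹' a ∩ X₁ ⁻¹' b = (fun ω => (X₀ ω, X₁ ω)) ⁻¹' (a ×ˢ b) := by
      ext; simp
    have e2 : Y₀ ⁻¹' c ∩ Y₁ ⁻¹' d = (fun ω => (Y₀ ω, Y₁ ω)) ⁻¹' (c ×ˢ d) := by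
      ext; simp
    rw [e1, e2, ← this]
    congr 1
    ext; simp; tauto
  rw [IndepFun_iff_Indep]
  refine IndepSets.indep (hX₀.prodMk hY₀).comap_le (hX₁.prodMk hY₁).comap_le (isPiSystem_prod.comap _)
    (isPiSystem_prod.comap _) (comap_prodMk_eq_generateFrom X₀ Y₀)
    (comap_prodMk_eq_generateFrom X₁ Y₁) ?_
  rw [IndepSets_iff]
  rintro _ _ ⟨_, ⟨a, ha, c, hc, rfl⟩, rfl⟩ ⟨_, ⟨b, hb, d, hd, rfl⟩, rfl⟩
  have h := key a b c d ha hb hc hd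
  have h1 := key a Set.univ c Set.univ ha MeasurableSet.univ hc MeasurableSet.univ
  have h2 := key Set.univ b Set.univ d MeasurableSet.univ hb MeasurableSet.univ hd
  simp only [Set.univ_prod_univ, Set.preimage_univ, Set.inter_univ, Set.univ_inter, measure_univ,
    mul_one, one_mul] at h1 h2
  rw [h, h1, h2]
  ring

lemma iIndepFun.indepFun_zero_succ {α : Type*} [MeasurableSpace α] {X : ℕ → Ω → α}
    (hX : ∀ n, Measurable (X n)) (h : iIndepFun X P) :
    IndepFun (X 0) (fun ω n => X (n + 1) ω) P := by
  have h' := indep_iSup_of_disjoint (m := fun n => MeasurableSpace.comap (X n) inferInstance)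
    (fun n => (hX n).comap_le) h (S := {0}) (T := {n | 1 ≤ n}) (by simp)
  rw [IndepFun_iff_Indep]
  refine indep_of_indep_of_le_left (indep_of_indep_of_le_right h' ?_) ?_
  · have : Measurable[⨆ n ∈ {n | 1 ≤ n}, MeasurableSpace.comap (X n) inferInstance]
        (fun ω n => X (n + 1) ω) := by
      refine @measurable_pi_lambda _ _ _ (_) _ _ fun n => ?_
      refine Measurable.mono (comap_measurable (X (n + 1))) ?_ le_rfl
      exact le_iSup₂_of_le (n + 1) (by simp) le_rfl
    exact this.comap_le
  · simp

variable {p : ℕ → ℝ} {box : ℕ → Ω → ℕ} {gap : ℕ → Ω → ℝ}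

/-- The input sequences of the scheme, as one random element. -/
def input (box : ℕ → Ω → ℕ) (gap : ℕ → Ω → ℝ) (ω : Ω) : (ℕ → ℕ) × (ℕ → ℝ) :=
  (fun n => box n ω, fun n => gap n ω)

namespace IsPoissonizedScheme

lemma measurable_input (h : IsPoissonizedScheme P p box gap) : Measurable (input box gap) :=
  (measurable_pi_lambda _ h.measurable_box).prodMk (measurable_pi_lambda _ h.measurable_gap)

lemma shift (h : IsPoissonizedScheme P p box gap) :
    IsPoissonizedScheme P p (fun n => box (n + 1)) (fun n => gap (n + 1)) where
  measurable_box n := h.measurable_box _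
  measurable_gap n := h.measurable_gap _
  law_box n := h.law_box _
  law_gap n := h.law_gap _
  indep_box := h.indep_box.precomp (add_left_injective 1)
  indep_gap := h.indep_gap.precomp (add_left_injective 1)
  indep_box_gap := h.indep_box_gap.comp (φ := fun (b : ℕ → ℕ) n => b (n + 1))
    (ψ := fun (g : ℕ → ℝ) n => g (n + 1))
    (by fun_prop) (by fun_prop)

lemma indepFun_first_dropFirst [IsProbabilityMeasure P] (h : IsPoissonizedScheme P p box gap) :
    IndepFun (fun ω => (box 0 ω, gap 0 ω))
      (input (fun n => box (n + 1)) (fun n => gap (n + 1))) P := by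
  refine IndepFun.prodMk_prodMk_of_prod (h.measurable_box 0)
    (measurable_pi_lambda _ fun n => h.measurable_box (n + 1)) (h.measurable_gap 0)
    (measurable_pi_lambda _ fun n => h.measurable_gap (n + 1))
    (iIndepFun.indepFun_zero_succ h.measurable_box h.indep_box)
    (iIndepFun.indepFun_zero_succ h.measurable_gap h.indep_gap) ?_
  exact h.indep_box_gap.comp (φ := fun b : ℕ → ℕ => (b 0, fun n => b (n + 1)))
    (ψ := fun g : ℕ → ℝ => (g 0, fun n => g (n + 1))) (by fun_prop) (by fun_prop)

lemma map_first [IsProbabilityMeasure P] (h : IsPoissonizedScheme P p box gap) :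
    P.map (fun ω => (box 0 ω, gap 0 ω)) = (P.map (box 0)).prod (expMeasure 1) := by
  have : IndepFun (box 0) (gap 0) P :=
    h.indep_box_gap.comp (φ := fun b : ℕ → ℕ => b 0) (ψ := fun g : ℕ → ℝ => g 0) (by fun_prop) (by fun_prop)
  rw [this.map_prod_eq_prod_map_map (h.measurable_box 0).aemeasurable
    (h.measurable_gap 0).aemeasurable, h.law_gap]

/-- First-step analysis. -/
lemma measureReal_lateSet_eq [IsProbabilityMeasure P] (h : IsPoissonizedScheme P p box gap)
    (A : Finset ℕ) (t : ℕ → ℝ) (j : ℕ → ℕ) :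
    Measurable (fun y : ℕ × ℝ => P.real (input (fun n => box (n + 1)) (fun n => gap (n + 1)) ⁻¹'
        lateSet A (fun k => t k - y.2) (demandAfter t j y))) ∧
    P.real (input box gap ⁻¹' lateSet A t j) =
      ∫ y, P.real (input (fun n => box (n + 1)) (fun n => gap (n + 1)) ⁻¹'
        lateSet A (fun k => t k - y.2) (demandAfter t j y)) ∂((P.map (box 0)).prod (expMeasure 1)) := by
  set W := {z : (ℕ × ℝ) × ((ℕ → ℕ) × (ℕ → ℝ)) |
      z.2 ∈ lateSet A (fun k => t k - z.1.2) (demandAfter t j z.1)} with hW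
  have hWm : MeasurableSet W := measurableSet_lateSet_step A t j
  set I := input (fun n => box (n + 1)) (fun n => gap (n + 1)) with hI
  have hIm : Measurable I := h.shift.measurable_input
  have h0m : Measurable fun ω => (box 0 ω, gap 0 ω) :=
    (h.measurable_box 0).prodMk (h.measurable_gap 0)
  have hset : input box gap ⁻¹' lateSet A t j = (fun ω => ((box 0 ω, gap 0 ω), I ω)) ⁻¹' W := by
    ext ω
    rw [Set.mem_preimage, mem_lateSet_iff]
    rfl
  have hsec : ∀ y : ℕ × ℝ, (P.map I) (Prod.mk y ⁻¹' W) =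
      P (I ⁻¹' lateSet A (fun k => t k - y.2) (demandAfter t j y)) := fun y => by
    rw [Measure.map_apply hIm (measurable_prodMk_left hWm)]
    rfl
  have : IsProbabilityMeasure (P.map I) := Measure.isProbabilityMeasure_map hIm.aemeasurable
  have hmeas : Measurable fun y : ℕ × ℝ => (P.map I) (Prod.mk y ⁻¹' W) :=
    measurable_measure_prodMk_left hWm
  simp_rw [hsec] at hmeas
  refine ⟨hmeas.ennreal_toReal, ?_⟩
  rw [hset, measureReal_def, ← Measure.map_apply (h0m.prodMk hIm) hWm,
    h.indepFun_first_dropFirst.map_prod_eq_prod_map_map h0m.aemeasurable hIm.aemeasurable,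
    Measure.prod_apply hWm, h.map_first]
  simp_rw [hsec]
  simp_rw [measureReal_def]
  rw [integral_toReal hmeas.aemeasurable (ae_of_all _ fun y => measure_lt_top _ _)]

end IsPoissonizedScheme

end

end Karlin

/-! ### The product of Poisson probabilities solves the first-step equation. -/

namespace Karlin

/-- The probability that independent Poisson processes with rates `p k`, `k ∈ A`, have less than
`j k` points at time `t k`. -/
noncomputable def lateProd (p : ℕ → ℝ) (A : Finset ℕ) (t : ℕ → ℝ) (j : ℕ → ℕ) : ℝ :=
  ∏ k ∈ A, poisLt (j k) (p k * max (t k) 0)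

lemma integral_expMeasure_one (f : ℝ → ℝ) :
    ∫ s, f s ∂(expMeasure 1) = ∫ s in Set.Ioi 0, Real.exp (-s) * f s := by
  have hd : expMeasure 1 = volume.withDensity (exponentialPDF 1) := rfl
  have hm : Measurable (exponentialPDF 1) := (measurable_gammaPDFReal 1 1).ennreal_ofReal
  rw [hd, integral_withDensity_eq_integral_toReal_smul hm (ae_of_all _ fun x => by
    simp [exponentialPDF]), ← integral_Ici_eq_integral_Ioi, ← integral_indicator measurableSet_Ici]
  congr 1
  ext s
  rw [exponentialPDF_eq]
  by_cases hs : 0 ≤ s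
  · simp [hs, Real.exp_nonneg]
  · simp [hs]

lemma expMeasure_one_real_Iic {T : ℝ} (hT : 0 ≤ T) :
    (expMeasure 1).real (Set.Iic T) = 1 - Real.exp (-T) := by
  have := cdf_expMeasure_eq one_pos T
  have hp : IsProbabilityMeasure (expMeasure 1) := isProbabilityMeasure_expMeasure one_pos
  rw [cdf_eq_real] at this
  rw [this]; simp [hT]

lemma expMeasure_one_ae_pos : ∀ᵐ s ∂(expMeasure 1), 0 < s := by
  have hp : IsProbabilityMeasure (expMeasure 1) := isProbabilityMeasure_expMeasure one_pos
  have h := expMeasure_one_real_Iic le_rfl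
  simp only [neg_zero, Real.exp_zero, sub_self] at h
  rw [measureReal_eq_zero_iff] at h
  rw [ae_iff]
  convert h using 2
  ext; simp

section

variable {p : ℕ → ℝ} (hp : ∀ k, 0 ≤ p k)

include hp

lemma lateProd_nonneg (A : Finset ℕ) (t : ℕ → ℝ) (j : ℕ → ℕ) : 0 ≤ lateProd p A t j :=
  Finset.prod_nonneg fun k _ => poisLt_nonneg _ (mul_nonneg (hp k) (le_max_right _ _))

lemma lateProd_le_one (A : Finset ℕ) (t : ℕ → ℝ) (j : ℕ → ℕ) : lateProd p A t j ≤ 1 :=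
  Finset.prod_le_one (fun k _ => poisLt_nonneg _ (mul_nonneg (hp k) (le_max_right _ _)))
    fun k _ => poisLt_le_one _ (mul_nonneg (hp k) (le_max_right _ _))

end

/-- The effect of a ball in box `k` at time `s` on `lateProd`. -/
noncomputable def lateJump (p : ℕ → ℝ) (A : Finset ℕ) (t : ℕ → ℝ) (j : ℕ → ℕ) (k : ℕ) (s : ℝ) : ℝ :=
  Set.indicator (Set.Iic (t k)) (fun s =>
    (∏ i ∈ A.erase k, poisLt (j i) (p i * max (t i - s) 0)) *
      (poisLt (j k - 1) (p k * max (t k - s) 0) - poisLt (j k) (p k * max (t k - s) 0))) s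

/-- The ball changes at most one factor, so at most one summand on the right is nonzero. In this
form each term is a function of the box times a function of the time and integrates against a
product measure at once. -/
lemma lateProd_demandAfter (p : ℕ → ℝ) (A : Finset ℕ) (t : ℕ → ℝ) (j : ℕ → ℕ) (y : ℕ × ℝ) :
    lateProd p A (fun k => t k - y.2) (demandAfter t j y) =
      lateProd p A (fun k => t k - y.2) j +
        ∑ k ∈ A, Set.indicator {k} (fun _ => (1 : ℝ)) y.1 * lateJump p A t j k y.2 := by
  obtain ⟨b, s⟩ := y
  by_cases hb : b ∈ A ∧ s ≤ t b
  · obtain ⟨hb, hs⟩ := hb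
    rw [Finset.sum_eq_single b]
    · simp only [Set.mem_singleton_iff, Set.indicator_of_mem, one_mul, lateJump, lateProd]
      rw [Set.indicator_of_mem (by simpa using hs), ← Finset.mul_prod_erase A _ hb,
        ← Finset.mul_prod_erase A _ hb]
      have : ∏ i ∈ A.erase b, poisLt (demandAfter t j (b, s) i) (p i * max (t i - s) 0) =
          ∏ i ∈ A.erase b, poisLt (j i) (p i * max (t i - s) 0) := by
        refine Finset.prod_congr rfl fun i hi => ?_
        have : b ≠ i := (Finset.ne_of_mem_erase hi).symm
        simp [demandAfter, this]
      rw [this]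
      have : demandAfter t j (b, s) b = j b - 1 := by simp [demandAfter, hs]
      rw [this]
      ring
    · intro k _ hk
      simp [Ne.symm hk]
    · exact fun h => absurd hb h
  · rw [Finset.sum_eq_zero, add_zero]
    · refine Finset.prod_congr rfl fun i hi => ?_
      have : ¬ (s ≤ t i ∧ b = i) := by
        rintro ⟨h1, rfl⟩
        exact hb ⟨hi, h1⟩
      simp [demandAfter, this]
    · intro k hk
      by_cases h : b = k
      · subst h
        have hs : ¬ s ≤ t b := fun h => hb ⟨hk, h⟩
        simp [lateJump, hs]
      · simp [h]

lemma continuous_lateProd_sub (p : ℕ → ℝ) (A : Finset ℕ) (t : ℕ → ℝ) (j : ℕ → ℕ) :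
    Continuous fun s => lateProd p A (fun k => t k - s) j :=
  continuous_finsetProd _ fun k _ => (continuous_poisLt _).comp (by fun_prop)

lemma measurable_lateJump (p : ℕ → ℝ) (A : Finset ℕ) (t : ℕ → ℝ) (j : ℕ → ℕ) (k : ℕ) :
    Measurable (lateJump p A t j k) := by
  refine Measurable.indicator (Continuous.measurable ?_) measurableSet_Iic
  refine (continuous_finsetProd _ fun k _ => (continuous_poisLt _).comp (by fun_prop)).mul ?_
  exact ((continuous_poisLt _).comp (by fun_prop)).sub ((continuous_poisLt _).comp (by fun_prop))

lemma abs_lateJump_le {p : ℕ → ℝ} (hp : ∀ k, 0 ≤ p k) (A : Finset ℕ) (t : ℕ → ℝ) (j : ℕ → ℕ)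
    (k : ℕ) (s : ℝ) : |lateJump p A t j k s| ≤ 1 := by
  have hn : ∀ i, 0 ≤ p i * max (t i - s) 0 := fun i => mul_nonneg (hp i) (le_max_right _ _)
  unfold lateJump Set.indicator
  split_ifs
  · rw [abs_mul, Finset.abs_prod]
    refine mul_le_one₀ (Finset.prod_le_one (fun i _ => abs_nonneg _) fun i _ => ?_)
      (abs_nonneg _) ?_
    · rw [abs_of_nonneg (poisLt_nonneg _ (hn i))]; exact poisLt_le_one _ (hn i)
    · have h1 := poisLt_nonneg (j k - 1) (hn k)
      have h2 := poisLt_nonneg (j k) (hn k)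
      have h3 := poisLt_le_one (j k - 1) (hn k)
      have h4 := poisLt_le_one (j k) (hn k)
      rw [abs_le]; constructor <;> linarith
  · simp

lemma integrableOn_exp_neg_mul {f : ℝ → ℝ} (hf : Measurable f) {C : ℝ} (hC : ∀ s, |f s| ≤ C) :
    IntegrableOn (fun s => Real.exp (-s) * f s) (Set.Ioi 0) := by
  have : IntegrableOn (fun s : ℝ => Real.exp (-s)) (Set.Ioi 0) := integrableOn_exp_neg_Ioi 0
  exact this.mul_bdd hf.aestronglyMeasurable (ae_of_all _ fun s => by simpa using hC s)

/-- Clipping at `0` encodes that nothing happens before time `0`. It costs a kink at `s = t`, which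
is why the fundamental theorem of calculus is later used off a finite set. -/
lemma hasDerivAt_poisLt_max (r t : ℝ) (j : ℕ) {s : ℝ} (hs : s ≠ t) :
    HasDerivAt (fun s => poisLt j (r * max (t - s) 0))
      (-(r * Set.indicator (Set.Iic t) (fun s => poisLt (j - 1) (r * max (t - s) 0) -
        poisLt j (r * max (t - s) 0)) s)) s := by
  rcases lt_or_gt_of_ne hs with h | h
  · have h1 : (fun s => poisLt j (r * max (t - s) 0)) =ᶠ[𝓝 s] fun s => poisLt j (r * (t - s)) := by
      filter_upwards [gt_mem_nhds h] with u hu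
      rw [max_eq_left (by linarith)]
    have h2 : HasDerivAt (fun s => r * (t - s)) (r * (-1)) s := by
      simpa using ((hasDerivAt_id s).const_sub t).const_mul r
    have h3 := (hasDerivAt_poisLt j (r * (t - s))).comp s h2
    refine (h3.congr_of_eventuallyEq h1).congr_deriv ?_
    rw [Set.indicator_of_mem (by simpa using h.le), max_eq_left (by linarith)]
    ring
  · have h1 : (fun s => poisLt j (r * max (t - s) 0)) =ᶠ[𝓝 s] fun s => poisLt j (r * 0) := by
      filter_upwards [lt_mem_nhds h] with u hu
      rw [max_eq_right (by linarith)]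
    refine ((hasDerivAt_const s _).congr_of_eventuallyEq h1).congr_deriv ?_
    rw [Set.indicator_of_notMem (by simpa using h)]
    simp

lemma hasDerivAt_lateProd_sub (p : ℕ → ℝ) (A : Finset ℕ) (t : ℕ → ℝ) (j : ℕ → ℕ) {s : ℝ}
    (hs : ∀ k ∈ A, s ≠ t k) :
    HasDerivAt (fun s => lateProd p A (fun k => t k - s) j)
      (-∑ k ∈ A, p k * lateJump p A t j k s) s := by
  unfold lateProd
  have := HasDerivAt.fun_finsetProd (u := A) (x := s)
    (f := fun k s => poisLt (j k) (p k * max (t k - s) 0))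
    fun k hk => hasDerivAt_poisLt_max (p k) (t k) (j k) (hs k hk)
  refine this.congr_deriv ?_
  rw [← Finset.sum_neg_distrib]
  refine Finset.sum_congr rfl fun k _ => ?_
  rw [lateJump, smul_eq_mul]
  by_cases h : s ∈ Set.Iic (t k)
  · simp only [Set.indicator_of_mem h]; ring
  · simp only [Set.indicator_of_notMem h]; ring

/-- With `Φ s` the product at times `t k - s`, the integrand is minus the derivative of `exp (-s) *
Φ s`, so the integral is `Φ 0`. Beyond the largest time `Φ` is constant and the tail is integrated
directly. -/
lemma setIntegral_lateProd {p : ℕ → ℝ} (hp : ∀ k, 0 ≤ p k) (A : Finset ℕ) (t : ℕ → ℝ)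
    (j : ℕ → ℕ) :
    ∫ s in Set.Ioi 0, Real.exp (-s) * (lateProd p A (fun k => t k - s) j +
      ∑ k ∈ A, p k * lateJump p A t j k s) = lateProd p A t j := by
  set Φ := fun s => lateProd p A (fun k => t k - s) j with hΦ
  set J := fun s => Φ s + ∑ k ∈ A, p k * lateJump p A t j k s with hJ
  have hJm : Measurable J := (continuous_lateProd_sub p A t j).measurable.add
    (Finset.measurable_sum _ fun k _ => (measurable_lateJump p A t j k).const_mul _)
  have hJb : ∀ s, |J s| ≤ 1 + ∑ k ∈ A, p k := fun s => by
    refine (abs_add_le _ _).trans (add_le_add ?_ ((Finset.abs_sum_le_sum_abs _ _).trans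
      (Finset.sum_le_sum fun k _ => ?_)))
    · rw [abs_of_nonneg (lateProd_nonneg hp _ _ _)]; exact lateProd_le_one hp _ _ _
    · rw [abs_mul, abs_of_nonneg (hp k)]
      exact mul_le_of_le_one_right (hp k) (abs_lateJump_le hp A t j k s)
  have hint := integrableOn_exp_neg_mul hJm hJb
  obtain ⟨T, hT0, hT⟩ : ∃ T : ℝ, 0 ≤ T ∧ ∀ k ∈ A, t k ≤ T := by
    refine ⟨∑ k ∈ A, |t k|, Finset.sum_nonneg fun _ _ => abs_nonneg _, fun k hk => ?_⟩
    exact (le_abs_self _).trans (Finset.single_le_sum (f := fun k => |t k|)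
      (fun _ _ => abs_nonneg _) hk)
  rw [← Set.Ioc_union_Ioi_eq_Ioi hT0, setIntegral_union (Set.Ioc_disjoint_Ioi le_rfl)
    measurableSet_Ioi (hint.mono_set Set.Ioc_subset_Ioi_self)
    (hint.mono_set (Set.Ioi_subset_Ioi hT0))]
  have h2 : ∫ s in Set.Ioi T, Real.exp (-s) * J s = Real.exp (-T) * Φ T := by
    rw [← integral_exp_neg_Ioi T, ← integral_mul_const]
    refine setIntegral_congr_fun measurableSet_Ioi fun s hs => ?_
    have hs' : T < s := hs
    have e1 : Φ s = Φ T := by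
      refine Finset.prod_congr rfl fun k hk => ?_
      have := hT k hk
      simp only
      rw [max_eq_right (by linarith), max_eq_right (by linarith)]
    have e2 : ∑ k ∈ A, p k * lateJump p A t j k s = 0 := by
      refine Finset.sum_eq_zero fun k hk => ?_
      rw [lateJump, Set.indicator_of_notMem (by simpa using (hT k hk).trans_lt hs'), mul_zero]
    simp only [hJ, e1, e2, add_zero]
  have h1 : ∫ s in Set.Ioc 0 T, Real.exp (-s) * J s = Φ 0 - Real.exp (-T) * Φ T := by
    rw [← intervalIntegral.integral_of_le hT0]
    have := integral_eq_of_hasDerivAt_off_countable (a := 0) (b := T)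
      (fun s => -(Real.exp (-s) * Φ s)) (fun s => Real.exp (-s) * J s) (s := t '' A)
      ((A.finite_toSet.image t).countable)
      (((Real.continuous_exp.comp continuous_neg).mul
        (continuous_lateProd_sub p A t j)).neg.continuousOn) ?_ ?_
    · rw [this]; simp; ring
    · intro s hs
      have hd := hasDerivAt_lateProd_sub p A t j (s := s) fun k hk h => hs.2 ⟨k, hk, h.symm⟩
      have hexp : HasDerivAt (fun s => Real.exp (-s)) (-Real.exp (-s)) s := by
        simpa using (hasDerivAt_neg s).exp
      refine ((hexp.mul hd).neg).congr_deriv ?_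
      simp only [hJ, hΦ]; ring
    · rw [intervalIntegrable_iff_integrableOn_Ioc_of_le hT0]
      exact hint.mono_set Set.Ioc_subset_Ioi_self
  rw [h1, h2]
  simp [hΦ]

/-- This says that `lateProd` is a fixed point of the operator in `measureReal_lateSet_eq`. Only
boxes in `A` enter the sum, a ball elsewhere having no effect. -/
lemma integral_lateProd_step {p : ℕ → ℝ} (hp : ∀ k, 0 ≤ p k) {μ : Measure ℕ}
    [IsProbabilityMeasure μ] (hμ : ∀ k, μ.real {k} = p k) (A : Finset ℕ) (t : ℕ → ℝ)
    (j : ℕ → ℕ) :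
    Measurable (fun y : ℕ × ℝ => lateProd p A (fun k => t k - y.2) (demandAfter t j y)) ∧
    ∫ y, lateProd p A (fun k => t k - y.2) (demandAfter t j y) ∂(μ.prod (expMeasure 1)) =
      lateProd p A t j := by
  have : IsProbabilityMeasure (expMeasure 1) := isProbabilityMeasure_expMeasure one_pos
  have hΦm := (continuous_lateProd_sub p A t j).measurable
  have hi : ∀ k, Measurable fun b : ℕ => Set.indicator {k} (fun _ => (1 : ℝ)) b :=
    fun k => measurable_const.indicator (measurableSet_singleton k)
  have hkm : ∀ k, Measurable fun y : ℕ × ℝ =>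
      Set.indicator {k} (fun _ => (1 : ℝ)) y.1 * lateJump p A t j k y.2 := fun k =>
    ((hi k).comp measurable_fst).mul ((measurable_lateJump p A t j k).comp measurable_snd)
  have hΦi : Integrable (fun s => lateProd p A (fun k => t k - s) j) (expMeasure 1) :=
    Integrable.of_bound hΦm.aestronglyMeasurable 1 (ae_of_all _ fun s => by
      rw [Real.norm_of_nonneg (lateProd_nonneg hp _ _ _)]; exact lateProd_le_one hp _ _ _)
  have hJi : ∀ k, Integrable (lateJump p A t j k) (expMeasure 1) := fun k =>
    Integrable.of_bound (measurable_lateJump p A t j k).aestronglyMeasurable 1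
      (ae_of_all _ fun s => abs_lateJump_le hp A t j k s)
  have h1i : ∀ k, Integrable (fun b : ℕ => Set.indicator {k} (fun _ => (1 : ℝ)) b) μ := fun k =>
    (integrable_const _).indicator (measurableSet_singleton k)
  simp_rw [lateProd_demandAfter]
  refine ⟨(hΦm.comp measurable_snd).add (Finset.measurable_sum _ fun k _ => hkm k), ?_⟩
  rw [integral_add (hΦi.comp_snd μ) (integrable_finsetSum _ fun k _ => (h1i k).mul_prod (hJi k)),
    integral_finsetSum _ fun k _ => (h1i k).mul_prod (hJi k)]
  simp_rw [fun k => integral_prod_mul (μ := μ) (ν := expMeasure 1)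
    (fun b : ℕ => Set.indicator {k} (fun _ => (1 : ℝ)) b) (lateJump p A t j k)]
  rw [integral_fun_snd (μ := μ) (ν := expMeasure 1)
    (fun s => lateProd p A (fun k => t k - s) j)]
  simp only [probReal_univ, one_smul]
  have : ∀ k, ∫ b : ℕ, Set.indicator {k} (fun _ => (1 : ℝ)) b ∂μ = p k := fun k => by
    rw [integral_indicator_const _ (measurableSet_singleton k), hμ]; simp
  simp_rw [this]
  rw [← setIntegral_lateProd hp A t j, ← integral_expMeasure_one, integral_add hΦi
    (integrable_finsetSum _ fun k _ => (hJi k).const_mul _),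
    integral_finsetSum _ fun k _ => (hJi k).const_mul _]
  simp_rw [integral_const_mul]

end Karlin

/-! ### Uniqueness for the first-step equation, and the law of the box counts. -/

namespace Karlin

lemma count_eq_zero_of_neg {k : ℕ} {t : ℝ} (ht : t < 0) {x : (ℕ → ℕ) × (ℕ → ℝ)}
    (hx : ∀ n, 0 < x.2 n) : count k t x = 0 := by
  refine ENNReal.tsum_eq_zero.2 fun n => ?_
  refine Set.indicator_of_notMem (fun h => ?_) _
  have := Finset.sum_nonneg fun i (_ : i ∈ Finset.range (n + 1)) => (hx i).le
  exact absurd h.1 (by linarith)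

namespace IsPoissonizedScheme

variable {Ω : Type*} [MeasurableSpace Ω] {P : Measure Ω} [IsProbabilityMeasure P]
  {p : ℕ → ℝ} {box : ℕ → Ω → ℕ} {gap : ℕ → Ω → ℝ}

omit [IsProbabilityMeasure P] in
lemma ae_gap_pos (h : IsPoissonizedScheme P p box gap) : ∀ᵐ ω ∂P, ∀ n, 0 < gap n ω := by
  refine ae_all_iff.2 fun n => ?_
  have := expMeasure_one_ae_pos
  rw [← h.law_gap n] at this
  exact ae_of_ae_map (h.measurable_gap n).aemeasurable this

/-- No ball is thrown before time `0`, so the event is almost surely empty or everything. It settles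
the case in which the first waiting time exceeds all `t k`. -/
lemma measureReal_lateSet_of_neg (h : IsPoissonizedScheme P p box gap) (A : Finset ℕ)
    {t : ℕ → ℝ} (j : ℕ → ℕ) (ht : ∀ k ∈ A, t k < 0) :
    P.real (input box gap ⁻¹' lateSet A t j) = lateProd p A t j := by
  have hprod : lateProd p A t j = ∏ k ∈ A, if 1 ≤ j k then (1 : ℝ) else 0 := by
    refine Finset.prod_congr rfl fun k hk => ?_
    rw [max_eq_right (ht k hk).le, mul_zero]
    split_ifs with hj
    · exact poisLt_at_zero hj
    · have : j k = 0 := by omega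
      rw [this, poisLt_zero]
  have hset : (input box gap ⁻¹' lateSet A t j : Set Ω) =ᵐ[P] {_ω : Ω | ∀ k ∈ A, 1 ≤ j k} := by
    filter_upwards [h.ae_gap_pos] with ω hω
    refine propext (forall₂_congr fun k hk => ?_)
    rw [count_eq_zero_of_neg (ht k hk) hω]
    simp [Nat.one_le_iff_ne_zero, Nat.pos_iff_ne_zero]
  rw [measureReal_congr hset, hprod]
  by_cases hA : ∀ k ∈ A, 1 ≤ j k
  · have hu : {_ω : Ω | ∀ k ∈ A, 1 ≤ j k} = Set.univ := Set.eq_univ_of_forall fun _ => hA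
    rw [Finset.prod_congr rfl fun k hk => if_pos (hA k hk), hu]
    simp
  · obtain ⟨k, hk, hjk⟩ : ∃ k ∈ A, ¬ 1 ≤ j k := by simpa using hA
    rw [Finset.prod_eq_zero hk (if_neg hjk)]
    simp [hA]

/-- Both sides satisfy the same first-step equation and agree once the first ball comes after `T`.
The discrepancy thus survives only if the first waiting time is at most `T`, which contributes a
factor `1 - exp (-T)` at each step. The shifted times stay below `T`, and the induction runs over
all schemes because the shifted scheme is again one. -/
lemma abs_measureReal_lateSet_sub_le (hp : ∀ k, 0 ≤ p k) {T : ℝ} (hT : 0 ≤ T) (n : ℕ)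
    (h : IsPoissonizedScheme P p box gap) (A : Finset ℕ)
    (t : ℕ → ℝ) (j : ℕ → ℕ) (ht : ∀ k ∈ A, t k ≤ T) :
    |P.real (input box gap ⁻¹' lateSet A t j) - lateProd p A t j| ≤ (1 - Real.exp (-T)) ^ n := by
  have hr : 0 ≤ 1 - Real.exp (-T) := by
    have := Real.exp_le_one_iff.2 (by linarith : -T ≤ 0); linarith
  induction n generalizing box gap t j with
  | zero =>
    have h1 := lateProd_nonneg hp A t j
    have h2 := lateProd_le_one hp A t j
    have h3 : 0 ≤ P.real (input box gap ⁻¹' lateSet A t j) := measureReal_nonneg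
    have h4 : P.real (input box gap ⁻¹' lateSet A t j) ≤ 1 := measureReal_le_one
    rw [pow_zero, abs_le]; constructor <;> linarith
  | succ n ih =>
    have : IsProbabilityMeasure (expMeasure 1) := isProbabilityMeasure_expMeasure one_pos
    have : IsProbabilityMeasure (P.map (box 0)) :=
      Measure.isProbabilityMeasure_map (h.measurable_box 0).aemeasurable
    have hμ : ∀ k, (P.map (box 0)).real {k} = p k := fun k => by
      rw [measureReal_def, Measure.map_apply (h.measurable_box 0) (measurableSet_singleton k)]
      have : box 0 ⁻¹' {k} = {ω | box 0 ω = k} := by ext; simp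
      rw [this, h.law_box, ENNReal.toReal_ofReal (hp k)]
    obtain ⟨hm1, h1⟩ := h.measureReal_lateSet_eq A t j
    obtain ⟨hm2, h2⟩ := integral_lateProd_step hp hμ A t j
    have hi1 := Integrable.of_bound (μ := (P.map (box 0)).prod (expMeasure 1))
      hm1.aestronglyMeasurable 1 (ae_of_all _ fun y => by
        rw [Real.norm_of_nonneg measureReal_nonneg]; exact measureReal_le_one)
    have hi2 := Integrable.of_bound (μ := (P.map (box 0)).prod (expMeasure 1))
      hm2.aestronglyMeasurable 1 (ae_of_all _ fun y => by
        rw [Real.norm_of_nonneg (lateProd_nonneg hp _ _ _)]; exact lateProd_le_one hp _ _ _)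
    rw [h1, ← h2, ← integral_sub hi1 hi2]
    refine abs_integral_le_integral_abs.trans ?_
    have hpos : ∀ᵐ y ∂((P.map (box 0)).prod (expMeasure 1)), 0 < y.2 :=
      Measure.quasiMeasurePreserving_snd.ae expMeasure_one_ae_pos
    calc _ ≤ ∫ y : ℕ × ℝ, (Set.Iic T).indicator (fun _ => (1 - Real.exp (-T)) ^ n) y.2
          ∂((P.map (box 0)).prod (expMeasure 1)) := by
          refine integral_mono_ae (hi1.sub hi2).abs ?_ ?_
          · exact ((integrable_const _).indicator measurableSet_Iic).comp_snd _
          · filter_upwards [hpos] with y hy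
            by_cases hyT : y.2 ≤ T
            · rw [Set.indicator_of_mem (by simpa using hyT)]
              exact ih h.shift _ _ fun k hk => by linarith [ht k hk]
            · rw [Set.indicator_of_notMem (by simpa using hyT),
                measureReal_lateSet_of_neg h.shift A _ fun k hk => by
                  have := ht k hk; linarith, sub_self, abs_zero]
      _ = _ := by
          rw [integral_fun_snd (μ := P.map (box 0)) (ν := expMeasure 1)
            (fun s => (Set.Iic T).indicator (fun _ => (1 - Real.exp (-T)) ^ n) s),
            integral_indicator_const _ measurableSet_Iic, expMeasure_one_real_Iic hT, pow_succ]
          simp [mul_comm]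

/-- The box counts are independent Poisson processes, as far as their marginals at one time per box
are concerned. -/
theorem measureReal_lateSet (hp : ∀ k, 0 ≤ p k) (h : IsPoissonizedScheme P p box gap)
    (A : Finset ℕ) (t : ℕ → ℝ) (j : ℕ → ℕ) :
    P.real (input box gap ⁻¹' lateSet A t j) = lateProd p A t j := by
  obtain ⟨T, hT0, hT⟩ : ∃ T : ℝ, 0 ≤ T ∧ ∀ k ∈ A, t k ≤ T := by
    refine ⟨∑ k ∈ A, |t k|, Finset.sum_nonneg fun _ _ => abs_nonneg _, fun k hk => ?_⟩
    exact (le_abs_self _).trans (Finset.single_le_sum (f := fun k => |t k|)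
      (fun _ _ => abs_nonneg _) hk)
  have hlim : Tendsto (fun n : ℕ => (1 - Real.exp (-T)) ^ n) atTop (𝓝 0) := by
    refine tendsto_pow_atTop_nhds_zero_of_lt_one ?_ ?_
    · have := Real.exp_le_one_iff.2 (by linarith : -T ≤ 0); linarith
    · have := Real.exp_pos (-T); linarith
  have := ge_of_tendsto hlim (Eventually.of_forall fun n =>
    h.abs_measureReal_lateSet_sub_le hp hT0 n A t j hT)
  exact sub_eq_zero.1 (abs_nonpos_iff.1 this)

end IsPoissonizedScheme

/-! ### Independence of the boxes for a fixed threshold. -/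

section

variable {Ω : Type*} [MeasurableSpace Ω] {P : Measure Ω} [IsProbabilityMeasure P]
  {p : ℕ → ℝ} {box : ℕ → Ω → ℕ} {gap : ℕ → Ω → ℝ}

/-- Box `k` contains at least `j` balls at time `t`. -/
def fullEvent (box : ℕ → Ω → ℕ) (gap : ℕ → Ω → ℝ) (j k : ℕ) (t : ℝ) : Set Ω :=
  {ω | (j : ℝ≥0∞) ≤ count k t (input box gap ω)}

/-- The σ-algebra of the process which tells when box `k` contains at least `j` balls. -/
@[reducible] def fullAlgebra (box : ℕ → Ω → ℕ) (gap : ℕ → Ω → ℝ) (j k : ℕ) : MeasurableSpace Ω :=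
  MeasurableSpace.generateFrom (Set.range fun t => (fullEvent box gap j k t)ᶜ)

omit [MeasurableSpace Ω] in
lemma measurableSet_fullAlgebra (j k : ℕ) (t : ℝ) :
    MeasurableSet[fullAlgebra box gap j k] (fullEvent box gap j k t) := by
  have : MeasurableSet[fullAlgebra box gap j k] (fullEvent box gap j k t)ᶜ :=
    MeasurableSpace.measurableSet_generateFrom ⟨t, rfl⟩
  simpa using this.compl

lemma count_mono (k : ℕ) (x : (ℕ → ℕ) × (ℕ → ℝ)) : Monotone fun t => count k t x := by
  intro s t hst
  refine ENNReal.tsum_le_tsum fun n => ?_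
  exact Set.indicator_le_indicator_of_subset
    (Set.ofPred_subset_ofPred.2 fun x hx => ⟨hx.1.trans hst, hx.2⟩) (fun _ => zero_le_one) x

omit [MeasurableSpace Ω] in
lemma fullEvent_mono (j k : ℕ) : Monotone (fullEvent box gap j k) :=
  fun _ _ hst _ hω => le_trans hω (count_mono k _ hst)

namespace IsPoissonizedScheme

omit [IsProbabilityMeasure P] in
lemma measurableSet_fullEvent (h : IsPoissonizedScheme P p box gap) (j k : ℕ) (t : ℝ) :
    MeasurableSet (fullEvent box gap j k t) :=
  measurableSet_le measurable_const ((measurable_count k t).comp h.measurable_input)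

lemma measureReal_fullEvent (hp : ∀ k, 0 ≤ p k) (h : IsPoissonizedScheme P p box gap)
    (j k : ℕ) {t : ℝ} (ht : 0 ≤ t) :
    P.real (fullEvent box gap j k t) = poisGe j (p k * t) := by
  have h1 := h.measureReal_lateSet hp {k} (fun _ => t) (fun _ => j)
  have h2 : input box gap ⁻¹' lateSet {k} (fun _ => t) (fun _ => j) =
      (fullEvent box gap j k t)ᶜ := by
    ext ω; simp [lateSet, fullEvent]
  rw [h2, probReal_compl_eq_one_sub (h.measurableSet_fullEvent j k t)] at h1
  simp only [lateProd, Finset.prod_singleton, max_eq_left ht] at h1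
  rw [poisGe]; linarith

/-- For fixed `j` and `k` the generating events decrease in time, so they form a π-system: an
intersection is the event at the later time. Hence product formulas with a single time per box
suffice, and no joint law of one count at several times is needed. -/
lemma iIndep_fullAlgebra (hp : ∀ k, 0 ≤ p k) (h : IsPoissonizedScheme P p box gap) (j : ℕ) :
    iIndep (fullAlgebra box gap j) P := by
  refine iIndepSets.iIndep (fun k => ?_) (fun k => Set.range fun t => (fullEvent box gap j k t)ᶜ)
    (fun k => ?_) (fun k => rfl) ?_
  · refine MeasurableSpace.generateFrom_le ?_
    rintro _ ⟨t, rfl⟩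
    exact (h.measurableSet_fullEvent j k t).compl
  · rintro _ ⟨s, rfl⟩ _ ⟨t, rfl⟩ _
    refine ⟨max s t, ?_⟩
    rcases le_total s t with hst | hst
    · simpa [max_eq_right hst] using fullEvent_mono j k hst
    · simpa [max_eq_left hst] using fullEvent_mono j k hst
  · rw [iIndepSets_iff]
    intro A f hf
    choose! t ht using hf
    have h1 := h.measureReal_lateSet hp A t (fun _ => j)
    have h2 : input box gap ⁻¹' lateSet A t (fun _ => j) = ⋂ k ∈ A, f k := by
      ext ω
      simp only [Set.mem_iInter]
      refine forall₂_congr fun k hk => ?_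
      rw [← ht k hk]
      simp [fullEvent]
    have h3 : ∀ k ∈ A, P.real (f k) = poisLt j (p k * max (t k) 0) := fun k hk => by
      have h4 := h.measureReal_lateSet hp {k} t (fun _ => j)
      simp only [lateProd, Finset.prod_singleton] at h4
      rw [← h4, ← ht k hk]
      congr 1
      ext ω; simp [lateSet, fullEvent]
    rw [h2, lateProd, ← Finset.prod_congr rfl h3] at h1
    rw [← ofReal_measureReal, h1, ENNReal.ofReal_prod_of_nonneg fun _ _ => measureReal_nonneg]
    exact Finset.prod_congr rfl fun k _ => ofReal_measureReal

end IsPoissonizedScheme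

end

end Karlin

/-! ### Only finitely many balls are thrown by any time. -/

namespace Karlin
namespace IsPoissonizedScheme

variable {Ω : Type*} [MeasurableSpace Ω] {P : Measure Ω} [IsProbabilityMeasure P]
  {p : ℕ → ℝ} {box : ℕ → Ω → ℕ} {gap : ℕ → Ω → ℝ}

/-- The second Borel–Cantelli lemma. Since the waiting times are also positive, the throwing times
increase to infinity and `ncard` counts genuinely finite sets. -/
lemma ae_frequently_one_lt_gap (h : IsPoissonizedScheme P p box gap) :
    ∀ᵐ ω ∂P, ∃ᶠ n in atTop, 1 < gap n ω := by
  set s : ℕ → Set Ω := fun n => gap n ⁻¹' Set.Ioi 1 with hs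
  have hsm : ∀ n, MeasurableSet (s n) := fun n => h.measurable_gap n measurableSet_Ioi
  have hind : iIndepSet s P := by
    refine iIndepSets.iIndepSet_of_mem (π := fun n => {t | MeasurableSet[MeasurableSpace.comap
      (gap n) inferInstance] t}) (fun n => ?_) hsm ?_
    · exact ⟨_, measurableSet_Ioi, rfl⟩
    · exact (iIndep_iff_iIndepSets _ _).1 h.indep_gap.iIndep
  have hP : ∀ n, P (s n) = ENNReal.ofReal (Real.exp (-1)) := fun n => by
    rw [hs, ← Measure.map_apply (h.measurable_gap n) measurableSet_Ioi, h.law_gap]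
    have hp : IsProbabilityMeasure (expMeasure 1) := isProbabilityMeasure_expMeasure one_pos
    rw [← ofReal_measureReal, ← Set.compl_Iic, probReal_compl_eq_one_sub measurableSet_Iic,
      expMeasure_one_real_Iic zero_le_one]
    simp
  have := measure_limsup_eq_one hsm hind (by
    simp_rw [hP]
    exact ENNReal.tsum_const_eq_top_of_ne_zero (by simp [Real.exp_pos]))
  have hl : MeasurableSet (limsup s atTop) := MeasurableSet.measurableSet_limsup hsm
  have h2 : ∀ᵐ ω ∂P, ω ∈ limsup s atTop := (prob_compl_eq_zero_iff hl).2 this |> fun h => h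
  filter_upwards [h2] with ω hω
  rw [mem_limsup_iff_frequently_mem] at hω
  exact hω

omit [MeasurableSpace Ω] in
lemma finite_setOf_throwTime_le {g : ℕ → Ω → ℝ} {ω : Ω} (h0 : ∀ n, 0 < g n ω)
    (h1 : ∃ᶠ n in atTop, 1 < g n ω) (t : ℝ) : {n | throwTime g n ω ≤ t}.Finite := by
  have hmono : Monotone fun n => throwTime g n ω := by
    refine monotone_nat_of_le_succ fun n => ?_
    rw [throwTime, throwTime, Finset.sum_range_succ _ (n + 1)]
    linarith [h0 (n + 1)]
  have hunb : ∀ m : ℕ, ∃ n, (m : ℝ) ≤ throwTime g n ω := by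
    intro m
    induction m with
    | zero => exact ⟨0, by simpa [throwTime] using (h0 0).le⟩
    | succ m ih =>
      obtain ⟨n, hn⟩ := ih
      obtain ⟨k, hk, hk1⟩ := (frequently_atTop.1 h1) (n + 1)
      refine ⟨k, ?_⟩
      obtain ⟨k, rfl⟩ : ∃ i, k = i + 1 := ⟨k - 1, by omega⟩
      have h3 := hmono (show n ≤ k by omega)
      simp only [throwTime] at h3 hn ⊢
      rw [Finset.sum_range_succ _ (k + 1)]
      push_cast
      linarith
  obtain ⟨m, hm⟩ := exists_nat_gt t
  obtain ⟨n, hn⟩ := hunb m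
  refine (Set.finite_lt_nat n).subset fun i hi => ?_
  by_contra hni
  have hi' : throwTime g i ω ≤ t := hi
  have := hmono (show n ≤ i by simpa using hni)
  simp only at this
  linarith

omit [MeasurableSpace Ω] in
lemma count_eq_ballCount {ω : Ω} {t : ℝ} (hfin : {n | throwTime gap n ω ≤ t}.Finite) (k : ℕ) :
    count k t (input box gap ω) = (ballCount box gap k t ω : ℝ≥0∞) := by
  have hfin' : {n | throwTime gap n ω ≤ t ∧ box n ω = k}.Finite := hfin.subset fun n hn => hn.1
  rw [ballCount, Set.ncard_eq_toFinset_card _ hfin', count, tsum_eq_sum (s := hfin'.toFinset)]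
  · rw [Finset.card_eq_sum_ones, Nat.cast_sum]
    refine Finset.sum_congr rfl fun n hn => ?_
    have hn' : throwTime gap n ω ≤ t ∧ box n ω = k := by simpa using hn
    rw [Set.indicator_of_mem (by exact hn'), Nat.cast_one]
  · intro n hn
    refine Set.indicator_of_notMem (fun h => hn ?_) _
    rw [Set.Finite.mem_toFinset]
    exact h

/-- Almost surely, simultaneously for all times, `K` is a finite sum of indicators. -/
lemma ae_K_eq (h : IsPoissonizedScheme P p box gap) {j : ℕ} (hj : 1 ≤ j) :
    ∀ᵐ ω ∂P, ∀ t, {k | ω ∈ fullEvent box gap j k t}.Finite ∧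
      K box gap j t ω = ∑' k, (fullEvent box gap j k t).indicator (fun _ => (1 : ℝ)) ω := by
  filter_upwards [h.ae_gap_pos, h.ae_frequently_one_lt_gap] with ω h0 h1 t
  have hfin := finite_setOf_throwTime_le h0 h1 t
  have hiff : {k | j ≤ ballCount box gap k t ω} = {k | ω ∈ fullEvent box gap j k t} := by
    ext k
    change j ≤ _ ↔ (j : ℝ≥0∞) ≤ count k t (input box gap ω)
    rw [count_eq_ballCount hfin]
    simp
  have hfin2 : {k | ω ∈ fullEvent box gap j k t}.Finite := by
    rw [← hiff]
    refine (hfin.image fun n => box n ω).subset fun k hk => ?_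
    have hk' : 0 < ballCount box gap k t ω := lt_of_lt_of_le hj hk
    obtain ⟨n, hn⟩ := Set.nonempty_of_ncard_ne_zero hk'.ne'
    exact ⟨n, hn.1, hn.2⟩
  refine ⟨hfin2, ?_⟩
  rw [K, hiff, Set.ncard_eq_toFinset_card _ hfin2, tsum_eq_sum (s := hfin2.toFinset)]
  · rw [Finset.card_eq_sum_ones, Nat.cast_sum]
    refine Finset.sum_congr rfl fun n hn => ?_
    rw [Set.indicator_of_mem (by simpa using hn), Nat.cast_one]
  · intro n hn
    exact Set.indicator_of_notMem (by simpa using hn) _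

end IsPoissonizedScheme
end Karlin

/-! ### Exponential moments and moderate deviations of sums of independent indicators. -/

namespace Karlin

lemma abs_exp_sub_quadratic_le {y : ℝ} (hy : |y| ≤ 1) :
    |Real.exp y - (1 + y + y ^ 2 / 2)| ≤ |y| ^ 3 / 2 := by
  have h := Real.exp_bound hy (n := 3) (by norm_num)
  simp only [Finset.sum_range_succ, Finset.sum_range_zero, Nat.factorial] at h
  norm_num at h
  have h3 : 0 ≤ |y| ^ 3 := by positivity
  linarith

/-- Bounds for the moment generating function of a centred Bernoulli variable. -/
lemma bernoulli_mgf_bounds {q θ : ℝ} (hq0 : 0 ≤ q) (hq1 : q ≤ 1) (hθ : |θ| ≤ 1) :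
    1 + q * (1 - q) * (θ ^ 2 * (1 - |θ|) / 2) ≤
        q * Real.exp (θ * (1 - q)) + (1 - q) * Real.exp (θ * (0 - q)) ∧
      q * Real.exp (θ * (1 - q)) + (1 - q) * Real.exp (θ * (0 - q)) ≤
        1 + q * (1 - q) * (θ ^ 2 * (1 + |θ|) / 2) := by
  have e1 : |θ * (1 - q)| = |θ| * (1 - q) := by
    rw [abs_mul, abs_of_nonneg (by linarith : 0 ≤ 1 - q)]
  have e2 : |θ * (0 - q)| = |θ| * q := by rw [abs_mul, zero_sub, abs_neg, abs_of_nonneg hq0]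
  have hθ0 := abs_nonneg θ
  have h1 := abs_exp_sub_quadratic_le (y := θ * (1 - q)) (by
    rw [e1]; exact mul_le_one₀ hθ (by linarith) (by linarith))
  have h2 := abs_exp_sub_quadratic_le (y := θ * (0 - q)) (by
    rw [e2]; exact mul_le_one₀ hθ hq0 hq1)
  rw [e1] at h1
  rw [e2] at h2
  rw [abs_le] at h1 h2
  have hsq : θ ^ 2 = |θ| ^ 2 := (sq_abs θ).symm
  -- The Taylor remainder carries the factor `q (1 - q)` too, so summing over boxes gives bounds in
  -- terms of the variance alone. The linear terms cancel by centring.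
  have hcube : q * ((|θ| * (1 - q)) ^ 3 / 2) + (1 - q) * ((|θ| * q) ^ 3 / 2) ≤
      q * (1 - q) * (θ ^ 2 * |θ| / 2) := by
    have : q * ((|θ| * (1 - q)) ^ 3 / 2) + (1 - q) * ((|θ| * q) ^ 3 / 2) =
        q * (1 - q) * (|θ| ^ 3 / 2) * ((1 - q) ^ 2 + q ^ 2) := by ring
    rw [this, hsq]
    have h3 : (1 - q) ^ 2 + q ^ 2 ≤ 1 := by nlinarith
    have h4 : 0 ≤ q * (1 - q) * (|θ| ^ 3 / 2) := by
      have : 0 ≤ 1 - q := by linarith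
      positivity
    nlinarith
  have f1 := mul_le_mul_of_nonneg_left h1.1 hq0
  have f2 := mul_le_mul_of_nonneg_left h1.2 hq0
  have f3 := mul_le_mul_of_nonneg_left h2.1 (by linarith : 0 ≤ 1 - q)
  have f4 := mul_le_mul_of_nonneg_left h2.2 (by linarith : 0 ≤ 1 - q)
  constructor <;> nlinarith

/-- From `exp (-w) ≥ 1 - w` with `w = z - z ^ 2` and `(1 + z) (1 - z + z ^ 2) = 1 + z ^ 3`. -/
lemma exp_le_one_add {z : ℝ} (hz0 : 0 ≤ z) : Real.exp (z - z ^ 2) ≤ 1 + z := by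
  rcases le_or_gt (z - z ^ 2) 0 with h | h
  · exact (Real.exp_le_one_iff.2 h).trans (by linarith)
  have h1 := Real.add_one_le_exp (-(z - z ^ 2))
  have h2 : 0 < -(z - z ^ 2) + 1 := by nlinarith
  have h3 : Real.exp (z - z ^ 2) ≤ (-(z - z ^ 2) + 1)⁻¹ := by
    rw [← neg_neg (z - z ^ 2), Real.exp_neg]
    simpa using inv_anti₀ h2 h1
  refine h3.trans ?_
  rw [inv_le_iff_one_le_mul₀ h2]
  nlinarith [pow_nonneg hz0 3]

section

variable {Ω : Type*} [MeasurableSpace Ω] {P : Measure Ω} [IsProbabilityMeasure P]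

/-- The sum of the centred indicators of finitely many events. -/
noncomputable def centredSum (P : Measure Ω) (B : ℕ → Set Ω) (A : Finset ℕ) (ω : Ω) : ℝ :=
  ∑ k ∈ A, ((B k).indicator (fun _ => (1 : ℝ)) ω - P.real (B k))

/-- The sum of the variances of the indicators of finitely many events. -/
noncomputable def varSum (P : Measure Ω) (B : ℕ → Set Ω) (A : Finset ℕ) : ℝ :=
  ∑ k ∈ A, P.real (B k) * (1 - P.real (B k))

variable {B : ℕ → Set Ω}

omit [IsProbabilityMeasure P] in
lemma measurable_centredSum (hBm : ∀ k, MeasurableSet (B k)) (A : Finset ℕ) :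
    Measurable (centredSum P B A) :=
  Finset.measurable_sum _ fun k _ => (measurable_const.indicator (hBm k)).sub_const _

lemma bernoulliVar_nonneg (B : Set Ω) : 0 ≤ P.real B * (1 - P.real B) :=
  mul_nonneg measureReal_nonneg (by linarith [measureReal_le_one (μ := P) (s := B)])

lemma varSum_nonneg (A : Finset ℕ) : 0 ≤ varSum P B A :=
  Finset.sum_nonneg fun k _ => bernoulliVar_nonneg _

lemma mgf_indicator_sub {B : Set Ω} (hB : MeasurableSet B) (θ : ℝ) :
    mgf (fun ω => B.indicator (fun _ => (1 : ℝ)) ω - P.real B) P θ =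
      P.real B * Real.exp (θ * (1 - P.real B)) +
        (1 - P.real B) * Real.exp (θ * (0 - P.real B)) := by
  have : ∀ ω, Real.exp (θ * (B.indicator (fun _ => (1 : ℝ)) ω - P.real B)) =
      B.indicator (fun _ => Real.exp (θ * (1 - P.real B))) ω +
        Bᶜ.indicator (fun _ => Real.exp (θ * (0 - P.real B))) ω := fun ω => by
    by_cases h : ω ∈ B <;> simp [h]
  rw [mgf]
  simp_rw [this]
  rw [integral_add ((integrable_const _).indicator hB) ((integrable_const _).indicator hB.compl),
    integral_indicator_const _ hB, integral_indicator_const _ hB.compl,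
    probReal_compl_eq_one_sub hB]
  simp

lemma mgf_centredSum (hBm : ∀ k, MeasurableSet (B k)) (hB : iIndepSet B P) (A : Finset ℕ) (θ : ℝ) :
    mgf (centredSum P B A) P θ = ∏ k ∈ A, (P.real (B k) * Real.exp (θ * (1 - P.real (B k))) +
        (1 - P.real (B k)) * Real.exp (θ * (0 - P.real (B k)))) := by
  have hind : iIndepFun (fun k ω => (B k).indicator (fun _ => (1 : ℝ)) ω - P.real (B k)) P :=
    hB.iIndepFun_indicator.comp (g := fun k x => x - P.real (B k))
      (fun k => measurable_id.sub_const _)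
  have := hind.mgf_sum (t := θ)
    (fun k => (measurable_const.indicator (hBm k)).sub_const _) A
  rw [← Finset.prod_congr rfl fun k _ => mgf_indicator_sub (hBm k) θ, ← this]
  congr 1
  ext ω
  simp [centredSum]

lemma mgf_centredSum_le (hBm : ∀ k, MeasurableSet (B k)) (hB : iIndepSet B P) (A : Finset ℕ)
    {θ : ℝ} (hθ : |θ| ≤ 1) :
    mgf (centredSum P B A) P θ ≤ Real.exp (varSum P B A * (θ ^ 2 * (1 + |θ|) / 2)) := by
  rw [mgf_centredSum hBm hB, varSum, Finset.sum_mul, Real.exp_sum]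
  refine Finset.prod_le_prod (fun k _ => ?_) fun k _ => ?_
  · have h1 := measureReal_nonneg (μ := P) (s := B k)
    have h2 : 0 ≤ 1 - P.real (B k) := by linarith [measureReal_le_one (μ := P) (s := B k)]
    positivity
  · refine (bernoulli_mgf_bounds measureReal_nonneg measureReal_le_one hθ).2.trans ?_
    rw [add_comm]
    exact Real.add_one_le_exp _

/-- Passing from `1 + z` to an exponential loses `z ^ 2 ≤ z * (θ / 2)`, which is absorbed by
weakening the factor `1 - θ` of `bernoulli_mgf_bounds` to `1 - 2 * θ`. -/
lemma le_mgf_centredSum (hBm : ∀ k, MeasurableSet (B k)) (hB : iIndepSet B P) (A : Finset ℕ)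
    {θ : ℝ} (hθ0 : 0 ≤ θ) (hθ : θ ≤ 1) :
    Real.exp (varSum P B A * (θ ^ 2 * (1 - 2 * θ) / 2)) ≤ mgf (centredSum P B A) P θ := by
  rw [mgf_centredSum hBm hB, varSum, Finset.sum_mul, Real.exp_sum]
  refine Finset.prod_le_prod (fun k _ => (Real.exp_pos _).le) fun k _ => ?_
  have h := (bernoulli_mgf_bounds (q := P.real (B k)) (θ := θ) measureReal_nonneg
    measureReal_le_one (by rwa [abs_of_nonneg hθ0])).1
  rw [abs_of_nonneg hθ0] at h
  refine le_trans ?_ h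
  set w := P.real (B k) * (1 - P.real (B k)) with hw
  have hw0 : 0 ≤ w := bernoulliVar_nonneg _
  have hw1 : w ≤ 1 / 4 := by nlinarith [sq_nonneg (P.real (B k) - 1 / 2)]
  set z := w * (θ ^ 2 * (1 - θ) / 2) with hz
  have h1θ : 0 ≤ 1 - θ := by linarith
  have hz0 : 0 ≤ z := by positivity
  have hzθ : z ≤ θ ^ 2 / 8 := by
    have : z ≤ 1 / 4 * (θ ^ 2 * 1 / 2) := by
      rw [hz]; gcongr; linarith
    linarith
  refine le_trans (Real.exp_le_exp.2 ?_) (exp_le_one_add hz0)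
  have : z ^ 2 ≤ z * (θ / 2) := by
    rw [sq]; exact mul_le_mul_of_nonneg_left (by nlinarith) hz0
  have h5 : z * (θ / 2) ≤ w * (θ ^ 2 * θ / 2) := by
    have : z ≤ w * (θ ^ 2 * 1 / 2) := by rw [hz]; gcongr; linarith
    nlinarith
  have h6 : w * (θ ^ 2 * (1 - 2 * θ) / 2) = z - w * (θ ^ 2 * θ / 2) := by rw [hz]; ring
  linarith

lemma integrable_exp_centredSum (hBm : ∀ k, MeasurableSet (B k)) (A : Finset ℕ) (θ : ℝ) :
    Integrable (fun ω => Real.exp (θ * centredSum P B A ω)) P := by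
  refine Integrable.of_bound (C := Real.exp (|θ| * A.card))
    ((measurable_centredSum hBm A).const_mul θ).exp.aestronglyMeasurable (ae_of_all _ fun ω => ?_)
  rw [Real.norm_of_nonneg (Real.exp_pos _).le]
  refine Real.exp_le_exp.2 ((le_abs_self _).trans ?_)
  rw [abs_mul]
  gcongr
  refine (Finset.abs_sum_le_sum_abs _ _).trans ?_
  have : ∀ k ∈ A, |(B k).indicator (fun _ => (1 : ℝ)) ω - P.real (B k)| ≤ 1 := fun k _ => by
    have h1 := measureReal_nonneg (μ := P) (s := B k)
    have h2 := measureReal_le_one (μ := P) (s := B k)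
    by_cases h : ω ∈ B k
    · simp only [Set.indicator_of_mem h]; rw [abs_le]; constructor <;> linarith
    · simp only [Set.indicator_of_notMem h]; rw [abs_le]; constructor <;> linarith
  simpa using Finset.sum_le_card_nsmul _ _ _ this

/-- Splitting an exponential moment at two levels `x ≤ y`. -/
lemma mgf_le_of_levels {S : Ω → ℝ} (hSm : Measurable S)
    (hint : ∀ c, Integrable (fun ω => Real.exp (c * S ω)) P) {θ δ x y : ℝ} (hθ : 0 ≤ θ)
    (hδ : 0 ≤ δ) :
    mgf S P θ ≤ Real.exp (δ * x) * mgf S P (θ - δ) + Real.exp (θ * y) * P.real {ω | x < S ω} +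
      Real.exp (-(δ * y)) * mgf S P (θ + δ) := by
  set E : Set Ω := {ω | x < S ω}
  have hE : MeasurableSet E := measurableSet_lt measurable_const hSm
  have hpt : ∀ ω, Real.exp (θ * S ω) ≤ Real.exp (δ * x) * Real.exp ((θ - δ) * S ω) +
      Real.exp (θ * y) * E.indicator (fun _ => (1 : ℝ)) ω +
      Real.exp (-(δ * y)) * Real.exp ((θ + δ) * S ω) := fun ω => by
    have p1 : 0 ≤ Real.exp (δ * x) * Real.exp ((θ - δ) * S ω) := by positivity
    have p3 : 0 ≤ Real.exp (-(δ * y)) * Real.exp ((θ + δ) * S ω) := by positivity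
    have p2 : 0 ≤ Real.exp (θ * y) * E.indicator (fun _ => (1 : ℝ)) ω :=
      mul_nonneg (Real.exp_pos _).le (Set.indicator_nonneg (fun _ _ => zero_le_one) _)
    rcases le_or_gt (S ω) x with h1 | h1
    · have : Real.exp (θ * S ω) ≤ Real.exp (δ * x) * Real.exp ((θ - δ) * S ω) := by
        rw [← Real.exp_add]
        refine Real.exp_le_exp.2 ?_
        linarith [mul_le_mul_of_nonneg_left h1 hδ]
      linarith
    · rcases le_or_gt (S ω) y with h2 | h2
      · have : Real.exp (θ * S ω) ≤ Real.exp (θ * y) * E.indicator (fun _ => (1 : ℝ)) ω := by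
          rw [Set.indicator_of_mem (show ω ∈ E from h1), mul_one]
          exact Real.exp_le_exp.2 (mul_le_mul_of_nonneg_left h2 hθ)
        linarith
      · have : Real.exp (θ * S ω) ≤ Real.exp (-(δ * y)) * Real.exp ((θ + δ) * S ω) := by
          rw [← Real.exp_add]
          refine Real.exp_le_exp.2 ?_
          linarith [mul_le_mul_of_nonneg_left h2.le hδ]
        linarith
  have i2 : Integrable (fun ω => Real.exp (θ * y) * E.indicator (fun _ => (1 : ℝ)) ω) P :=
    ((integrable_const (1 : ℝ)).indicator hE).const_mul _
  have i1 := (hint (θ - δ)).const_mul (Real.exp (δ * x))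
  have i3 := (hint (θ + δ)).const_mul (Real.exp (-(δ * y)))
  refine (integral_mono (hint θ) ((i1.add i2).add i3) hpt).trans (le_of_eq ?_)
  rw [integral_add' (i1.add i2) i3, integral_add' i1 i2]
  simp only [integral_const_mul]
  rw [integral_indicator_const _ hE]
  simp [mgf]

lemma exp_neg_two_le : Real.exp (-2) ≤ 1 / 4 := by
  rw [Real.exp_neg]
  have : (4 : ℝ) ≤ Real.exp 2 := by
    have := Real.add_one_le_exp (1 : ℝ)
    have h2 : Real.exp 2 = Real.exp 1 * Real.exp 1 := by rw [← Real.exp_add]; norm_num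
    rw [h2]; nlinarith
  rw [one_div]
  exact inv_anti₀ (by norm_num) this

/-- A lower bound for moderate deviations of sums of independent centred indicators. -/
lemma measureReal_lt_centredSum_ge (hBm : ∀ k, MeasurableSet (B k)) (hB : iIndepSet B P)
    (A : Finset ℕ) {ε θ : ℝ} (hε0 : 0 < ε) (hε : ε ≤ 1 / 2) (hθ0 : 0 < θ) (hθ : θ ≤ ε ^ 2 / 32)
    (hv : 8 / ε ^ 2 ≤ θ ^ 2 * varSum P B A) :
    1 / 2 * Real.exp (-(θ ^ 2 * varSum P B A / 2 * (1 + 3 * ε))) ≤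
      P.real {ω | (1 - ε) * θ * varSum P B A < centredSum P B A ω} := by
  have hM1 : mgf (centredSum P B A) P (θ - ε * θ) ≤ Real.exp (varSum P B A *
      ((θ - ε * θ) ^ 2 * (1 + (θ - ε * θ)) / 2)) := by
    have h0 : 0 ≤ θ - ε * θ := by nlinarith
    have := mgf_centredSum_le hBm hB A (θ := θ - ε * θ) (by rw [abs_of_nonneg h0]; nlinarith)
    rwa [abs_of_nonneg h0] at this
  have hM2 : mgf (centredSum P B A) P (θ + ε * θ) ≤ Real.exp (varSum P B A *
      ((θ + ε * θ) ^ 2 * (1 + (θ + ε * θ)) / 2)) := by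
    have h0 : 0 ≤ θ + ε * θ := by positivity
    have := mgf_centredSum_le hBm hB A (θ := θ + ε * θ) (by rw [abs_of_nonneg h0]; nlinarith)
    rwa [abs_of_nonneg h0] at this
  have hMl := le_mgf_centredSum hBm hB A hθ0.le (by nlinarith : θ ≤ 1)
  -- Under the measure tilted by `θ` the sum concentrates near `θ v`, `v` being the variance. The
  -- levels `(1 ∓ ε) θ v` isolate this region, and changing the tilt by `ε θ` bounds what lies
  -- outside.
  have hmain := mgf_le_of_levels (measurable_centredSum (P := P) hBm A)
    (fun c => integrable_exp_centredSum hBm A c) (θ := θ) (δ := ε * θ)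
    (x := (1 - ε) * θ * varSum P B A) (y := (1 + ε) * θ * varSum P B A) hθ0.le (by positivity)
  have hv0 : 0 ≤ varSum P B A := varSum_nonneg A
  generalize P.real {ω | (1 - ε) * θ * varSum P B A < centredSum P B A ω} = r at *
  generalize mgf (centredSum P B A) P (θ - ε * θ) = M₁ at *
  generalize mgf (centredSum P B A) P (θ + ε * θ) = M₂ at *
  generalize mgf (centredSum P B A) P θ = M at *
  generalize varSum P B A = v at *
  have hθv : 0 ≤ θ ^ 2 * v := by positivity
  have hM0 : 0 < M := (Real.exp_pos _).trans_le hMl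
  have hvε : 2 ≤ θ ^ 2 * v * (ε ^ 2 / 4) := by
    rw [div_le_iff₀ (by positivity)] at hv
    linarith
  -- Each outer part has, relative to `M`, the Gaussian exponent `-θ² v ε² / 2` plus cubic
  -- corrections `θ c`. As `exp (-2) ≤ 1 / 4`, each is at most `M / 4`, so the middle keeps half of
  -- `M`.
  have hnum : ∀ c, 0 ≤ c → c ≤ 4 → θ ^ 2 * v * (-ε ^ 2 / 2 + θ * c) ≤ -2 := fun c hc0 hc => by
    have h1 : θ * c ≤ ε ^ 2 / 32 * 4 := by gcongr
    have h2 : -ε ^ 2 / 2 + θ * c ≤ -(ε ^ 2 / 4) := by nlinarith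
    linarith [mul_le_mul_of_nonneg_left h2 hθv]
  have k1 : Real.exp (ε * θ * ((1 - ε) * θ * v)) * M₁ ≤ M / 4 := by
    calc _ ≤ Real.exp (ε * θ * ((1 - ε) * θ * v)) *
          Real.exp (v * ((θ - ε * θ) ^ 2 * (1 + (θ - ε * θ)) / 2)) := by gcongr
      _ ≤ Real.exp (-2) * Real.exp (v * (θ ^ 2 * (1 - 2 * θ) / 2)) := by
          rw [← Real.exp_add, ← Real.exp_add]
          refine Real.exp_le_exp.2 ?_
          have h3 : (1 - ε) ^ 3 ≤ 1 := pow_le_one₀ (by linarith) (by linarith)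
          have h4 : 0 ≤ (1 - ε) ^ 3 := pow_nonneg (by linarith) 3
          have := hnum ((1 - ε) ^ 3 / 2 + 1) (by linarith) (by linarith)
          linear_combination this
      _ ≤ 1 / 4 * M := by gcongr; exact exp_neg_two_le
      _ = _ := by ring
  have k3 : Real.exp (-(ε * θ * ((1 + ε) * θ * v))) * M₂ ≤ M / 4 := by
    calc _ ≤ Real.exp (-(ε * θ * ((1 + ε) * θ * v))) *
          Real.exp (v * ((θ + ε * θ) ^ 2 * (1 + (θ + ε * θ)) / 2)) := by gcongr
      _ ≤ Real.exp (-2) * Real.exp (v * (θ ^ 2 * (1 - 2 * θ) / 2)) := by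
          rw [← Real.exp_add, ← Real.exp_add]
          refine Real.exp_le_exp.2 ?_
          have h3 : (1 + ε) ^ 3 ≤ (3 / 2) ^ 3 := pow_le_pow_left₀ (by linarith) (by linarith) _
          have := hnum ((1 + ε) ^ 3 / 2 + 1) (by positivity) (by linarith)
          linear_combination this
      _ ≤ 1 / 4 * M := by gcongr; exact exp_neg_two_le
      _ = _ := by ring
  have hfin : M / 2 ≤ Real.exp (θ * ((1 + ε) * θ * v)) * r := by linarith
  have hr : 1 / 2 * (Real.exp (-(θ * ((1 + ε) * θ * v))) * M) ≤ r := by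
    have h1 : Real.exp (-(θ * ((1 + ε) * θ * v))) * Real.exp (θ * ((1 + ε) * θ * v)) = 1 := by
      rw [← Real.exp_add]; simp
    calc _ = Real.exp (-(θ * ((1 + ε) * θ * v))) * (M / 2) := by ring
      _ ≤ Real.exp (-(θ * ((1 + ε) * θ * v))) * (Real.exp (θ * ((1 + ε) * θ * v)) * r) := by gcongr
      _ = _ := by rw [← mul_assoc, h1, one_mul]
  refine le_trans ?_ hr
  gcongr 1 / 2 * ?_
  calc _ ≤ Real.exp (-(θ * ((1 + ε) * θ * v))) * Real.exp (v * (θ ^ 2 * (1 - 2 * θ) / 2)) := by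
        rw [← Real.exp_add]
        refine Real.exp_le_exp.2 ?_
        have h2 : 2 * θ ≤ ε := by nlinarith
        linear_combination (1 / 2) * mul_le_mul_of_nonneg_left h2 hθv
    _ ≤ _ := by gcongr

end
end Karlin

/-! ### Infinitely many independent events: Bernstein's inequality, mean and variance. -/

namespace Karlin

/-- The number of events `B k` which occur. -/
noncomputable def occur {Ω : Type*} (B : ℕ → Set Ω) (ω : Ω) : ℝ :=
  ∑' k, (B k).indicator (fun _ => (1 : ℝ)) ω

section

variable {Ω : Type*} [MeasurableSpace Ω] (P : Measure Ω)

/-- The expected number of events which occur. -/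
noncomputable def occurMean (B : ℕ → Set Ω) : ℝ := ∑' k, P.real (B k)

/-- The variance of the number of events which occur, for independent events. -/
noncomputable def occurVar (B : ℕ → Set Ω) : ℝ := ∑' k, P.real (B k) * (1 - P.real (B k))

variable {P} [IsProbabilityMeasure P] {B : ℕ → Set Ω}

lemma summable_bernoulliVar (hs : Summable fun k => P.real (B k)) :
    Summable fun k => P.real (B k) * (1 - P.real (B k)) :=
  hs.of_nonneg_of_le (fun k => bernoulliVar_nonneg _) fun k =>
    mul_le_of_le_one_right measureReal_nonneg
      (by linarith [measureReal_nonneg (μ := P) (s := B k)])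

lemma occurVar_nonneg : 0 ≤ occurVar P B := tsum_nonneg fun k => bernoulliVar_nonneg (B k)

lemma varSum_le_occurVar (hs : Summable fun k => P.real (B k)) (A : Finset ℕ) :
    varSum P B A ≤ occurVar P B :=
  (summable_bernoulliVar hs).sum_le_tsum A fun k _ => bernoulliVar_nonneg (B k)

lemma tendsto_varSum (hs : Summable fun k => P.real (B k)) :
    Tendsto (fun n => varSum P B (Finset.range n)) atTop (𝓝 (occurVar P B)) :=
  (summable_bernoulliVar hs).hasSum.tendsto_sum_nat

lemma ae_finite_occur (hs : Summable fun k => P.real (B k)) :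
    ∀ᵐ ω ∂P, {k | ω ∈ B k}.Finite := by
  refine ae_finite_setOfPred_mem ?_
  have := hs.tsum_ofReal_lt_top
  exact ne_of_eq_of_ne (tsum_congr fun k => by rw [ofReal_measureReal]) this.ne

omit [MeasurableSpace Ω] in
lemma hasSum_occur {ω : Ω} (hω : {k | ω ∈ B k}.Finite) :
    HasSum (fun k => (B k).indicator (fun _ => (1 : ℝ)) ω) (occur B ω) := by
  refine (summable_of_hasFiniteSupport (hω.subset fun k hk => ?_)).hasSum
  by_contra h
  exact hk (Set.indicator_of_notMem (by simpa using h) _)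

lemma ae_tendsto_centredSum (hs : Summable fun k => P.real (B k)) :
    ∀ᵐ ω ∂P, Tendsto (fun n => centredSum P B (Finset.range n) ω) atTop
      (𝓝 (occur B ω - occurMean P B)) := by
  filter_upwards [ae_finite_occur hs] with ω hω
  exact ((hasSum_occur hω).sub hs.hasSum).tendsto_sum_nat

omit [IsProbabilityMeasure P] in
lemma measurable_occur (hBm : ∀ k, MeasurableSet (B k)) : Measurable (occur B) :=
  Measurable.tsum fun k => measurable_const.indicator (hBm k)

/-- Fatou's lemma carries the finite bound over, because the partial centred sums converge almost
surely and their variances are at most the total one. -/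
lemma lintegral_exp_occur_le (hBm : ∀ k, MeasurableSet (B k)) (hB : iIndepSet B P)
    (hs : Summable fun k => P.real (B k)) {θ : ℝ} (hθ : |θ| ≤ 1) :
    ∫⁻ ω, ENNReal.ofReal (Real.exp (θ * (occur B ω - occurMean P B))) ∂P ≤
      ENNReal.ofReal (Real.exp (occurVar P B * (θ ^ 2 * (1 + |θ|) / 2))) := by
  have h1 : ∫⁻ ω, ENNReal.ofReal (Real.exp (θ * (occur B ω - occurMean P B))) ∂P =
      ∫⁻ ω, liminf (fun n => ENNReal.ofReal
        (Real.exp (θ * centredSum P B (Finset.range n) ω))) atTop ∂P := by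
    refine lintegral_congr_ae ?_
    filter_upwards [ae_tendsto_centredSum hs] with ω hω
    exact (((ENNReal.continuous_ofReal.comp Real.continuous_exp).tendsto _).comp
      (hω.const_mul θ)).liminf_eq.symm
  rw [h1]
  refine (lintegral_liminf_le fun n =>
    ((measurable_centredSum hBm _).const_mul θ).exp.ennreal_ofReal).trans ?_
  refine liminf_le_of_frequently_le' (Frequently.of_forall fun n => ?_)
  rw [← ofReal_integral_eq_lintegral_ofReal (integrable_exp_centredSum hBm _ θ)
    (ae_of_all _ fun ω => (Real.exp_pos _).le)]
  refine ENNReal.ofReal_le_ofReal ((mgf_centredSum_le hBm hB (Finset.range n) hθ).trans ?_)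
  refine Real.exp_le_exp.2 (mul_le_mul_of_nonneg_right (varSum_le_occurVar hs _) (by positivity))

lemma measureReal_le_occur_mul_le (hBm : ∀ k, MeasurableSet (B k)) (hB : iIndepSet B P)
    (hs : Summable fun k => P.real (B k)) {θ : ℝ} (hθ : |θ| ≤ 1) (x : ℝ) :
    P.real {ω | x ≤ θ * (occur B ω - occurMean P B)} ≤
      Real.exp (-x + occurVar P B * (θ ^ 2 * (1 + |θ|) / 2)) := by
  have hm : Measurable fun ω => ENNReal.ofReal (Real.exp (θ * (occur B ω - occurMean P B))) :=
    (((measurable_occur hBm).sub_const _).const_mul θ).exp.ennreal_ofReal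
  have h1 := mul_meas_ge_le_lintegral (μ := P) hm (ENNReal.ofReal (Real.exp x))
  have h2 := h1.trans (lintegral_exp_occur_le hBm hB hs hθ)
  have hset : {ω | ENNReal.ofReal (Real.exp x) ≤
      ENNReal.ofReal (Real.exp (θ * (occur B ω - occurMean P B)))} =
      {ω | x ≤ θ * (occur B ω - occurMean P B)} := by
    ext ω
    simp only [Set.mem_ofPred_eq]
    rw [ENNReal.ofReal_le_ofReal_iff (Real.exp_pos _).le, Real.exp_le_exp]
  rw [hset] at h2
  have h3 := ENNReal.toReal_mono ENNReal.ofReal_ne_top h2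
  rw [ENNReal.toReal_mul, ENNReal.toReal_ofReal (Real.exp_pos _).le,
    ENNReal.toReal_ofReal (Real.exp_pos _).le, ← measureReal_def] at h3
  rw [Real.exp_add, Real.exp_neg, inv_mul_eq_div, le_div_iff₀ (Real.exp_pos _)]
  linarith

/-- Bernstein's inequality, upper tail. -/
lemma measureReal_le_occur_sub_le (hBm : ∀ k, MeasurableSet (B k)) (hB : iIndepSet B P)
    (hs : Summable fun k => P.real (B k)) {v x : ℝ} (hv : occurVar P B ≤ v) (hv0 : 0 < v)
    (hx : 0 ≤ x) (hxv : x ≤ v) :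
    P.real {ω | x ≤ occur B ω - occurMean P B} ≤ Real.exp (-(x ^ 2 / (2 * v) * (1 - x / v))) := by
  rcases hx.eq_or_lt with rfl | hx
  · simp
  -- `θ = x / v` minimises the Gaussian part `-θ x + θ² v / 2` of the Chernoff exponent.
  have hθ0 : 0 < x / v := div_pos hx hv0
  have hθ : |x / v| ≤ 1 := by rw [abs_of_pos hθ0]; exact (div_le_one hv0).2 hxv
  have h := measureReal_le_occur_mul_le hBm hB hs hθ (x / v * x)
  have hset : {ω | x / v * x ≤ x / v * (occur B ω - occurMean P B)} =
      {ω | x ≤ occur B ω - occurMean P B} := by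
    ext ω
    simp only [Set.mem_ofPred_eq]
    exact mul_le_mul_iff_right₀ hθ0
  rw [hset, abs_of_pos hθ0] at h
  refine h.trans (Real.exp_le_exp.2 ?_)
  have : occurVar P B * ((x / v) ^ 2 * (1 + x / v) / 2) ≤ v * ((x / v) ^ 2 * (1 + x / v) / 2) := by
    gcongr
  refine (add_le_add le_rfl this).trans (le_of_eq ?_)
  field_simp
  ring

/-- Bernstein's inequality, lower tail. -/
lemma measureReal_occur_sub_le_neg_le (hBm : ∀ k, MeasurableSet (B k)) (hB : iIndepSet B P)
    (hs : Summable fun k => P.real (B k)) {v x : ℝ} (hv : occurVar P B ≤ v) (hv0 : 0 < v)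
    (hx : 0 ≤ x) (hxv : x ≤ v) :
    P.real {ω | occur B ω - occurMean P B ≤ -x} ≤ Real.exp (-(x ^ 2 / (2 * v) * (1 - x / v))) := by
  rcases hx.eq_or_lt with rfl | hx
  · simp
  have hθ0 : 0 < x / v := div_pos hx hv0
  have hθ : |-(x / v)| ≤ 1 := by rw [abs_neg, abs_of_pos hθ0]; exact (div_le_one hv0).2 hxv
  have h := measureReal_le_occur_mul_le hBm hB hs hθ (x / v * x)
  have hset : {ω | x / v * x ≤ -(x / v) * (occur B ω - occurMean P B)} =
      {ω | occur B ω - occurMean P B ≤ -x} := by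
    ext ω
    simp only [Set.mem_ofPred_eq]
    rw [neg_mul, ← mul_neg, mul_le_mul_iff_right₀ hθ0, le_neg]
  rw [hset, abs_neg, abs_of_pos hθ0] at h
  refine h.trans (Real.exp_le_exp.2 ?_)
  have : occurVar P B * ((-(x / v)) ^ 2 * (1 + x / v) / 2) ≤
      v * ((-(x / v)) ^ 2 * (1 + x / v) / 2) := by
    gcongr
  refine (add_le_add le_rfl this).trans (le_of_eq ?_)
  field_simp
  ring

/-- A two-sided form of Bernstein's inequality for moderate deviations. -/
lemma measureReal_le_abs_occur_sub_le (hBm : ∀ k, MeasurableSet (B k)) (hB : iIndepSet B P)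
    (hs : Summable fun k => P.real (B k)) {v x : ℝ} (hv : occurVar P B ≤ v) (hv0 : 0 < v)
    (hx : 0 ≤ x) (hxv : x ≤ v / 2) :
    P.real {ω | x ≤ |occur B ω - occurMean P B|} ≤ 2 * Real.exp (-(x ^ 2 / (4 * v))) := by
  have h1 := measureReal_le_occur_sub_le hBm hB hs hv hv0 hx (by linarith)
  have h2 := measureReal_occur_sub_le_neg_le hBm hB hs hv hv0 hx (by linarith)
  have h3 : Real.exp (-(x ^ 2 / (2 * v) * (1 - x / v))) ≤ Real.exp (-(x ^ 2 / (4 * v))) := by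
    refine Real.exp_le_exp.2 (neg_le_neg ?_)
    have : 1 / 2 ≤ 1 - x / v := by
      have : x / v ≤ 1 / 2 := by rw [div_le_iff₀ hv0]; linarith
      linarith
    calc x ^ 2 / (4 * v) = x ^ 2 / (2 * v) * (1 / 2) := by field_simp; norm_num
      _ ≤ _ := by gcongr
  have hset : {ω | x ≤ |occur B ω - occurMean P B|} ⊆ {ω | x ≤ occur B ω - occurMean P B} ∪
      {ω | occur B ω - occurMean P B ≤ -x} := by
    intro ω hω
    have hω' : x ≤ |occur B ω - occurMean P B| := hω
    rcases le_abs.1 hω' with h | h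
    · exact Or.inl h
    · exact Or.inr (show occur B ω - occurMean P B ≤ -x by linarith)
  have := (measureReal_mono (μ := P) hset (measure_ne_top P _)).trans (measureReal_union_le _ _)
  linarith

lemma moments_sum_indicator (hBm : ∀ k, MeasurableSet (B k)) (hB : iIndepSet B P) (A : Finset ℕ) :
    MemLp (fun ω => ∑ k ∈ A, (B k).indicator (fun _ => (1 : ℝ)) ω) 2 P ∧
    ∫ ω, ∑ k ∈ A, (B k).indicator (fun _ => (1 : ℝ)) ω ∂P = ∑ k ∈ A, P.real (B k) ∧
    variance (fun ω => ∑ k ∈ A, (B k).indicator (fun _ => (1 : ℝ)) ω) P = varSum P B A := by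
  have hL : ∀ k, MemLp ((B k).indicator (fun _ => (1 : ℝ))) 2 P := fun k =>
    memLp_indicator_const 2 (hBm k) 1 (Or.inr (measure_ne_top _ _))
  have hmean : ∀ k, ∫ ω, (B k).indicator (fun _ => (1 : ℝ)) ω ∂P = P.real (B k) := fun k => by
    rw [integral_indicator_const _ (hBm k)]; simp
  refine ⟨memLp_finsetSum _ fun k _ => hL k, ?_, ?_⟩
  · rw [integral_finsetSum _ fun k _ => (hL k).integrable (by norm_num)]
    exact Finset.sum_congr rfl fun k _ => hmean k
  · have h := IndepFun.variance_sum (s := A) (μ := P)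
      (X := fun k => (B k).indicator (fun _ => (1 : ℝ))) (fun k _ => hL k)
      (fun i _ k _ hik => hB.iIndepFun_indicator.indepFun hik)
    have e : (fun ω => ∑ k ∈ A, (B k).indicator (fun _ => (1 : ℝ)) ω) =
        ∑ k ∈ A, (B k).indicator (fun _ => (1 : ℝ)) := by ext; simp
    rw [e, h]
    refine Finset.sum_congr rfl fun k _ => ?_
    rw [variance_eq_sub (hL k)]
    have : ((B k).indicator (fun _ => (1 : ℝ))) ^ 2 = (B k).indicator (fun _ => (1 : ℝ)) := by
      ext ω; by_cases h : ω ∈ B k <;> simp [h]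
    rw [this, hmean]; ring

/-- Monotone convergence along the partial counts. It serves both moments: the first through `|x|`,
which agrees with `x` on counts but is nonnegative everywhere as `h0` demands, the second through `x
^ 2`. -/
lemma lintegral_occur_of_continuous (hBm : ∀ k, MeasurableSet (B k))
    (hs : Summable fun k => P.real (B k)) {f : ℝ → ℝ} (hf : Continuous f)
    (hmono : MonotoneOn f (Set.Ici 0)) (hint : ∀ n : ℕ, Integrable
      (fun ω => f (∑ k ∈ Finset.range n, (B k).indicator (fun _ => (1 : ℝ)) ω)) P)
    (h0 : ∀ x, 0 ≤ f x) {c : ℝ}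
    (hc : Tendsto (fun n => ∫ ω, f (∑ k ∈ Finset.range n,
      (B k).indicator (fun _ => (1 : ℝ)) ω) ∂P) atTop (𝓝 c)) :
    ∫⁻ ω, ENNReal.ofReal (f (occur B ω)) ∂P = ENNReal.ofReal c := by
  have hm : ∀ n : ℕ, Measurable fun ω => ∑ k ∈ Finset.range n,
      (B k).indicator (fun _ => (1 : ℝ)) ω := fun n =>
    Finset.measurable_sum _ fun k _ => measurable_const.indicator (hBm k)
  have hnn : ∀ ω, ∀ k, 0 ≤ (B k).indicator (fun _ => (1 : ℝ)) ω := fun ω k =>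
    Set.indicator_nonneg (fun _ _ => zero_le_one) ω
  have h := lintegral_tendsto_of_tendsto_of_monotone (μ := P)
    (f := fun n ω => ENNReal.ofReal (f (∑ k ∈ Finset.range n,
      (B k).indicator (fun _ => (1 : ℝ)) ω))) (F := fun ω => ENNReal.ofReal (f (occur B ω)))
    (fun n => (hf.measurable.comp (hm n)).ennreal_ofReal.aemeasurable)
    (ae_of_all _ fun ω => fun m n hmn => ENNReal.ofReal_le_ofReal (hmono
      (Finset.sum_nonneg fun k _ => hnn ω k) (Finset.sum_nonneg fun k _ => hnn ω k)
      (Finset.sum_le_sum_of_subset_of_nonneg (Finset.range_mono hmn) fun k _ _ => hnn ω k)))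
    (by
      filter_upwards [ae_finite_occur hs] with ω hω
      exact ((ENNReal.continuous_ofReal.comp hf).tendsto _).comp
        (hasSum_occur hω).tendsto_sum_nat)
  refine tendsto_nhds_unique h ?_
  have : Tendsto (fun n => ENNReal.ofReal (∫ ω, f (∑ k ∈ Finset.range n,
      (B k).indicator (fun _ => (1 : ℝ)) ω) ∂P)) atTop (𝓝 (ENNReal.ofReal c)) :=
    (ENNReal.continuous_ofReal.tendsto c).comp hc
  refine this.congr fun n => ?_
  rw [ofReal_integral_eq_lintegral_ofReal (hint n) (ae_of_all _ fun _ => h0 _)]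

/-- Mean and variance of the number of independent events which occur. -/
lemma integral_variance_occur (hBm : ∀ k, MeasurableSet (B k)) (hB : iIndepSet B P)
    (hs : Summable fun k => P.real (B k)) :
    ∫ ω, occur B ω ∂P = occurMean P B ∧ variance (occur B) P = occurVar P B := by
  have hocc0 : ∀ ω, 0 ≤ occur B ω := fun ω =>
    tsum_nonneg fun k => Set.indicator_nonneg (fun _ _ => zero_le_one) ω
  have hm := (measurable_occur hBm)
  have h1 := lintegral_occur_of_continuous hBm hs (f := fun x => |x|) continuous_abs
    (fun x hx y hy hxy => by
      simp only [abs_of_nonneg (show 0 ≤ x from hx), abs_of_nonneg (show 0 ≤ y from hy)]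
      exact hxy)
    (fun n => ((moments_sum_indicator hBm hB _).1.integrable (by norm_num)).abs)
    (fun x => abs_nonneg x) (c := occurMean P B) (by
      refine hs.hasSum.tendsto_sum_nat.congr fun n => ?_
      rw [← (moments_sum_indicator hBm hB _).2.1]
      refine integral_congr_ae (ae_of_all _ fun ω => (abs_of_nonneg ?_).symm)
      exact Finset.sum_nonneg fun k _ => Set.indicator_nonneg (fun _ _ => zero_le_one) ω)
  have h2 := lintegral_occur_of_continuous hBm hs (f := fun x => x ^ 2) (by fun_prop)
    (fun x hx y hy hxy => pow_le_pow_left₀ hx hxy 2)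
    (fun n => (moments_sum_indicator hBm hB _).1.integrable_sq) (fun x => sq_nonneg x)
    (c := occurVar P B + occurMean P B ^ 2) (by
      refine ((tendsto_varSum hs).add (hs.hasSum.tendsto_sum_nat.pow 2)).congr fun n => ?_
      obtain ⟨e1, e2, e3⟩ := moments_sum_indicator (P := P) hBm hB (Finset.range n)
      rw [variance_eq_sub e1, e2] at e3
      rw [← e3]
      simp)
  simp only [abs_of_nonneg (hocc0 _)] at h1
  have hmean0 : 0 ≤ occurMean P B := tsum_nonneg fun k => measureReal_nonneg
  have i1 : ∫ ω, occur B ω ∂P = occurMean P B := by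
    rw [integral_eq_lintegral_of_nonneg_ae (ae_of_all _ hocc0) hm.aestronglyMeasurable, h1,
      ENNReal.toReal_ofReal hmean0]
  have i2 : ∫ ω, occur B ω ^ 2 ∂P = occurVar P B + occurMean P B ^ 2 := by
    rw [integral_eq_lintegral_of_nonneg_ae (ae_of_all _ fun ω => sq_nonneg _)
      (hm.pow_const 2).aestronglyMeasurable, h2,
      ENNReal.toReal_ofReal (add_nonneg occurVar_nonneg (sq_nonneg _))]
  have hL : MemLp (occur B) 2 P := by
    rw [memLp_two_iff_integrable_sq hm.aestronglyMeasurable]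
    refine ⟨(hm.pow_const 2).aestronglyMeasurable, ?_⟩
    rw [hasFiniteIntegral_iff_ofReal (ae_of_all _ fun ω => sq_nonneg _), h2]
    exact ENNReal.ofReal_lt_top
  refine ⟨i1, ?_⟩
  rw [variance_eq_sub hL, i1]
  simp only [Pi.pow_apply]
  rw [i2]; ring

end
end Karlin

/-! ### The counting function `ρ` in de Haan's class. -/

namespace Karlin

section Rho

variable {p : ℕ → ℝ}

lemma finite_setOf_one_div_le (hp : IsBoxDistribution p) (t : ℝ) :
    {k : ℕ | 0 < p k ∧ 1 / p k ≤ t}.Finite := by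
  rcases le_or_gt t 0 with ht | ht
  · refine Set.finite_empty.subset fun k hk => ?_
    have := one_div_pos.2 hk.1
    exact absurd (hk.2.trans ht) (by linarith)
  · have h := hp.hasSum_one.summable.tendsto_cofinite_zero
    have h2 : ∀ᶠ k in cofinite, p k < 1 / t := h.eventually (gt_mem_nhds (one_div_pos.2 ht))
    refine (eventually_cofinite.1 h2).subset fun k hk => ?_
    have h3 : 1 / t ≤ p k := (one_div_le hk.1 ht).1 hk.2
    simpa using h3

lemma hasSum_rho (hp : IsBoxDistribution p) (t : ℝ) :
    HasSum (fun k => {k : ℕ | 0 < p k ∧ 1 / p k ≤ t}.indicator (fun _ => (1 : ℝ)) k) (rho p t) := by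
  have hfin := finite_setOf_one_div_le hp t
  have h : rho p t = ∑ k ∈ hfin.toFinset,
      {k : ℕ | 0 < p k ∧ 1 / p k ≤ t}.indicator (fun _ => (1 : ℝ)) k := by
    rw [rho, Set.ncard_eq_toFinset_card _ hfin, Finset.card_eq_sum_ones, Nat.cast_sum]
    refine Finset.sum_congr rfl fun k hk => ?_
    rw [Set.indicator_of_mem (by simpa using hk), Nat.cast_one]
  rw [h]
  refine hasSum_sum_of_ne_finset_zero fun k hk => ?_
  exact Set.indicator_of_notMem (by simpa using hk) _

lemma rho_nonneg (t : ℝ) : 0 ≤ rho p t := Nat.cast_nonneg _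

lemma rho_mono (hp : IsBoxDistribution p) : Monotone (rho p) := by
  intro s t hst
  refine Nat.cast_le.2 (Set.ncard_le_ncard (fun k hk => ?_) (finite_setOf_one_div_le hp t))
  exact ⟨hk.1, hk.2.trans hst⟩

variable {ℓ : ℝ → ℝ}

/-- The increments of `ρ` over `[t, e t]` vary by at most a factor `√e` when `t` is multiplied
by `e`. -/
lemma eventually_rho_increment_le (hρ : DeHaanPi (rho p) ℓ) (hℓ : Tendsto ℓ atTop atTop) :
    ∀ᶠ t in atTop, 0 < ℓ t ∧ rho p (Real.exp 1 * t) - rho p t ≤ 2 * ℓ t ∧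
      rho p (Real.exp 1 * (Real.exp 1 * t)) - rho p (Real.exp 1 * t) ≤
        Real.exp (1 / 2) * (rho p (Real.exp 1 * t) - rho p t) ∧
      rho p (Real.exp 1 * t) - rho p t ≤
        Real.exp (1 / 2) * (rho p (Real.exp 1 * (Real.exp 1 * t)) - rho p (Real.exp 1 * t)) := by
  have h1 := hρ (Real.exp 1) (Real.exp_pos 1)
  have h2 := hρ (Real.exp 1 * Real.exp 1) (by positivity)
  rw [Real.log_mul (Real.exp_ne_zero 1) (Real.exp_ne_zero 1)] at h2
  rw [Real.log_exp] at h1 h2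
  have hpos : ∀ᶠ t in atTop, 0 < ℓ t := hℓ.eventually_gt_atTop 0
  have h3 := h2.sub h1
  -- Both increments divided by `ℓ t` tend to `1`, hence lie in `(0.95, 1.05)`, and `1.05 < 1.2 *
  -- 0.95`.
  have hq : (1.2 : ℝ) < Real.exp (1 / 2) := by
    have := Real.add_one_le_exp (1 / 2 : ℝ); linarith
  filter_upwards [hpos, h1.eventually (lt_mem_nhds (show (0.95 : ℝ) < 1 by norm_num)),
    h1.eventually (gt_mem_nhds (show (1 : ℝ) < 1.05 by norm_num)),
    h3.eventually (lt_mem_nhds (show (0.95 : ℝ) < 1 + 1 - 1 by norm_num)),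
    h3.eventually (gt_mem_nhds (show (1 + 1 - 1 : ℝ) < 1.05 by norm_num))] with t h0 a1 a2 a3 a4
  rw [← sub_div, mul_assoc] at a3 a4
  rw [lt_div_iff₀ h0] at a1 a3
  rw [div_lt_iff₀ h0] at a2 a4
  refine ⟨h0, by linarith, ?_, ?_⟩ <;> nlinarith

/-- A Potter-type bound for `ρ`. -/
lemma exists_abs_rho_sub_le (hp : IsBoxDistribution p) (hρ : DeHaanPi (rho p) ℓ)
    (hℓ : Tendsto ℓ atTop atTop) :
    ∃ C : ℝ, ∀ᶠ t in atTop, ∀ c : ℝ, 0 < c →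
      |rho p (c * t) - rho p t| ≤ C * ℓ t * (c ^ (1 / 2 : ℝ) + c ^ (-(1 / 2) : ℝ)) := by
  obtain ⟨T, hT⟩ := eventually_atTop.1 (eventually_rho_increment_le hρ hℓ)
  set e := Real.exp 1 with he
  set q := Real.exp (1 / 2) with hq
  set a : ℝ → ℝ := fun t => rho p (e * t) - rho p t with ha
  set T₀ := max T 1 with hT₀
  have hT01 : 1 ≤ T₀ := le_max_right _ _
  have hTT : ∀ t, T₀ ≤ t → T ≤ t := fun t ht => (le_max_left _ _).trans ht
  have he1 : 1 ≤ e := Real.one_le_exp (by norm_num)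
  have he0 : 0 < e := by positivity
  have hq1 : 3 / 2 ≤ q := by have := Real.add_one_le_exp (1 / 2 : ℝ); linarith
  have hq0 : 0 < q := by positivity
  have ha0 : ∀ t, 0 ≤ t → 0 ≤ a t := fun t ht =>
    sub_nonneg.2 (rho_mono hp (le_mul_of_one_le_left ht he1))
  have hge : ∀ n : ℕ, ∀ t, T₀ ≤ t → T₀ ≤ e ^ n * t := fun n t ht =>
    ht.trans (le_mul_of_one_le_left (by linarith) (one_le_pow₀ he1))
  -- The increments over successive factors `e` grow at most geometrically with ratio `q = √e`. The
  -- constant `3` closes the induction because `3 q ≥ 4`.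
  have hup : ∀ n : ℕ, ∀ t, T₀ ≤ t → a (e ^ n * t) ≤ q ^ n * a t ∧
      rho p (e ^ n * t) - rho p t ≤ 3 * q ^ n * a t := by
    intro n t ht
    induction n with
    | zero => simpa using ha0 t (by linarith)
    | succ n ih =>
      have h1 := (hT _ (hTT _ (hge n t ht))).2.2.1
      have e1 : e ^ (n + 1) * t = e * (e ^ n * t) := by ring
      have h2 : a (e ^ (n + 1) * t) ≤ q * a (e ^ n * t) := by rw [e1]; exact h1
      have h3 : rho p (e ^ (n + 1) * t) - rho p (e ^ n * t) = a (e ^ n * t) := by rw [e1]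
      have h4 : 0 ≤ q ^ n * a t := mul_nonneg (by positivity) (ha0 t (by linarith))
      refine ⟨?_, ?_⟩
      · calc _ ≤ q * (q ^ n * a t) := h2.trans (by gcongr; exact ih.1)
          _ = _ := by ring
      · have : 3 * q ^ (n + 1) * a t = 3 * q * (q ^ n * a t) := by ring
        nlinarith [ih.1, ih.2]
  have hdown : ∀ n : ℕ, ∀ s, T₀ ≤ s → rho p (e ^ n * s) - rho p s ≤ 3 * q ^ n * a (e ^ n * s) ∧
      a s ≤ q ^ n * a (e ^ n * s) := by
    intro n
    induction n with
    | zero => intro s hs; simpa using ha0 s (by linarith)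
    | succ n ih =>
      intro s hs
      have h1 := (hT _ (hTT _ hs)).2.2.2
      obtain ⟨h2, h3⟩ := ih (e * s) (by simpa using hge 1 s hs)
      have e1 : e ^ n * (e * s) = e ^ (n + 1) * s := by ring
      rw [e1] at h2 h3
      have h5 : a s ≤ q * a (e * s) := h1
      have h6 : a s ≤ q * (q ^ n * a (e ^ (n + 1) * s)) :=
        h5.trans (mul_le_mul_of_nonneg_left h3 hq0.le)
      have h7 : 0 ≤ q ^ n * a (e ^ (n + 1) * s) := mul_nonneg (by positivity)
        (ha0 _ (by have := hge (n + 1) s hs; linarith))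
      have h8 : rho p (e * s) - rho p s = a s := rfl
      refine ⟨?_, h6.trans (le_of_eq (by ring))⟩
      have : 3 * q ^ (n + 1) * a (e ^ (n + 1) * s) = 3 * q * (q ^ n * a (e ^ (n + 1) * s)) := by
        ring
      nlinarith
  -- Rounding `log c` up to an integer turns the geometric bound `q ^ n` into the power `c ^ (1 /
  -- 2)`.
  have hqpow : ∀ c : ℝ, 1 ≤ c → c ≤ e ^ ⌈Real.log c⌉₊ ∧ e ^ ⌈Real.log c⌉₊ ≤ e * c ∧
      q ^ ⌈Real.log c⌉₊ ≤ q * c ^ (1 / 2 : ℝ) := by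
    intro c hc
    have hc0 : 0 < c := by linarith
    have hl := Real.log_nonneg hc
    have hceil := (Nat.ceil_lt_add_one hl).le
    refine ⟨?_, ?_, ?_⟩
    · rw [he, ← Real.exp_nat_mul, mul_one]
      calc c = Real.exp (Real.log c) := (Real.exp_log hc0).symm
        _ ≤ _ := Real.exp_le_exp.2 (Nat.le_ceil _)
    · rw [he, ← Real.exp_nat_mul, mul_one]
      calc _ ≤ Real.exp (Real.log c + 1) := Real.exp_le_exp.2 hceil
        _ = _ := by rw [Real.exp_add, Real.exp_log hc0, mul_comm]
    · rw [hq, ← Real.exp_nat_mul, Real.rpow_def_of_pos hc0, ← Real.exp_add]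
      refine Real.exp_le_exp.2 ?_
      linarith
  have hupper : ∀ t, T₀ ≤ t → ∀ c, 1 ≤ c →
      rho p (c * t) - rho p t ≤ 6 * q * ℓ t * c ^ (1 / 2 : ℝ) := by
    intro t ht c hc
    obtain ⟨h1, -, h3⟩ := hqpow c hc
    have h4 : rho p (c * t) ≤ rho p (e ^ ⌈Real.log c⌉₊ * t) :=
      rho_mono hp (by have : 0 ≤ t := by linarith
                      gcongr)
    have h5 := (hup ⌈Real.log c⌉₊ t ht).2
    have h6 : a t ≤ 2 * ℓ t := (hT t (hTT t ht)).2.1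
    have h7 := ha0 t (by linarith)
    have h8 : 0 ≤ ℓ t := (hT t (hTT t ht)).1.le
    calc _ ≤ 3 * q ^ ⌈Real.log c⌉₊ * a t := by linarith
      _ ≤ 3 * (q * c ^ (1 / 2 : ℝ)) * (2 * ℓ t) := by gcongr
      _ = _ := by ring
  have hlower : ∀ t, ∀ c, 0 < c → c ≤ 1 → e * T₀ ≤ c * t →
      rho p t - rho p (c * t) ≤ 6 * q * ℓ t * c ^ (-(1 / 2) : ℝ) := by
    intro t c hc0 hc ht
    have ht0 : 0 < t := by
      by_contra h
      have : c * t ≤ 0 := mul_nonpos_of_nonneg_of_nonpos hc0.le (by linarith)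
      have : 0 < e * T₀ := by positivity
      linarith
    have hTt : T₀ ≤ t := by
      calc T₀ ≤ e * T₀ := le_mul_of_one_le_left (by linarith) he1
        _ ≤ c * t := ht
        _ ≤ t := mul_le_of_le_one_left ht0.le hc
    have hc1 : 1 ≤ c⁻¹ := (one_le_inv₀ hc0).2 hc
    obtain ⟨h1, h2, h3⟩ := hqpow c⁻¹ hc1
    set n := ⌈Real.log c⁻¹⌉₊ with hn
    have hen : 0 < e ^ n := by positivity
    have hs : T₀ ≤ t / e ^ n := by
      rw [le_div_iff₀ hen]
      calc T₀ * e ^ n ≤ T₀ * (e * c⁻¹) := by gcongr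
        _ = (e * T₀) / c := by field_simp
        _ ≤ t := by rw [div_le_iff₀ hc0]; linarith
    have h4 : rho p (t / e ^ n) ≤ rho p (c * t) := by
      refine rho_mono hp ?_
      rw [div_le_iff₀ hen]
      calc t = c * t * c⁻¹ := by field_simp
        _ ≤ c * t * e ^ n := by gcongr
    have h5 := (hdown n _ hs).1
    rw [mul_div_cancel₀ _ hen.ne'] at h5
    have h6 : a t ≤ 2 * ℓ t := (hT t (hTT t hTt)).2.1
    have h7 := ha0 t ht0.le
    have h8 : 0 ≤ ℓ t := (hT t (hTT t hTt)).1.le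
    have h9 : c⁻¹ ^ (1 / 2 : ℝ) = c ^ (-(1 / 2) : ℝ) := by
      rw [Real.inv_rpow hc0.le, Real.rpow_neg hc0.le]
    rw [h9] at h3
    calc _ ≤ 3 * q ^ n * a t := by linarith
      _ ≤ 3 * (q * c ^ (-(1 / 2) : ℝ)) * (2 * ℓ t) := by gcongr
      _ = _ := by ring
  refine ⟨6 * q + 1, ?_⟩
  filter_upwards [eventually_ge_atTop (e * T₀), hℓ.eventually_ge_atTop (rho p (e * T₀))]
    with t ht hρt c hc
  have hTt : T₀ ≤ t := (le_mul_of_one_le_left (by linarith) he1).trans ht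
  have ht0 : 0 < t := by linarith
  have h8 : 0 < ℓ t := (hT t (hTT t hTt)).1
  have hp1 : 0 ≤ c ^ (1 / 2 : ℝ) := Real.rpow_nonneg hc.le _
  have hp2 : 0 ≤ c ^ (-(1 / 2) : ℝ) := Real.rpow_nonneg hc.le _
  have hA : 0 ≤ 6 * q * ℓ t * c ^ (1 / 2 : ℝ) := by positivity
  have hB : 0 ≤ 6 * q * ℓ t * c ^ (-(1 / 2) : ℝ) := by positivity
  have hA' : 0 ≤ ℓ t * c ^ (1 / 2 : ℝ) := by positivity
  have hB' : 0 ≤ ℓ t * c ^ (-(1 / 2) : ℝ) := by positivity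
  rcases le_total 1 c with hc1 | hc1
  · rw [abs_of_nonneg (sub_nonneg.2 (rho_mono hp (le_mul_of_one_le_left ht0.le hc1)))]
    have := hupper t hTt c hc1
    linarith
  · rw [abs_sub_comm,
      abs_of_nonneg (sub_nonneg.2 (rho_mono hp (mul_le_of_le_one_left ht0.le hc1)))]
    by_cases hct : e * T₀ ≤ c * t
    · have := hlower t c hc hc1 hct
      linarith
    -- Below `e * T₀` increments of `ρ` are not controlled. There `ρ (c t) ≥ 0`, and the excess `ρ
    -- (e T₀)` is a constant, eventually below `ℓ t`; this is the `+ 1` in the constant.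
    · push Not at hct
      have hc'0 : 0 < e * T₀ / t := by positivity
      have := hlower t (e * T₀ / t) hc'0 ((div_le_one ht0).2 ht) (by
        rw [div_mul_cancel₀ _ ht0.ne'])
      rw [div_mul_cancel₀ _ ht0.ne'] at this
      have h10 : (e * T₀ / t) ^ (-(1 / 2) : ℝ) ≤ c ^ (-(1 / 2) : ℝ) :=
        Real.rpow_le_rpow_of_nonpos hc ((le_div_iff₀ ht0).2 hct.le) (by norm_num)
      have h11 : 1 ≤ c ^ (-(1 / 2) : ℝ) :=
        Real.one_le_rpow_of_pos_of_le_one_of_nonpos hc hc1 (by norm_num)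
      have h12 : 6 * q * ℓ t * (e * T₀ / t) ^ (-(1 / 2) : ℝ) ≤
          6 * q * ℓ t * c ^ (-(1 / 2) : ℝ) := by gcongr
      have h13 : ℓ t ≤ ℓ t * c ^ (-(1 / 2) : ℝ) := le_mul_of_one_le_right h8.le h11
      have h14 := rho_nonneg (p := p) (c * t)
      linarith

/-- A function in de Haan's class with nonnegative values dominates its auxiliary function. -/
lemma tendsto_rho_div_atTop (hρ : DeHaanPi (rho p) ℓ) (hℓ : Tendsto ℓ atTop atTop) :
    Tendsto (fun t => rho p t / ℓ t) atTop atTop := by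
  refine tendsto_atTop.2 fun M => ?_
  have h := (hρ (Real.exp (-(|M| + 1))) (Real.exp_pos _))
  rw [Real.log_exp] at h
  filter_upwards [h.eventually (gt_mem_nhds (show -(|M| + 1) < -|M| by linarith)),
    hℓ.eventually_gt_atTop 0] with t ht h0
  rw [div_lt_iff₀ h0] at ht
  rw [le_div_iff₀ h0]
  have := rho_nonneg (p := p) (Real.exp (-(|M| + 1)) * t)
  nlinarith [le_abs_self M]

end Rho

end Karlin

/-! ### Abelian theorem for sums `∑ G (p k * t)`. -/

namespace Karlin

section Abel

variable {p : ℕ → ℝ} {ℓ φ : ℝ → ℝ} {C : ℝ}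

lemma integrableOn_exp_neg_div_four_mul_rpow {s : ℝ} (hs : -1 < s) :
    IntegrableOn (fun x : ℝ => Real.exp (-(x / 4)) * x ^ s) (Set.Ioi 0) := by
  have := integrableOn_rpow_mul_exp_neg_mul_rpow hs one_pos (by norm_num : (0 : ℝ) < 1 / 4)
  refine this.congr_fun (fun x _ => ?_) measurableSet_Ioi
  simp only [Real.rpow_one]
  rw [mul_comm]; congr 2; ring

lemma integrableOn_of_abs_le_exp (hφ : Measurable φ)
    (hb : ∀ x, 0 < x → |φ x| ≤ C * Real.exp (-(x / 4))) : IntegrableOn φ (Set.Ioi 0) := by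
  have h := (integrableOn_exp_neg_div_four_mul_rpow (s := 0) (by norm_num)).const_mul C
  refine h.mono' hφ.aestronglyMeasurable ?_
  filter_upwards [ae_restrict_mem measurableSet_Ioi] with x hx
  simpa using hb x hx

/-- The representation of `∑ G(p_k t)`, where `G' = φ`, as an integral with respect to `ρ`. -/
lemma hasSum_integral_rho (hp : IsBoxDistribution p) (hφ : Measurable φ)
    (hb : ∀ x, 0 < x → |φ x| ≤ C * Real.exp (-(x / 4))) {t : ℝ} (ht : 0 < t) :
    HasSum (fun k => ∫ x in Set.Ioc 0 (p k * t), φ x) (∫ x in Set.Ioi 0, φ x * rho p (t / x)) ∧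
      IntegrableOn (fun x => φ x * rho p (t / x)) (Set.Ioi 0) := by
  have hC : 0 ≤ C := by
    have := (abs_nonneg _).trans (hb 1 one_pos)
    exact nonneg_of_mul_nonneg_left this (Real.exp_pos _)
  have hint := integrableOn_of_abs_le_exp hφ hb
  have hCb : ∀ x, 0 < x → |φ x| ≤ C := fun x hx => (hb x hx).trans
    (mul_le_of_le_one_right hC (Real.exp_le_one_iff.2 (by linarith)))
  -- For `x > 0`, `x ≤ p k * t` means `1 / p k ≤ t / x`; summing over `k` produces `ρ (t / x)`.
  have hpt : ∀ k, ∀ x ∈ Set.Ioi (0 : ℝ), (Set.Ioc 0 (p k * t)).indicator φ x =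
      φ x * {k : ℕ | 0 < p k ∧ 1 / p k ≤ t / x}.indicator (fun _ => (1 : ℝ)) k := by
    intro k x hx
    have hx0 : 0 < x := hx
    have hiff : x ∈ Set.Ioc 0 (p k * t) ↔ 0 < p k ∧ 1 / p k ≤ t / x := by
      constructor
      · rintro ⟨-, h⟩
        have hpk : 0 < p k := by
          by_contra hn
          have := mul_nonpos_of_nonpos_of_nonneg (not_lt.1 hn) ht.le
          linarith
        refine ⟨hpk, ?_⟩
        rw [div_le_div_iff₀ hpk hx0]; linarith
      · rintro ⟨hpk, h⟩
        rw [div_le_div_iff₀ hpk hx0] at h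
        exact ⟨hx0, by linarith⟩
    by_cases h : x ∈ Set.Ioc 0 (p k * t)
    · rw [Set.indicator_of_mem h, Set.indicator_of_mem (by exact hiff.1 h), mul_one]
    · rw [Set.indicator_of_notMem h, Set.indicator_of_notMem
        (show k ∉ {k : ℕ | 0 < p k ∧ 1 / p k ≤ t / x} from fun h' => h (hiff.2 h')), mul_zero]
  have hsub : ∀ k, Set.Ioc 0 (p k * t) ⊆ Set.Ioi 0 := fun k => Set.Ioc_subset_Ioi_self
  have hik : ∀ k, Integrable ((Set.Ioc 0 (p k * t)).indicator φ)
      (volume.restrict (Set.Ioi 0)) := fun k => hint.integrable.indicator measurableSet_Ioc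
  have hnorm : ∀ k, ∫ x in Set.Ioi 0, ‖(Set.Ioc 0 (p k * t)).indicator φ x‖ ≤ C * t * p k := by
    intro k
    have h0 : 0 ≤ p k * t := mul_nonneg (hp.nonneg k) ht.le
    have : ∫ x in Set.Ioi 0, ‖(Set.Ioc 0 (p k * t)).indicator φ x‖ =
        ∫ x in Set.Ioc 0 (p k * t), ‖φ x‖ := by
      simp_rw [norm_indicator_eq_indicator_norm]
      rw [setIntegral_indicator measurableSet_Ioc, Set.inter_eq_right.2 (hsub k)]
    rw [this]
    calc _ ≤ ∫ x in Set.Ioc 0 (p k * t), C := by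
          refine setIntegral_mono_on ((hint.mono_set (hsub k)).norm) (by simp) measurableSet_Ioc
            fun x hx => hCb x hx.1
      _ = _ := by
          rw [setIntegral_const, Real.volume_real_Ioc_of_le h0, smul_eq_mul]; ring
  have hsummable : Summable fun k => ∫ x in Set.Ioi 0, ‖(Set.Ioc 0 (p k * t)).indicator φ x‖ :=
    (hp.hasSum_one.summable.mul_left (C * t)).of_nonneg_of_le
      (fun k => integral_nonneg fun x => norm_nonneg _) hnorm
  have hsum := hasSum_integral_of_summable_integral_norm hik hsummable
  have htsum : ∀ x ∈ Set.Ioi (0 : ℝ),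
      ∑' k, (Set.Ioc 0 (p k * t)).indicator φ x = φ x * rho p (t / x) := by
    intro x hx
    simp_rw [fun k => hpt k x hx]
    exact ((hasSum_rho hp (t / x)).mul_left (φ x)).tsum_eq
  rw [setIntegral_congr_fun measurableSet_Ioi htsum] at hsum
  refine ⟨?_, ?_⟩
  · have e : ∀ k, ∫ x in Set.Ioi 0, (Set.Ioc 0 (p k * t)).indicator φ x =
        ∫ x in Set.Ioc 0 (p k * t), φ x := fun k => by
      rw [setIntegral_indicator measurableSet_Ioc, Set.inter_eq_right.2 (hsub k)]
    simpa only [e] using hsum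
  · refine ⟨(hφ.mul ((rho_mono hp).measurable.comp
      (measurable_const.div measurable_id))).aestronglyMeasurable, ?_⟩
    calc ∫⁻ x in Set.Ioi 0, ‖φ x * rho p (t / x)‖ₑ
        ≤ ∫⁻ x in Set.Ioi 0, ∑' k, ‖(Set.Ioc 0 (p k * t)).indicator φ x‖ₑ := by
          refine setLIntegral_mono' measurableSet_Ioi fun x hx => ?_
          rw [← htsum x hx]
          exact enorm_tsum_le_tsum_enorm
      _ = ∑' k, ∫⁻ x in Set.Ioi 0, ‖(Set.Ioc 0 (p k * t)).indicator φ x‖ₑ :=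
          lintegral_tsum fun k => (hφ.indicator measurableSet_Ioc).enorm.aemeasurable
      _ = ∑' k, ENNReal.ofReal (∫ x in Set.Ioi 0, ‖(Set.Ioc 0 (p k * t)).indicator φ x‖) :=
          tsum_congr fun k => (ofReal_integral_norm_eq_lintegral_enorm (hik k)).symm
      _ < ∞ := hsummable.tsum_ofReal_lt_top

/-- An Abelian theorem for de Haan's class. -/
lemma tendsto_tsum_sub_rho_div (hp : IsBoxDistribution p) (hρ : DeHaanPi (rho p) ℓ)
    (hℓ : Tendsto ℓ atTop atTop) (hφ : Measurable φ)
    (hb : ∀ x, 0 < x → |φ x| ≤ C * Real.exp (-(x / 4))) :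
    Tendsto (fun t => ((∑' k, ∫ x in Set.Ioc 0 (p k * t), φ x) -
      (∫ x in Set.Ioi 0, φ x) * rho p t) / ℓ t) atTop
      (𝓝 (∫ x in Set.Ioi 0, φ x * -Real.log x)) := by
  have hC : 0 ≤ C := by
    have := (abs_nonneg _).trans (hb 1 one_pos)
    exact nonneg_of_mul_nonneg_left this (Real.exp_pos _)
  obtain ⟨D, hD⟩ := exists_abs_rho_sub_le hp hρ hℓ
  have hint := integrableOn_of_abs_le_exp hφ hb
  have hbound : IntegrableOn (fun x : ℝ => C * |D| * (Real.exp (-(x / 4)) * x ^ (-(1 / 2) : ℝ) +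
      Real.exp (-(x / 4)) * x ^ (1 / 2 : ℝ))) (Set.Ioi 0) :=
    ((integrableOn_exp_neg_div_four_mul_rpow (by norm_num)).add
      (integrableOn_exp_neg_div_four_mul_rpow (by norm_num))).const_mul _
  have hrm : ∀ t : ℝ, Measurable fun x : ℝ => rho p (t / x) := fun t =>
    (rho_mono hp).measurable.comp (measurable_const.div measurable_id)
  -- The definition of the class with `c = x⁻¹` gives the pointwise limit `-log x`; the Potter-type
  -- bound dominates, as `x ^ (± 1 / 2)` is integrable against `exp (-(x / 4))`.
  have hmain : Tendsto (fun t => ∫ x in Set.Ioi 0, φ x * ((rho p (t / x) - rho p t) / ℓ t)) atTop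
      (𝓝 (∫ x in Set.Ioi 0, φ x * -Real.log x)) := by
    refine tendsto_integral_filter_of_dominated_convergence _ ?_ ?_ hbound ?_
    · exact Eventually.of_forall fun t =>
        (hφ.mul (((hrm t).sub_const _).div_const _)).aestronglyMeasurable
    · filter_upwards [hD, hℓ.eventually_gt_atTop 0] with t hDt h0
      filter_upwards [ae_restrict_mem measurableSet_Ioi] with x hx
      have hx0 : 0 < x := hx
      have h1 := hDt x⁻¹ (inv_pos.2 hx0)
      rw [Real.inv_rpow hx0.le, ← Real.rpow_neg hx0.le, Real.inv_rpow hx0.le,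
        ← Real.rpow_neg hx0.le, neg_neg, inv_mul_eq_div] at h1
      rw [norm_mul, norm_div, Real.norm_eq_abs, Real.norm_eq_abs, Real.norm_of_nonneg h0.le]
      have hr1 : 0 ≤ x ^ (-(1 / 2) : ℝ) := Real.rpow_nonneg hx0.le _
      have hr2 : 0 ≤ x ^ (1 / 2 : ℝ) := Real.rpow_nonneg hx0.le _
      have h2 : |rho p (t / x) - rho p t| / ℓ t ≤
          |D| * (x ^ (-(1 / 2) : ℝ) + x ^ (1 / 2 : ℝ)) := by
        rw [div_le_iff₀ h0]
        refine h1.trans ?_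
        have : D * ℓ t * (x ^ (-(1 / 2) : ℝ) + x ^ (1 / 2 : ℝ)) ≤
            |D| * ℓ t * (x ^ (-(1 / 2) : ℝ) + x ^ (1 / 2 : ℝ)) := by
          gcongr; exact le_abs_self D
        linarith
      calc _ ≤ (C * Real.exp (-(x / 4))) * (|D| * (x ^ (-(1 / 2) : ℝ) + x ^ (1 / 2 : ℝ))) := by
            gcongr; exact hb x hx0
        _ = _ := by ring
    · filter_upwards [ae_restrict_mem measurableSet_Ioi] with x hx
      have hx0 : 0 < x := hx
      have h1 := hρ x⁻¹ (inv_pos.2 hx0)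
      rw [Real.log_inv] at h1
      simp_rw [inv_mul_eq_div] at h1
      exact h1.const_mul _
  refine hmain.congr' ?_
  filter_upwards [eventually_gt_atTop 0] with t ht
  obtain ⟨h1, h2⟩ := hasSum_integral_rho hp hφ hb ht
  rw [h1.tsum_eq, ← integral_mul_const, ← integral_sub h2 (hint.mul_const _), ← integral_div]
  refine integral_congr_ae (ae_of_all _ fun x => ?_)
  simp only
  ring

/-- The Abelian theorem for a function given by its derivative. -/
lemma tendsto_tsum_of_hasDerivAt (hp : IsBoxDistribution p) (hρ : DeHaanPi (rho p) ℓ)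
    (hℓ : Tendsto ℓ atTop atTop) {G : ℝ → ℝ} {m : ℝ} (hφ : Continuous φ)
    (hb : ∀ x, 0 < x → |φ x| ≤ C * Real.exp (-(x / 4))) (hG : ∀ x, HasDerivAt G (φ x) x)
    (hG0 : G 0 = 0) (hGm : Tendsto G atTop (𝓝 m)) :
    Tendsto (fun t => (∑' k, G (p k * t) - m * rho p t) / ℓ t) atTop
      (𝓝 (∫ x in Set.Ioi 0, φ x * -Real.log x)) ∧
    ∀ t, 0 < t → Summable fun k => G (p k * t) := by
  have hint := integrableOn_of_abs_le_exp hφ.measurable hb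
  have hFTC : ∀ y, 0 ≤ y → ∫ x in Set.Ioc 0 y, φ x = G y := fun y hy => by
    rw [← intervalIntegral.integral_of_le hy,
      intervalIntegral.integral_eq_sub_of_hasDerivAt (fun x _ => hG x)
        (hφ.intervalIntegrable _ _), hG0, sub_zero]
  have hm : ∫ x in Set.Ioi 0, φ x = m := by
    rw [integral_Ioi_of_hasDerivAt_of_tendsto' (fun x _ => hG x) hint hGm, hG0, sub_zero]
  have hk : ∀ t, 0 < t → ∀ k, ∫ x in Set.Ioc 0 (p k * t), φ x = G (p k * t) := fun t ht k =>
    hFTC _ (mul_nonneg (hp.nonneg k) ht.le)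
  refine ⟨?_, fun t ht => ?_⟩
  · refine (tendsto_tsum_sub_rho_div hp hρ hℓ hφ.measurable hb).congr' ?_
    filter_upwards [eventually_gt_atTop 0] with t ht
    rw [hm]
    simp_rw [hk t ht]
  · have := (hasSum_integral_rho hp hφ.measurable hb ht).1.summable
    simpa only [hk t ht] using this

end Abel

end Karlin

/-! ### The limiting variance constant. -/

namespace Karlin

/-- The variance of the indicator that a Poisson variable with mean `x` is at least `j`. -/
noncomputable def poisVar (j : ℕ) (x : ℝ) : ℝ := poisGe j x * (1 - poisGe j x)

lemma poisVar_nonneg (j : ℕ) {x : ℝ} (hx : 0 ≤ x) : 0 ≤ poisVar j x :=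
  mul_nonneg (poisGe_nonneg j hx) (by linarith [poisGe_le_one j hx])

lemma poisWeight_le_quarter (j : ℕ) {x : ℝ} (hx : 0 ≤ x) :
    poisWeight j x ≤ 2 ^ j * Real.exp (-(x / 4)) :=
  (poisWeight_le j hx).trans (by gcongr; norm_num)

lemma poisVar_le {j : ℕ} (hj : 1 ≤ j) {x : ℝ} (hx : 0 ≤ x) :
    poisVar j x ≤ 2 ^ j * (x * Real.exp (-(x / 2))) := by
  rw [poisVar, one_sub_poisGe]
  calc _ ≤ x * (2 ^ j * Real.exp (-(x / 2))) :=
        mul_le_mul (poisGe_le_self hj hx) (poisLt_le j hx) (poisLt_nonneg j hx) hx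
    _ = _ := by ring

lemma abs_poisWeight_mul_le (j i : ℕ) {x : ℝ} (hx : 0 ≤ x) :
    |poisWeight j x * (1 - 2 * poisGe i x)| ≤ 2 ^ j * Real.exp (-(x / 4)) := by
  rw [abs_mul, abs_of_nonneg (poisWeight_nonneg j hx)]
  have h1 := poisGe_nonneg i hx
  have h2 := poisGe_le_one i hx
  have : |1 - 2 * poisGe i x| ≤ 1 := by rw [abs_le]; constructor <;> linarith
  calc _ ≤ poisWeight j x * 1 := by gcongr; exact poisWeight_nonneg j hx
    _ ≤ _ := by rw [mul_one]; exact poisWeight_le_quarter j hx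

lemma hasDerivAt_poisVar_succ (j : ℕ) (x : ℝ) :
    HasDerivAt (poisVar (j + 1)) (poisWeight j x * (1 - 2 * poisGe (j + 1) x)) x := by
  have h := hasDerivAt_poisGe_succ j x
  have h2 : HasDerivAt (poisVar (j + 1)) _ x := h.mul (h.const_sub 1)
  exact h2.congr_deriv (by ring)

lemma tendsto_poisGe_atTop (j : ℕ) : Tendsto (poisGe j) atTop (𝓝 1) := by
  have h0 : Tendsto (fun x : ℝ => 2 ^ j * Real.exp (-(x / 2))) atTop (𝓝 (2 ^ j * 0)) := by
    refine Tendsto.const_mul _ (Real.tendsto_exp_atBot.comp ?_)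
    exact tendsto_neg_atTop_atBot.comp (tendsto_id.atTop_div_const (by norm_num))
  rw [mul_zero] at h0
  have h1 : Tendsto (poisLt j) atTop (𝓝 0) := by
    refine tendsto_of_tendsto_of_tendsto_of_le_of_le' tendsto_const_nhds h0 ?_ ?_
    · filter_upwards [eventually_ge_atTop 0] with x hx using poisLt_nonneg j hx
    · filter_upwards [eventually_ge_atTop 0] with x hx using poisLt_le j hx
  have h2 := h1.const_sub 1
  rw [sub_zero] at h2
  exact h2

lemma tendsto_poisVar_atTop (j : ℕ) : Tendsto (poisVar j) atTop (𝓝 0) := by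
  have h := tendsto_poisGe_atTop j
  have h2 := h.mul (h.const_sub 1)
  rw [sub_self, mul_zero] at h2
  exact h2

lemma abs_log_le {x : ℝ} (hx : 0 < x) :
    |Real.log x| ≤ 2 * (x ^ (1 / 2 : ℝ) + x ^ (-(1 / 2) : ℝ)) := by
  have h1 := Real.log_le_rpow_div hx.le (show (0 : ℝ) < 1 / 2 by norm_num)
  have h2 := Real.log_le_rpow_div (inv_pos.2 hx).le (show (0 : ℝ) < 1 / 2 by norm_num)
  rw [Real.log_inv, Real.inv_rpow hx.le, ← Real.rpow_neg hx.le] at h2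
  have h3 := Real.rpow_nonneg hx.le (1 / 2 : ℝ)
  have h4 := Real.rpow_nonneg hx.le (-(1 / 2) : ℝ)
  rw [abs_le]
  constructor <;> linarith

lemma integrableOn_mul_log {φ : ℝ → ℝ} {C : ℝ} (hφ : Measurable φ)
    (hb : ∀ x, 0 < x → |φ x| ≤ C * Real.exp (-(x / 4))) :
    IntegrableOn (fun x => φ x * -Real.log x) (Set.Ioi 0) := by
  have hbound : IntegrableOn (fun x : ℝ => C * 2 * (Real.exp (-(x / 4)) * x ^ (1 / 2 : ℝ) +
      Real.exp (-(x / 4)) * x ^ (-(1 / 2) : ℝ))) (Set.Ioi 0) :=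
    ((integrableOn_exp_neg_div_four_mul_rpow (by norm_num)).add
      (integrableOn_exp_neg_div_four_mul_rpow (by norm_num))).const_mul _
  refine hbound.mono' (hφ.mul Real.measurable_log.neg).aestronglyMeasurable ?_
  filter_upwards [ae_restrict_mem measurableSet_Ioi] with x hx
  have hx0 : 0 < x := hx
  have h0 : 0 ≤ C * Real.exp (-(x / 4)) := (abs_nonneg _).trans (hb x hx0)
  rw [norm_mul, norm_neg, Real.norm_eq_abs, Real.norm_eq_abs]
  calc _ ≤ (C * Real.exp (-(x / 4))) * (2 * (x ^ (1 / 2 : ℝ) + x ^ (-(1 / 2) : ℝ))) :=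
        mul_le_mul (hb x hx0) (abs_log_le hx0) (abs_nonneg _) h0
    _ = _ := by ring

/-- Integration by parts against the logarithm. -/
lemma integral_deriv_mul_neg_log {h φ : ℝ → ℝ} {C : ℝ} (hφ : Measurable φ)
    (hb : ∀ x, 0 < x → |φ x| ≤ C * Real.exp (-(x / 4))) (hd : ∀ x, HasDerivAt h (φ x) x)
    (hh : ∀ x, 0 ≤ x → |h x| ≤ C * (x * Real.exp (-(x / 4)))) :
    IntegrableOn (fun x => h x / x) (Set.Ioi 0) ∧
    ∫ x in Set.Ioi 0, φ x * -Real.log x = ∫ x in Set.Ioi 0, h x / x := by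
  have hhm : Measurable h := (continuous_iff_continuousAt.2 fun x => (hd x).continuousAt).measurable
  have hint : IntegrableOn (fun x => h x / x) (Set.Ioi 0) := by
    refine integrableOn_of_abs_le_exp (C := C) (hhm.div measurable_id) fun x hx => ?_
    rw [abs_div, abs_of_pos hx, div_le_iff₀ hx]
    calc _ ≤ _ := hh x hx.le
      _ = _ := by ring
  refine ⟨hint, ?_⟩
  have hdom : ∀ x, 0 < x → ‖(h * fun x => -Real.log x) x‖ ≤
      2 * C * (x * Real.exp (-(x / 4)) * (x ^ (1 / 2 : ℝ) + x ^ (-(1 / 2) : ℝ))) := fun x hx => by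
    rw [Pi.mul_apply, norm_mul, norm_neg, Real.norm_eq_abs, Real.norm_eq_abs]
    calc _ ≤ (C * (x * Real.exp (-(x / 4)))) * (2 * (x ^ (1 / 2 : ℝ) + x ^ (-(1 / 2) : ℝ))) :=
          mul_le_mul (hh x hx.le) (abs_log_le hx) (abs_nonneg _)
            ((abs_nonneg _).trans (hh x hx.le))
      _ = _ := by ring
  have hdom' : ∀ x, 0 < x → ‖(h * fun x => -Real.log x) x‖ ≤
      2 * C * (x ^ (3 / 2 : ℝ) * Real.exp (-(1 / 4) * x) +
        x ^ (1 / 2 : ℝ) * Real.exp (-(1 / 4) * x)) := fun x hx => by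
    refine (hdom x hx).trans (le_of_eq ?_)
    have e1 : x ^ (3 / 2 : ℝ) = x * x ^ (1 / 2 : ℝ) := by
      rw [show (3 / 2 : ℝ) = 1 + 1 / 2 by norm_num, Real.rpow_add hx, Real.rpow_one]
    have e2 : x ^ (1 / 2 : ℝ) = x * x ^ (-(1 / 2) : ℝ) := by
      nth_rewrite 1 [show (1 / 2 : ℝ) = 1 + -(1 / 2) by norm_num]
      rw [Real.rpow_add hx, Real.rpow_one]
    have e3 : Real.exp (-(x / 4)) = Real.exp (-(1 / 4) * x) := by congr 1; ring
    rw [e3, e1]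
    linear_combination (-(2 * C * Real.exp (-(1 / 4) * x))) * e2
  have h0 : Tendsto (h * fun x => -Real.log x) (𝓝[>] 0) (𝓝 0) := by
    refine squeeze_zero_norm' ((eventually_mem_nhdsWithin).mono fun x hx => hdom' x hx) ?_
    have hc : Continuous fun x : ℝ => 2 * C * (x ^ (3 / 2 : ℝ) * Real.exp (-(1 / 4) * x) +
        x ^ (1 / 2 : ℝ) * Real.exp (-(1 / 4) * x)) := by
      have c1 : Continuous fun x : ℝ => x ^ (3 / 2 : ℝ) :=
        Real.continuous_rpow_const (by norm_num)
      have c2 : Continuous fun x : ℝ => x ^ (1 / 2 : ℝ) :=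
        Real.continuous_rpow_const (by norm_num)
      fun_prop
    have := hc.tendsto 0
    rw [Real.zero_rpow (by norm_num), Real.zero_rpow (by norm_num)] at this
    simp only [zero_mul, add_zero, mul_zero] at this
    exact this.mono_left nhdsWithin_le_nhds
  have hinf : Tendsto (h * fun x => -Real.log x) atTop (𝓝 0) := by
    refine squeeze_zero_norm' ((eventually_gt_atTop 0).mono fun x hx => hdom' x hx) ?_
    have := ((tendsto_rpow_mul_exp_neg_mul_atTop_nhds_zero (3 / 2) (1 / 4) (by norm_num)).add
      (tendsto_rpow_mul_exp_neg_mul_atTop_nhds_zero (1 / 2) (1 / 4) (by norm_num))).const_mul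
      (2 * C)
    simpa using this
  have := integral_Ioi_mul_deriv_eq_deriv_mul (a := 0) (u := h) (v := fun x => -Real.log x)
    (u' := φ) (v' := fun x => -x⁻¹) (fun x _ => hd x)
    (fun x hx => (Real.hasDerivAt_log (ne_of_gt hx)).neg)
    (by
      refine hint.neg.congr_fun (fun x _ => ?_) measurableSet_Ioi
      simp [div_eq_mul_inv])
    (integrableOn_mul_log hφ hb) h0 hinf
  have e : ∫ x in Set.Ioi 0, h x * -x⁻¹ = -∫ x in Set.Ioi 0, h x / x := by
    rw [← integral_neg]
    congr 1; ext x; ring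
  rw [e] at this
  linarith

/-- The limit of the normalized variances. -/
noncomputable def varConst (j : ℕ) : ℝ := ∫ x in Set.Ioi 0, poisVar j x / x

/-- Identifies the limit supplied by the Abelian theorem for `G = poisVar (j + 1)` with an integral
that is visibly positive and easier to compute. -/
lemma varConst_succ_eq (j : ℕ) :
    IntegrableOn (fun x => poisVar (j + 1) x / x) (Set.Ioi 0) ∧
    ∫ x in Set.Ioi 0, poisWeight j x * (1 - 2 * poisGe (j + 1) x) * -Real.log x =
      varConst (j + 1) := by
  refine integral_deriv_mul_neg_log (C := 2 ^ (j + 1)) (h := poisVar (j + 1)) (Continuous.measurable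
    ((continuous_poisWeight j).mul
      (continuous_const.sub (continuous_const.mul (continuous_poisGe (j + 1))))))
    (fun x hx => ?_) (hasDerivAt_poisVar_succ j) fun x hx => ?_
  · refine (abs_poisWeight_mul_le j (j + 1) hx.le).trans ?_
    gcongr <;> norm_num
  · rw [abs_of_nonneg (poisVar_nonneg _ hx)]
    refine (poisVar_le (by omega) hx).trans ?_
    gcongr; norm_num

lemma varConst_pos {j : ℕ} (hj : 1 ≤ j) : 0 < varConst j := by
  obtain ⟨j, rfl⟩ : ∃ i, j = i + 1 := ⟨j - 1, by omega⟩
  have hpos : ∀ x ∈ Set.Ioi (0 : ℝ), 0 < poisVar (j + 1) x / x := fun x hx => by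
    have hx0 : 0 < x := hx
    have h1 : 0 < poisLt (j + 1) x :=
      Finset.sum_pos (fun i _ => poisWeight_pos i hx0) ⟨0, by simp⟩
    have h2 : 0 < poisGe (j + 1) x := by
      have := poisLt_le_one (j + 2) hx0.le
      rw [poisLt_succ] at this
      have h3 := poisWeight_pos (j + 1) hx0
      rw [poisGe]; linarith
    rw [poisVar, one_sub_poisGe]
    positivity
  rw [varConst, setIntegral_pos_iff_support_of_nonneg_ae
    ((ae_restrict_mem measurableSet_Ioi).mono fun x hx => (hpos x hx).le)
    (varConst_succ_eq j).1]
  have : Function.support (fun x => poisVar (j + 1) x / x) ∩ Set.Ioi 0 = Set.Ioi 0 :=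
    Set.inter_eq_right.2 fun x hx => (hpos x hx).ne'
  rw [this]
  simp

/-- Here `poisVar 1 x = exp (-x) - exp (-(2 * x))`, so this is a Frullani integral. It is evaluated
in the logarithmic form by substituting `2 * x` for the variable. -/
lemma varConst_one : varConst 1 = Real.log 2 := by
  rw [← (varConst_succ_eq 0).2]
  have hb : ∀ a : ℝ, 1 / 4 ≤ a → ∀ x : ℝ, 0 < x →
      |Real.exp (-(a * x))| ≤ 1 * Real.exp (-(x / 4)) := fun a ha x hx => by
    rw [abs_of_pos (Real.exp_pos _), one_mul]
    exact Real.exp_le_exp.2 (by nlinarith)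
  have hi : ∀ a : ℝ, 1 / 4 ≤ a →
      IntegrableOn (fun x => Real.exp (-(a * x)) * -Real.log x) (Set.Ioi 0) := fun a ha =>
    integrableOn_mul_log (C := 1) (by fun_prop) (hb a ha)
  have e1 : ∀ x, poisWeight 0 x * (1 - 2 * poisGe (0 + 1) x) * -Real.log x =
      2 * (Real.exp (-(2 * x)) * -Real.log x) - Real.exp (-(1 * x)) * -Real.log x := fun x => by
    have : Real.exp (-(2 * x)) = Real.exp (-x) * Real.exp (-x) := by
      rw [← Real.exp_add]; ring_nf
    rw [this]
    simp [poisGe, poisLt, poisWeight]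
    ring
  simp_rw [e1]
  rw [integral_sub ((hi 2 (by norm_num)).integrable.const_mul 2) (hi 1 (by norm_num)),
    integral_const_mul]
  have hsub := integral_comp_mul_left_Ioi (fun y => Real.exp (-(1 * y)) * -Real.log y) 0
    (b := 2) (by norm_num)
  have e2 : ∫ x in Set.Ioi (0 : ℝ), Real.exp (-(1 * (2 * x))) * -Real.log (2 * x) =
      (∫ x in Set.Ioi 0, Real.exp (-(2 * x)) * -Real.log x) -
        Real.log 2 * ∫ x in Set.Ioi 0, Real.exp (-(2 * x)) := by
    rw [← integral_const_mul, ← integral_sub (hi 2 (by norm_num))]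
    · refine setIntegral_congr_fun measurableSet_Ioi fun x hx => ?_
      rw [Real.log_mul two_ne_zero (ne_of_gt hx), one_mul]
      ring
    · exact (integrableOn_of_abs_le_exp (by fun_prop) (hb 2 (by norm_num))).integrable.const_mul _
  have e3 : ∫ x in Set.Ioi (0 : ℝ), Real.exp (-(2 * x)) = 1 / 2 := by
    have := integral_comp_mul_left_Ioi (fun y => Real.exp (-y)) 0 (b := 2) (by norm_num)
    rw [this, mul_zero, integral_exp_neg_Ioi_zero]
    simp
  rw [e2, e3, mul_zero, smul_eq_mul] at hsub
  linarith

lemma poisWeight_succ_div (j : ℕ) {x : ℝ} (hx : x ≠ 0) :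
    poisWeight (j + 1) x / x = poisWeight j x / (j + 1) := by
  unfold poisWeight
  have h1 : ((j + 1).factorial : ℝ) = (j + 1) * j.factorial := by
    push_cast [Nat.factorial_succ]; ring
  have : (j.factorial : ℝ) ≠ 0 := by positivity
  have : ((j : ℝ) + 1) ≠ 0 := by positivity
  rw [h1]
  field_simp
  ring

/-- With `G = poisGe (j + 1)` and `w = poisWeight (j + 1)`, the variance changes by `-w (1 - 2 G) -
w²`. Since `w / x = poisWeight j x / (j + 1)`, the first term over `x` is the derivative of `(G² -
G) / (j + 1)`, which vanishes at `0` and at `∞`. The second leaves a Gamma integral, and its value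
is the subtracted fraction. -/
lemma varConst_succ_succ (j : ℕ) : varConst (j + 2) = varConst (j + 1) -
    ((2 * (j + 1) - 1).factorial : ℝ) / (((j + 1).factorial : ℝ) ^ 2 * 2 ^ (2 * (j + 1))) := by
  have i1 := (varConst_succ_eq j).1
  have i2 := (varConst_succ_eq (j + 1)).1
  have hd : varConst (j + 2) - varConst (j + 1) =
      ∫ x in Set.Ioi 0, (poisVar (j + 2) x / x - poisVar (j + 1) x / x) :=
    (integral_sub i2 i1).symm
  set u : ℝ → ℝ := fun x => (poisGe (j + 1) x ^ 2 - poisGe (j + 1) x) / (j + 1) with hu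
  have hud : ∀ x, HasDerivAt u (-(poisWeight j x * (1 - 2 * poisGe (j + 1) x)) / (j + 1)) x :=
    fun x => by
      have h := hasDerivAt_poisGe_succ j x
      exact (((h.pow 2).sub h).div_const _).congr_deriv (by push_cast; ring)
  have hui : IntegrableOn (fun x => -(poisWeight j x * (1 - 2 * poisGe (j + 1) x)) / (j + 1))
      (Set.Ioi 0) := by
    refine Integrable.div_const (Integrable.neg ?_) _
    exact integrableOn_of_abs_le_exp (Continuous.measurable ((continuous_poisWeight j).mul
      (continuous_const.sub (continuous_const.mul (continuous_poisGe (j + 1))))))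
      fun x hx => abs_poisWeight_mul_le j (j + 1) hx.le
  have hu0 : ∫ x in Set.Ioi 0, -(poisWeight j x * (1 - 2 * poisGe (j + 1) x)) / ((j : ℝ) + 1) =
      0 := by
    have hlim : Tendsto u atTop (𝓝 ((1 ^ 2 - 1) / (j + 1))) :=
      (((tendsto_poisGe_atTop (j + 1)).pow 2).sub (tendsto_poisGe_atTop (j + 1))).div_const _
    rw [integral_Ioi_of_hasDerivAt_of_tendsto' (fun x _ => hud x) hui hlim, hu]
    simp [poisGe_at_zero]
  have hsq : ∀ x ∈ Set.Ioi (0 : ℝ), poisVar (j + 2) x / x - poisVar (j + 1) x / x =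
      -(poisWeight j x * (1 - 2 * poisGe (j + 1) x)) / (j + 1) -
        (((j + 1).factorial : ℝ) ^ 2)⁻¹ *
          (x ^ ((2 * (j : ℝ) + 2) - 1) * Real.exp (-(2 * x))) := by
    intro x hx
    have hx0 : x ≠ 0 := ne_of_gt hx
    have e1 : poisVar (j + 2) x = poisVar (j + 1) x -
        poisWeight (j + 1) x * (1 - 2 * poisGe (j + 1) x) - poisWeight (j + 1) x ^ 2 := by
      rw [poisVar, poisVar, poisGe_succ]; ring
    have e2 : poisWeight (j + 1) x ^ 2 / x = (((j + 1).factorial : ℝ) ^ 2)⁻¹ *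
        (x ^ ((2 * (j : ℝ) + 2) - 1) * Real.exp (-(2 * x))) := by
      have h1 : x ^ ((2 * (j : ℝ) + 2) - 1) = x ^ (2 * j + 1) := by
        rw [← Real.rpow_natCast]; congr 1; push_cast; ring
      have h2 : Real.exp (-(2 * x)) = Real.exp (-x) * Real.exp (-x) := by
        rw [← Real.exp_add]; ring_nf
      rw [h1, h2, poisWeight]
      field_simp
      ring
    rw [e1, ← e2, ← sub_div]
    have e3 := poisWeight_succ_div j hx0
    calc _ = -(poisWeight (j + 1) x / x) * (1 - 2 * poisGe (j + 1) x) -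
          poisWeight (j + 1) x ^ 2 / x := by ring
      _ = _ := by rw [e3]; ring
  have hgam := Real.integral_rpow_mul_exp_neg_mul_Ioi (a := 2 * (j : ℝ) + 2) (r := 2)
    (by positivity) two_pos
  have hgi : IntegrableOn (fun x : ℝ => (((j + 1).factorial : ℝ) ^ 2)⁻¹ *
      (x ^ ((2 * (j : ℝ) + 2) - 1) * Real.exp (-(2 * x)))) (Set.Ioi 0) := by
    refine ((hui.sub (i2.sub i1))).congr_fun (fun x hx => ?_) measurableSet_Ioi
    have := hsq x hx
    simp only [Pi.sub_apply]
    rw [this]; ring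
  rw [setIntegral_congr_fun measurableSet_Ioi hsq, integral_sub hui hgi, hu0,
    integral_const_mul, hgam] at hd
  have hG : Real.Gamma (2 * (j : ℝ) + 2) = ((2 * (j + 1) - 1).factorial : ℝ) := by
    rw [show 2 * (j + 1) - 1 = 2 * j + 1 by omega, ← Real.Gamma_nat_eq_factorial]
    congr 1; push_cast; ring
  have hp2 : (1 / 2 : ℝ) ^ (2 * (j : ℝ) + 2) = (2 ^ (2 * (j + 1)))⁻¹ := by
    rw [show 2 * (j : ℝ) + 2 = ((2 * (j + 1) : ℕ) : ℝ) by push_cast; ring, Real.rpow_natCast,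
      one_div, inv_pow]
  rw [hG, hp2] at hd
  rw [eq_add_of_sub_eq hd, div_eq_mul_inv, mul_inv]
  ring

lemma varConst_eq {j : ℕ} (hj : 1 ≤ j) : varConst j = Real.log 2 - ∑ k ∈ Finset.Ico 1 j,
    ((2 * k - 1).factorial : ℝ) / ((k.factorial : ℝ) ^ 2 * 2 ^ (2 * k)) := by
  induction j, hj using Nat.le_induction with
  | base => simp [varConst_one]
  | succ j hj ih =>
    obtain ⟨i, rfl⟩ : ∃ i, j = i + 1 := ⟨j - 1, by omega⟩
    rw [varConst_succ_succ, ih, Finset.sum_Ico_succ_top hj]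
    ring

/-! ### Asymptotics of the mean and the variance. -/

section

variable {p : ℕ → ℝ} {ℓ : ℝ → ℝ}

/-- The expected number of boxes with at least `j` balls at time `t`. -/
noncomputable def meanK (p : ℕ → ℝ) (j : ℕ) (t : ℝ) : ℝ := ∑' k, poisGe j (p k * t)

/-- The variance of the number of boxes with at least `j` balls at time `t`. -/
noncomputable def varK (p : ℕ → ℝ) (j : ℕ) (t : ℝ) : ℝ := ∑' k, poisVar j (p k * t)

/-- A sum which controls the increments of `meanK` and `varK`. -/
noncomputable def scaleSum (p : ℕ → ℝ) (t : ℝ) : ℝ := ∑' k, p k * t * Real.exp (-(p k * t / 2))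

lemma summable_poisGe (hp : IsBoxDistribution p) {j : ℕ} (hj : 1 ≤ j) {t : ℝ} (ht : 0 ≤ t) :
    Summable fun k => poisGe j (p k * t) :=
  (hp.hasSum_one.summable.mul_right t).of_nonneg_of_le
    (fun k => poisGe_nonneg j (mul_nonneg (hp.nonneg k) ht))
    fun k => poisGe_le_self hj (mul_nonneg (hp.nonneg k) ht)

lemma summable_scale (hp : IsBoxDistribution p) {t : ℝ} (ht : 0 ≤ t) :
    Summable fun k => p k * t * Real.exp (-(p k * t / 2)) :=
  (hp.hasSum_one.summable.mul_right t).of_nonneg_of_le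
    (fun k => mul_nonneg (mul_nonneg (hp.nonneg k) ht) (Real.exp_pos _).le)
    fun k => mul_le_of_le_one_right (mul_nonneg (hp.nonneg k) ht) (Real.exp_le_one_iff.2 (by
      have := mul_nonneg (hp.nonneg k) ht; linarith))

lemma summable_poisVar (hp : IsBoxDistribution p) {j : ℕ} (hj : 1 ≤ j) {t : ℝ} (ht : 0 ≤ t) :
    Summable fun k => poisVar j (p k * t) :=
  ((summable_scale hp ht).mul_left (2 ^ j)).of_nonneg_of_le
    (fun k => poisVar_nonneg j (mul_nonneg (hp.nonneg k) ht))
    fun k => poisVar_le hj (mul_nonneg (hp.nonneg k) ht)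

/-- `poisVar j` vanishes at infinity, so the `ρ` term of the Abelian theorem drops out and the order
is `ℓ`. -/
lemma tendsto_varK_div (hp : IsBoxDistribution p) (hρ : DeHaanPi (rho p) ℓ)
    (hℓ : Tendsto ℓ atTop atTop) {j : ℕ} (hj : 1 ≤ j) :
    Tendsto (fun t => varK p j t / ℓ t) atTop (𝓝 (varConst j)) := by
  obtain ⟨j, rfl⟩ : ∃ i, j = i + 1 := ⟨j - 1, by omega⟩
  have h := (tendsto_tsum_of_hasDerivAt hp hρ hℓ ((continuous_poisWeight j).mul
    (continuous_const.sub (continuous_const.mul (continuous_poisGe (j + 1)))))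
    (fun x hx => abs_poisWeight_mul_le j (j + 1) hx.le) (hasDerivAt_poisVar_succ j)
    (by simp [poisVar, poisGe_at_zero]) (tendsto_poisVar_atTop (j + 1))).1
  rw [← (varConst_succ_eq j).2]
  simpa [varK] using h

/-- The Abelian theorem with limit `G(∞) = 1` says that mean minus `ρ` is of order `ℓ`, and `ℓ =
o(ρ)`. -/
lemma tendsto_meanK_div (hp : IsBoxDistribution p) (hρ : DeHaanPi (rho p) ℓ)
    (hℓ : Tendsto ℓ atTop atTop) {j : ℕ} (hj : 1 ≤ j) :
    Tendsto (fun t => meanK p j t / rho p t) atTop (𝓝 1) := by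
  obtain ⟨j, rfl⟩ : ∃ i, j = i + 1 := ⟨j - 1, by omega⟩
  have h := (tendsto_tsum_of_hasDerivAt hp hρ hℓ (continuous_poisWeight j) (C := 2 ^ j)
    (fun x hx => by
      rw [abs_of_nonneg (poisWeight_nonneg j hx.le)]; exact poisWeight_le_quarter j hx.le)
    (hasDerivAt_poisGe_succ j) (by simp [poisGe_at_zero]) (tendsto_poisGe_atTop (j + 1))).1
  have hr := tendsto_rho_div_atTop hρ hℓ
  have h2 := (h.mul hr.inv_tendsto_atTop).const_add 1
  rw [mul_zero, add_zero] at h2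
  refine h2.congr' ?_
  filter_upwards [hr.eventually_gt_atTop 0, hℓ.eventually_gt_atTop 0] with t h1 h0
  have h3 : 0 < rho p t := by
    by_contra hn
    exact absurd (div_nonpos_of_nonpos_of_nonneg (not_lt.1 hn) h0.le) (by linarith)
  simp only [Pi.inv_apply, inv_div, meanK]
  generalize ∑' k, poisGe (j + 1) (p k * t) = S
  field_simp
  ring

/-- The Abelian theorem for `G x = x * exp (-(x / 2))`, which is zero at both ends. -/
lemma exists_scaleSum_le (hp : IsBoxDistribution p) (hρ : DeHaanPi (rho p) ℓ)
    (hℓ : Tendsto ℓ atTop atTop) :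
    ∃ C : ℝ, 0 < C ∧ ∀ᶠ t in atTop, scaleSum p t ≤ C * ℓ t := by
  have h := (tendsto_tsum_of_hasDerivAt hp hρ hℓ (φ := fun x => (1 - x / 2) * Real.exp (-(x / 2)))
    (G := fun x => x * Real.exp (-(x / 2))) (C := 2) (m := 0) (by fun_prop) (fun x hx => ?_)
    (fun x => ?_) (by simp) ?_).1
  · set c := ∫ x in Set.Ioi 0, (1 - x / 2) * Real.exp (-(x / 2)) * -Real.log x
    refine ⟨|c| + 1, by positivity, ?_⟩
    filter_upwards [h.eventually (gt_mem_nhds (show c < |c| + 1 by linarith [le_abs_self c])),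
      hℓ.eventually_gt_atTop 0] with t ht h0
    rw [div_lt_iff₀ h0, zero_mul, sub_zero] at ht
    exact ht.le
  · rw [abs_mul, abs_of_pos (Real.exp_pos _)]
    have h1 : |1 - x / 2| ≤ 2 * Real.exp (x / 4) := by
      have := Real.add_one_le_exp (x / 4)
      rw [abs_le]; constructor <;> linarith
    calc _ ≤ 2 * Real.exp (x / 4) * Real.exp (-(x / 2)) := by gcongr
      _ = _ := by rw [mul_assoc, ← Real.exp_add]; ring_nf
  · have h1 : HasDerivAt (fun x : ℝ => -(x / 2)) (-(1 / 2)) x :=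
      ((hasDerivAt_id x).div_const 2).neg
    exact ((hasDerivAt_id x).mul h1.exp).congr_deriv (by simp; ring)
  · have := tendsto_rpow_mul_exp_neg_mul_atTop_nhds_zero 1 (1 / 2) (by norm_num)
    refine this.congr fun x => ?_
    rw [Real.rpow_one]; congr 2; ring

end

end Karlin

/-! ### The process `K`: its moments and its increments. -/

namespace Karlin

section

variable {Ω : Type*} [MeasurableSpace Ω] {P : Measure Ω} [IsProbabilityMeasure P]
  {p : ℕ → ℝ} {box : ℕ → Ω → ℕ} {gap : ℕ → Ω → ℝ}

namespace IsPoissonizedScheme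

lemma iIndepSet_of_fullAlgebra (hp : IsBoxDistribution p) (h : IsPoissonizedScheme P p box gap)
    {j : ℕ} {B : ℕ → Set Ω} (hB : ∀ k, MeasurableSet[fullAlgebra box gap j k] (B k)) :
    iIndepSet B P := by
  rw [iIndepSet_iff]
  intro s f hf
  have hi := (iIndep_iff _ _).1 (h.iIndep_fullAlgebra hp.nonneg j)
  exact hi s fun i his => MeasurableSpace.generateFrom_le
    (by rintro t rfl; exact hB i) _ (hf i his)

omit [IsProbabilityMeasure P] in
lemma measurableSet_of_fullAlgebra (h : IsPoissonizedScheme P p box gap) {j : ℕ}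
    {B : ℕ → Set Ω} (hB : ∀ k, MeasurableSet[fullAlgebra box gap j k] (B k)) (k : ℕ) :
    MeasurableSet (B k) := by
  have : fullAlgebra box gap j k ≤ ‹MeasurableSpace Ω› := by
    refine MeasurableSpace.generateFrom_le ?_
    rintro _ ⟨t, rfl⟩
    exact (h.measurableSet_fullEvent j k t).compl
  exact this _ (hB k)

lemma occurMean_fullEvent (hp : IsBoxDistribution p) (h : IsPoissonizedScheme P p box gap)
    (j : ℕ) {t : ℝ} (ht : 0 ≤ t) :
    occurMean P (fun k => fullEvent box gap j k t) = meanK p j t :=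
  tsum_congr fun k => h.measureReal_fullEvent hp.nonneg j k ht

lemma summable_fullEvent (hp : IsBoxDistribution p) (h : IsPoissonizedScheme P p box gap)
    {j : ℕ} (hj : 1 ≤ j) {t : ℝ} (ht : 0 ≤ t) :
    Summable fun k => P.real (fullEvent box gap j k t) := by
  simp_rw [h.measureReal_fullEvent hp.nonneg j _ ht]
  exact summable_poisGe hp hj ht

lemma occurVar_fullEvent (hp : IsBoxDistribution p) (h : IsPoissonizedScheme P p box gap)
    (j : ℕ) {t : ℝ} (ht : 0 ≤ t) :
    occurVar P (fun k => fullEvent box gap j k t) = varK p j t :=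
  tsum_congr fun k => by rw [h.measureReal_fullEvent hp.nonneg j k ht, poisVar]

lemma integral_variance_K (hp : IsBoxDistribution p) (h : IsPoissonizedScheme P p box gap)
    {j : ℕ} (hj : 1 ≤ j) {t : ℝ} (ht : 0 ≤ t) :
    ∫ ω, K box gap j t ω ∂P = meanK p j t ∧ variance (K box gap j t) P = varK p j t := by
  have hae : K box gap j t =ᵐ[P] occur fun k => fullEvent box gap j k t := by
    filter_upwards [h.ae_K_eq hj] with ω hω using (hω t).2
  have hB : ∀ k, MeasurableSet[fullAlgebra box gap j k] (fullEvent box gap j k t) :=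
    fun k => measurableSet_fullAlgebra j k t
  obtain ⟨h1, h2⟩ := integral_variance_occur (h.measurableSet_of_fullAlgebra hB)
    (h.iIndepSet_of_fullAlgebra hp hB) (h.summable_fullEvent hp hj ht)
  rw [integral_congr_ae hae, variance_congr hae, h1, h2, h.occurMean_fullEvent hp j ht,
    h.occurVar_fullEvent hp j ht]
  exact ⟨rfl, rfl⟩

lemma measureReal_fullEvent_diff (hp : IsBoxDistribution p) (h : IsPoissonizedScheme P p box gap)
    (j k : ℕ) {s t : ℝ} (hs : 0 ≤ s) (hst : s ≤ t) :
    P.real (fullEvent box gap j k t \ fullEvent box gap j k s) =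
      poisGe j (p k * t) - poisGe j (p k * s) := by
  rw [measureReal_sdiff (fullEvent_mono j k hst) (h.measurableSet_fullEvent j k s),
    h.measureReal_fullEvent hp.nonneg j k hs,
    h.measureReal_fullEvent hp.nonneg j k (hs.trans hst)]

/-- Moderate deviations for the increments of `K`. -/
lemma measureReal_increment_le (hp : IsBoxDistribution p) (h : IsPoissonizedScheme P p box gap)
    {j : ℕ} (hj : 1 ≤ j) {s t v x : ℝ} (hs : 0 ≤ s) (hst : s ≤ t)
    (hv : meanK p j t - meanK p j s ≤ v) (hv0 : 0 < v) (hx : 0 ≤ x) (hxv : x ≤ v / 2) :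
    P.real {ω | x ≤ |occur (fun k => fullEvent box gap j k t \ fullEvent box gap j k s) ω -
      (meanK p j t - meanK p j s)|} ≤ 2 * Real.exp (-(x ^ 2 / (4 * v))) := by
  have hB : ∀ k, MeasurableSet[fullAlgebra box gap j k]
      (fullEvent box gap j k t \ fullEvent box gap j k s) := fun k =>
    (measurableSet_fullAlgebra j k t).diff (measurableSet_fullAlgebra j k s)
  have hP := fun k => h.measureReal_fullEvent_diff hp j k hs hst
  have s1 := summable_poisGe hp hj (hs.trans hst)
  have s2 := summable_poisGe hp hj hs
  have hsum : Summable fun k =>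
      P.real (fullEvent box gap j k t \ fullEvent box gap j k s) := by
    simp_rw [hP]; exact s1.sub s2
  have hmean : occurMean P (fun k => fullEvent box gap j k t \ fullEvent box gap j k s) =
      meanK p j t - meanK p j s := by
    rw [occurMean, meanK, meanK, ← s1.tsum_sub s2]
    exact tsum_congr hP
  rw [← hmean]
  -- An increment counts the independent events that a box reaches `j` balls between the two times;
  -- the variance of a sum of indicators is at most its mean, hence at most `v`.
  refine measureReal_le_abs_occur_sub_le (h.measurableSet_of_fullAlgebra hB)
    (h.iIndepSet_of_fullAlgebra hp hB) hsum (le_trans ?_ hv) hv0 hx hxv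
  rw [← hmean]
  exact (summable_bernoulliVar hsum).tsum_le_tsum (fun k => mul_le_of_le_one_right
    measureReal_nonneg (sub_le_self _ measureReal_nonneg)) hsum

end IsPoissonizedScheme

omit [MeasurableSpace Ω] in
lemma occur_diff {j : ℕ} {s t : ℝ} (hst : s ≤ t) {ω : Ω}
    (hω : {k | ω ∈ fullEvent box gap j k t}.Finite) :
    occur (fun k => fullEvent box gap j k t \ fullEvent box gap j k s) ω =
      occur (fun k => fullEvent box gap j k t) ω - occur (fun k => fullEvent box gap j k s) ω := by
  have hω' : {k | ω ∈ fullEvent box gap j k s}.Finite :=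
    hω.subset fun k hk => fullEvent_mono j k hst hk
  have h1 := (hasSum_occur hω).sub (hasSum_occur hω')
  rw [← h1.tsum_eq]
  refine tsum_congr fun k => ?_
  rw [Set.indicator_sdiff (fullEvent_mono j k hst)]
  rfl

omit [MeasurableSpace Ω] in
lemma occur_mono {j : ℕ} {s t : ℝ} (hst : s ≤ t) {ω : Ω}
    (hω : {k | ω ∈ fullEvent box gap j k t}.Finite) :
    occur (fun k => fullEvent box gap j k s) ω ≤ occur (fun k => fullEvent box gap j k t) ω := by
  have := occur_diff hst hω
  have h0 : 0 ≤ occur (fun k => fullEvent box gap j k t \ fullEvent box gap j k s) ω :=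
    tsum_nonneg fun k => Set.indicator_nonneg (fun _ _ => zero_le_one) ω
  linarith

end

/-! ### Regularity of mean and variance in logarithmic time. -/

section Increments

variable {p : ℕ → ℝ} {ℓ : ℝ → ℝ}

lemma exp_sub_one_le_two_mul {h : ℝ} (h0 : 0 ≤ h) (h1 : h ≤ 1) : Real.exp h - 1 ≤ 2 * h := by
  have := abs_exp_sub_quadratic_le (y := h) (by rwa [abs_of_nonneg h0])
  rw [abs_of_nonneg h0] at this
  have := (abs_le.1 this).2
  nlinarith [pow_le_pow_left₀ h0 h1 2, pow_le_pow_left₀ h0 h1 3, sq_nonneg h,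
    mul_nonneg h0 (sub_nonneg.2 h1), mul_nonneg (sq_nonneg h) (sub_nonneg.2 h1)]

/-- The mean value inequality on `[y, y * exp h]`. The bound is linear in the logarithmic increment
`h`, and summing it over `y = p k * t` gives `scaleSum`. -/
lemma abs_sub_le_of_abs_deriv_le {G φ : ℝ → ℝ} (hG : ∀ x, HasDerivAt G (φ x) x) {j : ℕ}
    (hb : ∀ x, 0 ≤ x → |φ x| ≤ poisWeight j x) {y h : ℝ} (hy : 0 ≤ y) (h0 : 0 ≤ h)
    (h1 : h ≤ 1) :
    |G (y * Real.exp h) - G y| ≤ 2 ^ (j + 1) * h * (y * Real.exp (-(y / 2))) := by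
  have hyh : y ≤ y * Real.exp h := le_mul_of_one_le_right hy (Real.one_le_exp h0)
  have := (convex_Icc y (y * Real.exp h)).norm_image_sub_le_of_norm_hasDerivWithin_le
    (f := G) (f' := φ) (C := 2 ^ j * Real.exp (-(y / 2)))
    (fun x _ => (hG x).hasDerivWithinAt) (fun x hx => ?_) (Set.left_mem_Icc.2 hyh)
    (Set.right_mem_Icc.2 hyh)
  · rw [Real.norm_eq_abs, Real.norm_of_nonneg (by linarith)] at this
    refine this.trans ?_
    have h3 : y * Real.exp h - y ≤ y * (2 * h) := by
      have := mul_le_mul_of_nonneg_left (exp_sub_one_le_two_mul h0 h1) hy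
      linarith
    calc _ ≤ 2 ^ j * Real.exp (-(y / 2)) * (y * (2 * h)) := by gcongr
      _ = _ := by ring
  · have hx0 : 0 ≤ x := hy.trans hx.1
    refine (hb x hx0).trans ((poisWeight_le j hx0).trans ?_)
    gcongr
    exact hx.1

lemma abs_poisGe_sub_le {j : ℕ} (hj : 1 ≤ j) {y h : ℝ} (hy : 0 ≤ y) (h0 : 0 ≤ h) (h1 : h ≤ 1) :
    |poisGe j (y * Real.exp h) - poisGe j y| ≤ 2 ^ j * h * (y * Real.exp (-(y / 2))) := by
  obtain ⟨j, rfl⟩ : ∃ i, j = i + 1 := ⟨j - 1, by omega⟩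
  exact abs_sub_le_of_abs_deriv_le (hasDerivAt_poisGe_succ j)
    (fun x hx => (abs_of_nonneg (poisWeight_nonneg j hx)).le) hy h0 h1

lemma abs_poisVar_sub_le {j : ℕ} (hj : 1 ≤ j) {y h : ℝ} (hy : 0 ≤ y) (h0 : 0 ≤ h) (h1 : h ≤ 1) :
    |poisVar j (y * Real.exp h) - poisVar j y| ≤ 2 ^ j * h * (y * Real.exp (-(y / 2))) := by
  obtain ⟨j, rfl⟩ : ∃ i, j = i + 1 := ⟨j - 1, by omega⟩
  refine abs_sub_le_of_abs_deriv_le (hasDerivAt_poisVar_succ j) (fun x hx => ?_) hy h0 h1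
  rw [abs_mul, abs_of_nonneg (poisWeight_nonneg j hx)]
  have h1 := poisGe_nonneg (j + 1) hx
  have h2 := poisGe_le_one (j + 1) hx
  exact mul_le_of_le_one_right (poisWeight_nonneg j hx) (by rw [abs_le]; constructor <;> linarith)

lemma abs_tsum_sub_tsum_le {f g w : ℕ → ℝ} (hf : Summable f) (hg : Summable g)
    (hw : Summable w) (h : ∀ k, |f k - g k| ≤ w k) : |∑' k, f k - ∑' k, g k| ≤ ∑' k, w k := by
  rw [← hf.tsum_sub hg, ← Real.norm_eq_abs]
  exact tsum_of_norm_bounded hw.hasSum fun k => (Real.norm_eq_abs _).trans_le (h k)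

lemma abs_meanK_sub_le (hp : IsBoxDistribution p) {j : ℕ} (hj : 1 ≤ j) {t h : ℝ} (ht : 0 ≤ t)
    (h0 : 0 ≤ h) (h1 : h ≤ 1) :
    |meanK p j (t * Real.exp h) - meanK p j t| ≤ 2 ^ j * h * scaleSum p t := by
  rw [scaleSum, ← tsum_mul_left]
  refine abs_tsum_sub_tsum_le (summable_poisGe hp hj (by positivity)) (summable_poisGe hp hj ht)
    ((summable_scale hp ht).mul_left _) fun k => ?_
  rw [← mul_assoc]
  exact abs_poisGe_sub_le hj (mul_nonneg (hp.nonneg k) ht) h0 h1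

lemma abs_varK_sub_le (hp : IsBoxDistribution p) {j : ℕ} (hj : 1 ≤ j) {t h : ℝ} (ht : 0 ≤ t)
    (h0 : 0 ≤ h) (h1 : h ≤ 1) :
    |varK p j (t * Real.exp h) - varK p j t| ≤ 2 ^ j * h * scaleSum p t := by
  rw [scaleSum, ← tsum_mul_left]
  refine abs_tsum_sub_tsum_le (summable_poisVar hp hj (by positivity)) (summable_poisVar hp hj ht)
    ((summable_scale hp ht).mul_left _) fun k => ?_
  rw [← mul_assoc]
  exact abs_poisVar_sub_le hj (mul_nonneg (hp.nonneg k) ht) h0 h1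

lemma tendsto_varK_atTop (hp : IsBoxDistribution p) (hρ : DeHaanPi (rho p) ℓ)
    (hℓ : Tendsto ℓ atTop atTop) {j : ℕ} (hj : 1 ≤ j) : Tendsto (varK p j) atTop atTop := by
  have h := (tendsto_varK_div hp hρ hℓ hj).pos_mul_atTop (varConst_pos hj) hℓ
  refine h.congr' ?_
  filter_upwards [hℓ.eventually_gt_atTop 0] with t ht
  rw [div_mul_cancel₀ _ ht.ne']

/-- The sum controlling the increments is of the order of the variance. -/
lemma exists_scaleSum_le_varK (hp : IsBoxDistribution p) (hρ : DeHaanPi (rho p) ℓ)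
    (hℓ : Tendsto ℓ atTop atTop) {j : ℕ} (hj : 1 ≤ j) :
    ∃ C : ℝ, 1 ≤ C ∧ ∀ᶠ t in atTop, ℓ t ≤ C * varK p j t ∧ 2 ^ j * scaleSum p t ≤ C * varK p j t := by
  obtain ⟨C, hC0, hC⟩ := exists_scaleSum_le hp hρ hℓ
  have hc := varConst_pos hj
  refine ⟨max 1 (max (2 / varConst j) (2 ^ j * C * (2 / varConst j))), le_max_left _ _, ?_⟩
  filter_upwards [hC, hℓ.eventually_gt_atTop 0, (tendsto_varK_div hp hρ hℓ hj).eventually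
    (lt_mem_nhds (show varConst j / 2 < varConst j by linarith))] with t h1 h0 h2
  rw [lt_div_iff₀ h0] at h2
  have hV : 0 ≤ varK p j t := by
    have : 0 < varConst j / 2 * ℓ t := by positivity
    linarith
  have h3 : ℓ t ≤ 2 / varConst j * varK p j t := by
    have : ℓ t = 2 / varConst j * (varConst j / 2 * ℓ t) := by field_simp
    rw [this]; gcongr
  constructor
  · refine h3.trans ?_
    gcongr
    exact (le_max_left _ _).trans (le_max_right _ _)
  · calc 2 ^ j * scaleSum p t ≤ 2 ^ j * (C * (2 / varConst j * varK p j t)) := by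
          gcongr; exact h1.trans (by gcongr)
      _ = 2 ^ j * C * (2 / varConst j) * varK p j t := by ring
      _ ≤ _ := by
        gcongr
        exact (le_max_right _ _).trans (le_max_right _ _)

end Increments

end Karlin

/-! ### Chaining over short logarithmic time blocks. -/

namespace Karlin

section Chaining

lemma sum_range_succ_div_two_pow (M : ℕ) :
    ∑ m ∈ Finset.range M, ((m : ℝ) + 1) / 2 ^ m = 4 - (2 * M + 4) / 2 ^ M := by
  induction M with
  | zero => norm_num
  | succ n ih =>
    rw [Finset.sum_range_succ, ih]
    push_cast
    field_simp
    ring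

/-- Keeps the thresholds `x * (m + 1) / 2 ^ m` of all chaining levels within the range where
Bernstein's inequality is used, namely at most half of the variance bound. -/
lemma succ_mul_two_pow_le {m n : ℕ} (hn : 3 ≤ n) (hmn : m ≤ n) :
    ((m : ℝ) + 1) * 2 ^ (m + 1) ≤ 4 ^ n := by
  have h1 : (n + 1) * 2 ^ (n + 1) ≤ 4 ^ n := by
    induction n, hn using Nat.le_induction with
    | base => norm_num
    | succ n hn ih =>
      by_cases h : m ≤ n
      · have := ih h
        have h2 : 4 ^ (n + 1) = 4 * 4 ^ n := by ring
        have h3 : 2 ^ (n + 1 + 1) = 2 * 2 ^ (n + 1) := by ring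
        rw [h2, h3]
        nlinarith [Nat.two_pow_pos (n + 1)]
      · have := n.lt_two_pow_self
        have hs : n + 2 ≤ 2 ^ n := by
          clear ih h hmn this
          induction n, hn using Nat.le_induction with
          | base => norm_num
          | succ n hn ih => rw [pow_succ]; omega
        have h2 : 4 ^ (n + 1) = 2 ^ n * 2 ^ (n + 1 + 1) := by
          rw [← pow_add, show (4 : ℕ) = 2 ^ 2 by norm_num, ← pow_mul]; ring_nf
        rw [h2]
        exact Nat.mul_le_mul_right _ hs
  have h2 : (m + 1) * 2 ^ (m + 1) ≤ 4 ^ n :=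
    le_trans (Nat.mul_le_mul (by omega) (Nat.pow_le_pow_right (by norm_num) (by omega))) h1
  exact_mod_cast h2

/-- Dyadic chaining (in base four) for the difference of a monotone and a Lipschitz function. -/
lemma sub_le_of_chain {f g : ℝ → ℝ} {δ D x : ℝ} {M : ℕ} (hδ : 0 < δ) (hM : 1 ≤ M)
    (hf : ∀ u v, 0 ≤ u → u ≤ v → v ≤ δ → f u ≤ f v)
    (hg : ∀ u h, 0 ≤ u → 0 ≤ h → u + h ≤ δ → g (u + h) - g u ≤ D * h)
    (hx : 0 ≤ x) (hD : 0 ≤ D) (hend : D * (δ / 4 ^ M) ≤ x)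
    (hgood : ∀ m < M, ∀ i : ℕ, i < 4 ^ (m + 1) →
      |(f (δ * (i / 4 ^ (m + 1))) - g (δ * (i / 4 ^ (m + 1)))) -
        (f (δ * ((i / 4 : ℕ) / 4 ^ m)) - g (δ * ((i / 4 : ℕ) / 4 ^ m)))| ≤ x * (m + 1) / 2 ^ m)
    {u : ℝ} (hu0 : 0 ≤ u) (hu : u ≤ δ / 2) : f u - g u ≤ f 0 - g 0 + 5 * x := by
  have key : ∀ m ≤ M, ∀ i : ℕ, i < 4 ^ m → f (δ * (i / 4 ^ m)) - g (δ * (i / 4 ^ m)) ≤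
      f 0 - g 0 + x * ∑ l ∈ Finset.range m, ((l : ℝ) + 1) / 2 ^ l := by
    intro m
    induction m with
    | zero =>
      intro _ i hi
      obtain rfl : i = 0 := by simpa using hi
      simp
    | succ m ih =>
      intro hm i hi
      have h1 := hgood m (by omega) i hi
      have h2 := ih (by omega) (i / 4) (by rw [pow_succ] at hi; omega)
      rw [Finset.sum_range_succ, mul_add]
      have h3 := (abs_le.1 h1).2
      rw [mul_div_assoc x] at h3
      linarith
  have h4 : (0 : ℝ) < 4 ^ M := by positivity
  -- By monotonicity of `f`, `u` is compared with the next finest grid point `i + 1`, which is still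
  -- in the block as `u ≤ δ / 2`. The levels cost at most `4 * x` by `sum_range_succ_div_two_pow`,
  -- the drift of `g` up to that point at most `x`.
  set i := ⌊4 ^ M * u / δ⌋₊ with hi
  have hi1 : (i : ℝ) ≤ 4 ^ M * u / δ := Nat.floor_le (by positivity)
  have hi2 : 4 ^ M * u / δ < i + 1 := Nat.lt_floor_add_one _
  rw [le_div_iff₀ hδ] at hi1
  rw [div_lt_iff₀ hδ] at hi2
  have hM4 : (4 : ℝ) ≤ 4 ^ M := by
    calc (4 : ℝ) = 4 ^ 1 := by norm_num
      _ ≤ 4 ^ M := pow_le_pow_right₀ (by norm_num) hM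
  have hi3 : (i : ℝ) ≤ 4 ^ M / 2 := by
    by_contra hc
    push Not at hc
    nlinarith
  have hi4 : i + 1 < 4 ^ M := by
    have : ((i + 1 : ℕ) : ℝ) < ((4 ^ M : ℕ) : ℝ) := by push_cast; linarith
    exact_mod_cast this
  set v := δ * (((i + 1 : ℕ) : ℝ) / 4 ^ M) with hv
  have hve : v * 4 ^ M = δ * (i + 1) := by rw [hv]; push_cast; field_simp
  have huv : u ≤ v := by nlinarith
  have hvδ : v ≤ δ := by
    have : (i : ℝ) + 1 ≤ 4 ^ M := by exact_mod_cast hi4.le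
    nlinarith
  have hvu : v - u ≤ δ / 4 ^ M := by
    rw [le_div_iff₀ h4]; nlinarith
  have h1 := key M le_rfl (i + 1) hi4
  rw [sum_range_succ_div_two_pow, ← hv] at h1
  have h2 := hf u v hu0 huv hvδ
  have h3 := hg u (v - u) hu0 (by linarith) (by linarith)
  rw [add_sub_cancel] at h3
  have h5 : D * (v - u) ≤ x := (mul_le_mul_of_nonneg_left hvu hD).trans hend
  have h6 : 0 ≤ x * ((2 * M + 4) / 2 ^ M) := by positivity
  nlinarith

end Chaining

section

variable {Ω : Type*} [MeasurableSpace Ω] {P : Measure Ω} [IsProbabilityMeasure P]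
  {p : ℕ → ℝ} {box : ℕ → Ω → ℕ} {gap : ℕ → Ω → ℝ}

/-- Maximal inequality over a short (logarithmic) time block. -/
lemma IsPoissonizedScheme.exists_block_exceptional (hp : IsBoxDistribution p)
    (h : IsPoissonizedScheme P p box gap) {j : ℕ} (hj : 1 ≤ j) {t₀ D δ x : ℝ} (ht₀ : 0 ≤ t₀)
    (hD : 0 < D) (hδ : 0 < δ) (hx : 0 < x)
    (hmean : ∀ u e, 0 ≤ u → 0 ≤ e → u + e ≤ δ →
      meanK p j (t₀ * Real.exp (u + e)) - meanK p j (t₀ * Real.exp u) ≤ D * e)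
    (hxD : 64 * x ≤ D * δ) (hr : 8 * Real.exp (-(x ^ 2 / (4 * (D * δ)))) ≤ 1) :
    ∃ S : Set Ω, P.real S ≤ 16 * Real.exp (-(x ^ 2 / (4 * (D * δ)))) ∧ ∀ ω ∉ S,
      (∀ t, {k | ω ∈ fullEvent box gap j k t}.Finite) → ∀ u, 0 ≤ u → u ≤ δ / 2 →
      occur (fun k => fullEvent box gap j k (t₀ * Real.exp u)) ω - meanK p j (t₀ * Real.exp u) ≤
      occur (fun k => fullEvent box gap j k t₀) ω - meanK p j t₀ + 5 * x := by
  set a := x ^ 2 / (4 * (D * δ)) with ha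
  -- The chaining stops at level `n + 1`, where the mean increment `D * δ / 4 ^ (n + 1)` of a cell
  -- has fallen below `x`.
  obtain ⟨n, hn1, hn2⟩ := exists_nat_pow_near (x := D * δ / x) (y := 4)
    (by rw [le_div_iff₀ hx]; linarith) (by norm_num)
  rw [le_div_iff₀ hx] at hn1
  rw [div_lt_iff₀ hx] at hn2
  have hn3 : 3 ≤ n := by
    by_contra hc
    have h1 : (4 : ℝ) ^ (n + 1) ≤ 4 ^ 3 := pow_le_pow_right₀ (by norm_num) (by omega)
    nlinarith
  have a0 : 0 < a := by positivity
  set T : ℕ → ℕ → ℝ := fun m i => t₀ * Real.exp (δ * (i / 4 ^ m)) with hT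
  set bad : ℕ → ℕ → Set Ω := fun m i => {ω | x * (m + 1) / 2 ^ m ≤
    |occur (fun k => fullEvent box gap j k (T (m + 1) i) \ fullEvent box gap j k (T m (i / 4))) ω -
      (meanK p j (T (m + 1) i) - meanK p j (T m (i / 4)))|} with hbad
  have hparent : ∀ m i : ℕ, (((i / 4 : ℕ) : ℝ) / 4 ^ m) ≤ i / 4 ^ (m + 1) ∧
      (i : ℝ) / 4 ^ (m + 1) ≤ ((i / 4 : ℕ) : ℝ) / 4 ^ m + 1 / 4 ^ m := by
    intro m i
    have h1 : ((4 * (i / 4) : ℕ) : ℝ) ≤ i := by exact_mod_cast (by omega : 4 * (i / 4) ≤ i)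
    have h2 : (i : ℝ) ≤ ((4 * (i / 4) + 4 : ℕ) : ℝ) := by
      exact_mod_cast (by omega : i ≤ 4 * (i / 4) + 4)
    push_cast at h1 h2
    have h4 : (0 : ℝ) < 4 ^ m := by positivity
    constructor
    · rw [div_le_div_iff₀ h4 (by positivity), pow_succ]
      nlinarith
    · rw [← add_div, div_le_div_iff₀ (by positivity) h4, pow_succ]
      nlinarith
  have hTle : ∀ m i, T m (i / 4) ≤ T (m + 1) i := fun m i => by
    exact mul_le_mul_of_nonneg_left (Real.exp_le_exp.2
      (mul_le_mul_of_nonneg_left (hparent m i).1 hδ.le)) ht₀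
  -- At level `m` the variance is at most `D δ / 4 ^ m` and the threshold `x (m + 1) / 2 ^ m`, so
  -- the exponent is `a (m + 1)² ≥ a (m + 1)`. All `4 ^ (m + 1)` events of the level then cost `2 (4
  -- exp (-a)) ^ (m + 1)`, a geometric series with ratio at most `1 / 2` by `hr`.
  have hbadP : ∀ m < n + 1, ∀ i < 4 ^ (m + 1), P.real (bad m i) ≤
      2 * Real.exp (-a) ^ (m + 1) := by
    intro m hm i hi
    have h4 : (0 : ℝ) < 4 ^ m := by positivity
    have h24 : (2 : ℝ) ^ m * 2 ^ m = 4 ^ m := by rw [← mul_pow]; norm_num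
    have hi' : (i : ℝ) / 4 ^ (m + 1) ≤ 1 := by
      rw [div_le_one (by positivity)]; exact_mod_cast hi.le
    have hv : meanK p j (T (m + 1) i) - meanK p j (T m (i / 4)) ≤ D * (δ / 4 ^ m) := by
      have h1 := hmean (δ * ((i / 4 : ℕ) / 4 ^ m))
        (δ * (i / 4 ^ (m + 1)) - δ * ((i / 4 : ℕ) / 4 ^ m)) (by positivity)
        (by rw [← mul_sub]; exact mul_nonneg hδ.le (by linarith [(hparent m i).1]))
        (by rw [add_sub_cancel]; exact mul_le_of_le_one_right hδ.le hi')
      rw [add_sub_cancel] at h1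
      refine h1.trans (mul_le_mul_of_nonneg_left ?_ hD.le)
      rw [← mul_sub, div_eq_mul_one_div δ]
      exact mul_le_mul_of_nonneg_left (by linarith [(hparent m i).2]) hδ.le
    refine (h.measureReal_increment_le hp hj (by positivity) (hTle m i) hv (by positivity)
      (by positivity) ?_).trans ?_
    · have h5 := succ_mul_two_pow_le hn3 (by omega : m ≤ n)
      rw [pow_succ] at h5
      have h6 : x * (((m : ℝ) + 1) * (2 ^ m * 2)) ≤ D * δ :=
        (mul_le_mul_of_nonneg_left h5 hx.le).trans (by linarith)
      rw [← mul_div_assoc, div_div, div_le_div_iff₀ (by positivity) (by positivity), ← h24]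
      have h7 : (0 : ℝ) < 2 ^ m := by positivity
      nlinarith [mul_le_mul_of_nonneg_right h6 h7.le]
    · rw [← Real.exp_nat_mul]
      gcongr
      have h8 : (x * (m + 1) / 2 ^ m) ^ 2 / (4 * (D * (δ / 4 ^ m))) = a * (m + 1) ^ 2 := by
        rw [ha, div_pow, pow_two (2 ^ m : ℝ), h24]
        field_simp
      rw [h8]
      push_cast
      have : 0 ≤ a * (((m : ℝ) + 1) * m) := by positivity
      nlinarith
  refine ⟨⋃ m ∈ Finset.range (n + 1), ⋃ i ∈ Finset.range (4 ^ (m + 1)), bad m i, ?_, ?_⟩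
  · calc P.real (⋃ m ∈ Finset.range (n + 1), ⋃ i ∈ Finset.range (4 ^ (m + 1)), bad m i)
        ≤ ∑ m ∈ Finset.range (n + 1), ∑ i ∈ Finset.range (4 ^ (m + 1)), P.real (bad m i) := by
          refine (measureReal_biUnion_finset_le _ _).trans (Finset.sum_le_sum fun m _ => ?_)
          exact measureReal_biUnion_finset_le _ _
      _ ≤ ∑ m ∈ Finset.range (n + 1), (4 * Real.exp (-a)) * 2 * (4 * Real.exp (-a)) ^ m := by
          refine Finset.sum_le_sum fun m hm => ?_
          refine (Finset.sum_le_card_nsmul _ _ _ fun i hi => hbadP m (Finset.mem_range.1 hm) i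
            (Finset.mem_range.1 hi)).trans (le_of_eq ?_)
          rw [Finset.card_range, nsmul_eq_mul]
          push_cast
          rw [mul_pow]; ring
      _ ≤ ∑ m ∈ Finset.range (n + 1), (4 * Real.exp (-a)) * 2 * (1 / 2) ^ m := by
          gcongr
          linarith
      _ ≤ (4 * Real.exp (-a)) * 2 * 2 := by
          rw [← Finset.mul_sum]
          gcongr
          have := (summable_geometric_two).sum_le_tsum (Finset.range (n + 1))
            (fun _ _ => by positivity)
          rwa [tsum_geometric_two] at this
      _ = _ := by ring
  · intro ω hω hfin u hu0 hu
    have := sub_le_of_chain (f := fun u => occur (fun k => fullEvent box gap j k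
        (t₀ * Real.exp u)) ω) (g := fun u => meanK p j (t₀ * Real.exp u)) (D := D) (x := x)
      (M := n + 1) hδ (by omega) (fun u v hu huv hv => occur_mono (by gcongr) (hfin _))
      hmean hx.le hD.le ?_ ?_ hu0 hu
    · simpa using this
    · rw [← mul_div_assoc, div_le_iff₀ (by positivity)]
      linarith
    · intro m hm i hi
      simp only [Set.mem_iUnion, Finset.mem_range, not_exists] at hω
      have h1 := hω m hm i hi
      simp only [hbad, Set.mem_ofPred_eq, not_le] at h1
      rw [occur_diff (hTle m i) (hfin _)] at h1
      refine le_trans (le_of_eq ?_) h1.le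
      simp only [hT]
      ring_nf

end

end Karlin

/-! ### Upper half of the law of the iterated logarithm. -/

namespace Karlin

section

variable {Ω : Type*} [MeasurableSpace Ω] {P : Measure Ω} [IsProbabilityMeasure P]
  {p : ℕ → ℝ} {box : ℕ → Ω → ℕ} {gap : ℕ → Ω → ℝ} {ℓ : ℝ → ℝ}

/-- The normalisation in the law of the iterated logarithm for a process with variance `V`. -/
noncomputable def lilScale (V : ℝ → ℝ) (t : ℝ) : ℝ := √(2 * V t * Real.log (Real.log t))

lemma tendsto_log_log : Tendsto (fun t : ℝ => Real.log (Real.log t)) atTop atTop :=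
  Real.tendsto_log_atTop.comp Real.tendsto_log_atTop

lemma lilScale_div {V : ℝ → ℝ} {t : ℝ} (hV : 0 < V t) :
    lilScale V t / V t = √(2 * (Real.log (Real.log t) / V t)) := by
  rw [lilScale, div_eq_iff hV.ne']
  nth_rewrite 3 [← Real.sqrt_sq hV.le]
  rw [← Real.sqrt_mul' _ (sq_nonneg _)]
  congr 1
  field_simp

lemma tendsto_lilScale_div {V : ℝ → ℝ} (hV : Tendsto V atTop atTop)
    (hs : Tendsto (fun t => Real.log (Real.log t) / V t) atTop (𝓝 0)) :
    Tendsto (fun t => lilScale V t / V t) atTop (𝓝 0) := by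
  have h1 : Tendsto (fun t => √(2 * (Real.log (Real.log t) / V t))) atTop (𝓝 0) := by
    simpa using (hs.const_mul 2).sqrt
  refine h1.congr' ?_
  filter_upwards [hV.eventually_gt_atTop 0] with t ht
  rw [lilScale_div ht]

lemma tendsto_exp_nat_mul {c : ℝ} (hc : 0 < c) :
    Tendsto (fun n : ℕ => Real.exp (n * c)) atTop atTop :=
  Real.tendsto_exp_atTop.comp (tendsto_natCast_atTop_atTop.atTop_mul_const hc)

-- Borel–Cantelli: at time `exp (n * c)` one has `log log = log (n * c)`, so a bound `exp (-q log
-- log)` is a multiple of `n ^ (-q)`, summable for `q > 1`.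
omit [IsProbabilityMeasure P] in
lemma ae_eventually_notMem_of_le_exp_log [IsFiniteMeasure P] {s : ℕ → Set Ω} {c q A : ℝ}
    (hc : 0 < c) (hq : 1 < q)
    (h : ∀ᶠ n : ℕ in atTop, P.real (s n) ≤ A * Real.exp (-(q * Real.log (n * c)))) :
    ∀ᵐ ω ∂P, ∀ᶠ n in atTop, ω ∉ s n := by
  have h1 : Summable fun n : ℕ => A * c ^ (-q) * (n : ℝ) ^ (-q) :=
    (Real.summable_nat_rpow.2 (by linarith)).mul_left _
  have h2 : Summable fun n => P.real (s n) := by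
    refine Summable.of_norm_bounded_eventually_nat h1 ?_
    filter_upwards [h, eventually_gt_atTop 0] with n hn hn0
    rw [Real.norm_of_nonneg measureReal_nonneg]
    refine hn.trans (le_of_eq ?_)
    have hn0' : (0 : ℝ) < n := by exact_mod_cast hn0
    rw [mul_assoc, ← Real.mul_rpow hc.le hn0'.le, mul_comm c, Real.rpow_def_of_pos (by positivity)]
    ring_nf
  refine ae_eventually_notMem ?_
  have h3 := h2.tsum_ofReal_ne_top
  convert h3 using 3 with n
  rw [ofReal_measureReal]

namespace IsPoissonizedScheme

lemma measureReal_le_occur_fullEvent_sub_le (hp : IsBoxDistribution p)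
    (h : IsPoissonizedScheme P p box gap) {j : ℕ} (hj : 1 ≤ j) {t x : ℝ} (ht : 0 ≤ t)
    (hv : 0 < varK p j t) (hx : 0 ≤ x) (hxv : x ≤ varK p j t) :
    P.real {ω | x ≤ occur (fun k => fullEvent box gap j k t) ω - meanK p j t} ≤
      Real.exp (-(x ^ 2 / (2 * varK p j t) * (1 - x / varK p j t))) := by
  have hB : ∀ k, MeasurableSet[fullAlgebra box gap j k] (fullEvent box gap j k t) :=
    fun k => measurableSet_fullAlgebra j k t
  rw [← h.occurMean_fullEvent hp j ht]
  exact measureReal_le_occur_sub_le (h.measurableSet_of_fullAlgebra hB)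
    (h.iIndepSet_of_fullAlgebra hp hB) (h.summable_fullEvent hp hj ht)
    (h.occurVar_fullEvent hp j ht).le hv hx hxv

/-- Upper half of the law of the iterated logarithm. -/
theorem ae_eventually_le (hp : IsBoxDistribution p) (h : IsPoissonizedScheme P p box gap)
    (hρ : DeHaanPi (rho p) ℓ) (hℓ : Tendsto ℓ atTop atTop) {j : ℕ} (hj : 1 ≤ j)
    (hs : Tendsto (fun t => Real.log (Real.log t) / varK p j t) atTop (𝓝 0))
    {η : ℝ} (hη : 0 < η) :
    ∀ᵐ ω ∂P, ∀ᶠ t in atTop, occur (fun k => fullEvent box gap j k t) ω - meanK p j t ≤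
      (1 + η) * lilScale (varK p j) t := by
  have hVt := tendsto_varK_atTop hp hρ hℓ hj
  obtain ⟨C, hC1, hC⟩ := exists_scaleSum_le_varK hp hρ hℓ hj
  set V := varK p j with hV
  -- The grid costs `1 + ε`, the chaining `5 ε`, and the change of scale inside a block a factor `1
  -- - ε`. The choice makes `1 + 6 ε ≤ (1 + η) (1 - ε)`.
  set ε := min (1 / 2) (η / 14) with hε
  have hε0 : 0 < ε := by positivity
  have hε1 : ε ≤ 1 / 2 := min_le_left _ _
  have hεη : 14 * ε ≤ η := by linarith [min_le_right (1 / 2) (η / 14)]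
  -- Makes the variance bound of a block `ε² V / 8`, so a deviation `ε * lilScale V` has exponent `4
  -- log log`. Consecutive grid times are `δ / 2` apart, the part of a block of length `δ` that the
  -- chaining controls.
  set δ := ε ^ 2 / (8 * (C * (1 + C))) with hδ
  have hδ0 : 0 < δ := by positivity
  have hδe : C * (1 + C) * δ = ε ^ 2 / 8 := by rw [hδ]; field_simp
  have hδ1 : δ ≤ 1 := by nlinarith [mul_nonneg (sub_nonneg.2 hC1) hδ0.le]
  have hCδ : C * δ ≤ ε := by nlinarith [mul_nonneg (sub_nonneg.2 hC1) hδ0.le]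
  have hc0 : 0 < δ / 2 := by positivity
  set τ : ℕ → ℝ := fun n => Real.exp (n * (δ / 2)) with hτ
  have hτt : Tendsto τ atTop atTop := tendsto_exp_nat_mul hc0
  have hτ0 : ∀ n, 0 < τ n := fun n => Real.exp_pos _
  have hLτ : ∀ n, Real.log (Real.log (τ n)) = Real.log (n * (δ / 2)) := fun n => by
    rw [hτ, Real.log_exp]
  obtain ⟨T, hT⟩ := eventually_atTop.1 (hC.and (hVt.eventually_gt_atTop 0))
  -- the values at the grid points
  have hgrid : ∀ᵐ ω ∂P, ∀ᶠ n in atTop, ω ∉ {ω | (1 + ε) * lilScale V (τ n) ≤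
      occur (fun k => fullEvent box gap j k (τ n)) ω - meanK p j (τ n)} := by
    refine ae_eventually_notMem_of_le_exp_log (q := 1 + ε) (A := 1) hc0 (by linarith) ?_
    have h1 : ∀ᶠ t in atTop, 0 < V t ∧ 0 < Real.log (Real.log t) ∧ lilScale V t / V t < ε / 4 :=
      (hVt.eventually_gt_atTop 0).and ((tendsto_log_log.eventually_gt_atTop 0).and
        ((tendsto_lilScale_div hVt hs).eventually (gt_mem_nhds (by positivity))))
    filter_upwards [hτt.eventually h1] with n ⟨hV0, hL0, hb⟩
    rw [← hLτ, one_mul]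
    have hb0 : 0 ≤ lilScale V (τ n) := Real.sqrt_nonneg _
    have hb' := hb
    rw [div_lt_iff₀ hV0] at hb'
    refine (h.measureReal_le_occur_fullEvent_sub_le hp hj (hτ0 n).le hV0 (by positivity)
      (by nlinarith)).trans (Real.exp_le_exp.2 (neg_le_neg ?_))
    rw [← hV, mul_pow, lilScale, Real.sq_sqrt (by positivity), ← lilScale]
    have h2 : (1 + ε) ^ 2 * (2 * V (τ n) * Real.log (Real.log (τ n))) / (2 * V (τ n)) =
        (1 + ε) ^ 2 * Real.log (Real.log (τ n)) := by field_simp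
    rw [h2, mul_div_assoc]
    have h3 : 1 ≤ (1 + ε) * (1 - (1 + ε) * (lilScale V (τ n) / V (τ n))) := by nlinarith
    calc (1 + ε) * Real.log (Real.log (τ n)) =
          (1 + ε) * Real.log (Real.log (τ n)) * 1 := by ring
      _ ≤ (1 + ε) * Real.log (Real.log (τ n)) *
          ((1 + ε) * (1 - (1 + ε) * (lilScale V (τ n) / V (τ n)))) := by gcongr
      _ = _ := by ring
  -- the blocks between consecutive grid points
  have hVblock : ∀ t, T ≤ t → 0 ≤ t → ∀ u, 0 ≤ u → u ≤ 1 →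
      |V (t * Real.exp u) - V t| ≤ u * (C * V t) := fun t hTt ht u hu0 hu1 =>
    (abs_varK_sub_le hp hj ht hu0 hu1).trans (by nlinarith [(hT t hTt).1.2])
  have hblockn : ∀ᶠ n : ℕ in atTop, ∃ S : Set Ω,
      P.real S ≤ 16 * Real.exp (-(2 * Real.log (n * (δ / 2)))) ∧ ∀ ω ∉ S,
      (∀ t, {k | ω ∈ fullEvent box gap j k t}.Finite) → ∀ u, 0 ≤ u → u ≤ δ / 2 →
      occur (fun k => fullEvent box gap j k (τ n * Real.exp u)) ω -
        meanK p j (τ n * Real.exp u) ≤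
      occur (fun k => fullEvent box gap j k (τ n)) ω - meanK p j (τ n) +
        5 * (ε * lilScale V (τ n)) := by
    have h1 : ∀ᶠ t in atTop, T ≤ t ∧ 0 < V t ∧ 3 ≤ Real.log (Real.log t) ∧
        lilScale V t / V t < ε / 512 :=
      (eventually_ge_atTop T).and ((hVt.eventually_gt_atTop 0).and
        ((tendsto_log_log.eventually_ge_atTop 3).and
        ((tendsto_lilScale_div hVt hs).eventually (gt_mem_nhds (by positivity)))))
    filter_upwards [hτt.eventually h1] with n ⟨hTn, hV0, hL, hb⟩
    rw [div_lt_iff₀ hV0] at hb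
    have hD : C * (1 + C) * V (τ n) * δ = ε ^ 2 / 8 * V (τ n) := by rw [← hδe]; ring
    have hb0 : 0 < lilScale V (τ n) := Real.sqrt_pos.2 (by nlinarith)
    have hexp : (ε * lilScale V (τ n)) ^ 2 / (4 * (C * (1 + C) * V (τ n) * δ)) =
        4 * Real.log (Real.log (τ n)) := by
      rw [hD, mul_pow, lilScale, Real.sq_sqrt (by nlinarith)]
      field_simp
      norm_num
    have hexp' : 16 * Real.exp (-(4 * Real.log (Real.log (τ n)))) ≤
        16 * Real.exp (-(2 * Real.log (n * (δ / 2)))) := by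
      rw [← hLτ]; gcongr; norm_num
    have hS := h.exists_block_exceptional hp hj (t₀ := τ n)
      (D := C * (1 + C) * V (τ n)) (δ := δ) (x := ε * lilScale V (τ n)) (hτ0 n).le
      (by positivity) hδ0 (by positivity) ?_ (by rw [hD]; nlinarith) ?_
    · obtain ⟨S, hS1, hS2⟩ := hS
      rw [hexp] at hS1
      exact ⟨S, hS1.trans hexp', hS2⟩
    · intro u e hu he hue
      have hue1 : τ n ≤ τ n * Real.exp u :=
        le_mul_of_one_le_right (hτ0 n).le (Real.one_le_exp hu)
      have h2 := (abs_le.1 (abs_meanK_sub_le hp hj (t := τ n * Real.exp u) (h := e)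
        (by positivity) he (by linarith))).2
      rw [mul_assoc (τ n), ← Real.exp_add] at h2
      have h3 := (hT _ (hTn.trans hue1)).1.2
      have h4 := (abs_le.1 (hVblock _ hTn (hτ0 n).le u hu (by linarith))).2
      have h5 : V (τ n * Real.exp u) ≤ (1 + C) * V (τ n) := by
        nlinarith [mul_nonneg (sub_nonneg.2 (show u ≤ 1 by linarith))
          (mul_nonneg (zero_le_one.trans hC1) hV0.le)]
      calc _ ≤ 2 ^ j * e * scaleSum p (τ n * Real.exp u) := h2
        _ = e * (2 ^ j * scaleSum p (τ n * Real.exp u)) := by ring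
        _ ≤ e * (C * ((1 + C) * V (τ n))) := by
          refine mul_le_mul_of_nonneg_left (h3.trans ?_) he
          exact mul_le_mul_of_nonneg_left h5 (by linarith)
        _ = _ := by ring
    · rw [hexp]
      have h6 := Real.add_one_le_exp (4 * Real.log (Real.log (τ n)))
      rw [Real.exp_neg, ← div_eq_mul_inv, div_le_one (Real.exp_pos _)]
      linarith
  obtain ⟨n₀, hn₀⟩ := eventually_atTop.1 hblockn
  choose S hS using hn₀
  have hblock : ∀ᵐ ω ∂P, ∀ᶠ n in atTop, ω ∉ (if hn : n₀ ≤ n then S n hn else ∅) := by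
    refine ae_eventually_notMem_of_le_exp_log (q := 2) (A := 16) hc0 (by norm_num) ?_
    filter_upwards [eventually_ge_atTop n₀] with n hn
    rw [dif_pos hn]
    exact (hS n hn).1
  filter_upwards [hgrid, hblock, h.ae_K_eq hj] with ω h1 h2 h3
  have hfin : ∀ t, {k | ω ∈ fullEvent box gap j k t}.Finite := fun t => (h3 t).1
  have hn : ∀ᶠ n : ℕ in atTop, ∀ u, 0 ≤ u → u ≤ δ / 2 →
      occur (fun k => fullEvent box gap j k (τ n * Real.exp u)) ω -
        meanK p j (τ n * Real.exp u) ≤ (1 + η) * lilScale V (τ n * Real.exp u) := by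
    filter_upwards [h1, h2, eventually_ge_atTop n₀, hτt.eventually_ge_atTop T,
      hτt.eventually (hVt.eventually_gt_atTop 0),
      hτt.eventually (tendsto_log_log.eventually_gt_atTop 0),
      hτt.eventually (Real.tendsto_log_atTop.eventually_gt_atTop 0)] with
      n hg hb hn hTn hV0 hL0 hL1 u hu0 hu
    rw [dif_pos hn] at hb
    have h4 := (hS n hn).2 ω hb hfin u hu0 hu
    simp only [not_le] at hg
    have h5 : (1 - ε) * lilScale V (τ n) ≤ lilScale V (τ n * Real.exp u) := by
      rw [lilScale, lilScale]
      refine Real.le_sqrt_of_sq_le ?_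
      rw [mul_pow, Real.sq_sqrt (by positivity)]
      have h6 := (abs_le.1 (hVblock _ hTn (hτ0 n).le u hu0 (by linarith))).1
      have h7 : (1 - ε) * V (τ n) ≤ V (τ n * Real.exp u) := by
        have : u * C * V (τ n) ≤ ε * V (τ n) := by
          refine mul_le_mul_of_nonneg_right ?_ hV0.le
          nlinarith
        linarith
      have h8 : Real.log (Real.log (τ n)) ≤ Real.log (Real.log (τ n * Real.exp u)) :=
        Real.log_le_log hL1 (Real.log_le_log (hτ0 n)
          (le_mul_of_one_le_right (hτ0 n).le (Real.one_le_exp hu0)))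
      calc (1 - ε) ^ 2 * (2 * V (τ n) * Real.log (Real.log (τ n)))
          = 2 * ((1 - ε) * ((1 - ε) * V (τ n))) * Real.log (Real.log (τ n)) := by ring
        _ ≤ 2 * (1 * V (τ n * Real.exp u)) * Real.log (Real.log (τ n * Real.exp u)) := by
          refine mul_le_mul (mul_le_mul_of_nonneg_left (mul_le_mul (by linarith) h7
            (mul_nonneg (by linarith) hV0.le) zero_le_one) zero_le_two) h8 hL0.le ?_
          exact mul_nonneg zero_le_two (mul_nonneg zero_le_one
            ((mul_nonneg (by linarith) hV0.le).trans h7))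
        _ = _ := by ring
    have hb0 : 0 ≤ lilScale V (τ n) := Real.sqrt_nonneg _
    have h9 : 1 + 6 * ε ≤ (1 + η) * (1 - ε) := by nlinarith
    nlinarith [mul_le_mul_of_nonneg_right h9 hb0, mul_le_mul_of_nonneg_left h5
      (by linarith : 0 ≤ 1 + η)]
  -- Every large `t` is `τ n * exp u` for this `n`, with `0 ≤ u ≤ δ / 2`.
  have hfl : Tendsto (fun t : ℝ => ⌊Real.log t / (δ / 2)⌋₊) atTop atTop :=
    tendsto_nat_floor_atTop.comp (Real.tendsto_log_atTop.atTop_div_const hc0)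
  filter_upwards [hfl.eventually hn, eventually_ge_atTop 1] with t ht ht1
  have hlog : 0 ≤ Real.log t := Real.log_nonneg ht1
  have hf1 := Nat.floor_le (show 0 ≤ Real.log t / (δ / 2) by positivity)
  have hf2 := Nat.lt_floor_add_one (Real.log t / (δ / 2))
  rw [le_div_iff₀ hc0] at hf1
  rw [div_lt_iff₀ hc0] at hf2
  have h10 := ht (Real.log t - ⌊Real.log t / (δ / 2)⌋₊ * (δ / 2)) (by linarith) (by linarith)
  have h11 : τ ⌊Real.log t / (δ / 2)⌋₊ *
      Real.exp (Real.log t - ⌊Real.log t / (δ / 2)⌋₊ * (δ / 2)) = t := by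
    rw [hτ, ← Real.exp_add, add_sub_cancel, Real.exp_log (by linarith)]
  rwa [h11] at h10

end IsPoissonizedScheme

end

end Karlin

/-! ### Tools for the lower half: disjoint blocks of boxes and the effective window. -/

namespace Karlin

lemma measurable_centredSum_of_le {Ω : Type*} {m mΩ : MeasurableSpace Ω} {P : Measure Ω} {B : ℕ → Set Ω} {A : Finset ℕ}
    (h : ∀ k ∈ A, MeasurableSet[m] (B k)) : Measurable[m] (centredSum P B A) :=
  Finset.measurable_sum _ fun k hk => (measurable_const.indicator (h k hk)).sub_const _

section

variable {Ω : Type*} [mΩ : MeasurableSpace Ω] {P : Measure Ω} [IsProbabilityMeasure P]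

lemma iIndepSet_of_disjoint {m : ℕ → MeasurableSpace Ω} (hm : ∀ k, m k ≤ mΩ) (hi : iIndep m P)
    {A : ℕ → Set ℕ} (hA : Pairwise (Function.onFun Disjoint A)) {D : ℕ → Set Ω}
    (hD : ∀ n, MeasurableSet[⨆ k ∈ A n, m k] (D n)) : iIndepSet D P := by
  have hDm : ∀ n, MeasurableSet (D n) := fun n =>
    (iSup₂_le fun k _ => hm k : ⨆ k ∈ A n, m k ≤ mΩ) _ (hD n)
  rw [iIndepSet_iff_meas_biInter hDm]
  intro s
  induction s using Finset.induction_on with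
  | empty => simp
  | insert a s has ih =>
    rw [Finset.prod_insert has, ← ih, Finset.set_biInter_insert]
    have hdisj : Disjoint (A a) (⋃ n ∈ s, A n) := by
      simp only [Set.disjoint_iUnion_right]
      exact fun n hn => hA (fun h => has (h ▸ hn))
    refine (Indep_iff _ _ _).1 (indep_iSup_of_disjoint hm hi hdisj) _ _ (hD a) ?_
    refine Finset.measurableSet_biInter s fun n hn => ?_
    refine (iSup₂_le fun k hk => le_iSup₂_of_le k ?_ le_rfl :
      ⨆ k ∈ A n, m k ≤ ⨆ k ∈ ⋃ n ∈ s, A n, m k) _ (hD n)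
    exact Set.mem_biUnion hn hk

/-- The second Borel–Cantelli lemma, by comparison with the harmonic series. -/
lemma ae_frequently_mem_of_iIndepSet {D : ℕ → Set Ω} (hDm : ∀ n, MeasurableSet (D n))
    (hD : iIndepSet D P) {c : ℝ} (hc : 0 < c)
    (h : ∀ᶠ n : ℕ in atTop, c * (n : ℝ)⁻¹ ≤ P.real (D n)) : ∀ᵐ ω ∂P, ∃ᶠ n in atTop, ω ∈ D n := by
  have hsum : ∑' n, P (D n) = ∞ := by
    by_contra hne
    have h1 : Summable fun n => P.real (D n) := ENNReal.summable_toReal hne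
    have h2 : Summable fun n : ℕ => c * (n : ℝ)⁻¹ := by
      refine Summable.of_norm_bounded_eventually_nat h1 ?_
      filter_upwards [h] with n hn
      rwa [Real.norm_of_nonneg (by positivity)]
    exact Real.not_summable_natCast_inv ((summable_mul_left_iff hc.ne').1 h2)
  have h3 := measure_limsup_eq_one hDm hD hsum
  rw [← mem_ae_iff_prob_eq_one (MeasurableSet.measurableSet_limsup hDm)] at h3
  filter_upwards [h3] with ω hω
  exact mem_limsup_iff_frequently_mem.1 hω

end

section Split

lemma sum_add_tsum_ite {f : ℕ → ℝ} (hf : Summable f) (A : Finset ℕ) :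
    ∑ k ∈ A, f k + ∑' k, (if k ∈ A then 0 else f k) = ∑' k, f k := by
  rw [← hf.sum_add_tsum_compl (s := A), tsum_subtype]
  congr 1
  refine tsum_congr fun k => ?_
  by_cases hk : k ∈ A <;> simp [hk]

variable {Ω : Type*} [MeasurableSpace Ω] {P : Measure Ω}

lemma occur_sub_occurMean_eq {B : ℕ → Set Ω} (hs : Summable fun k => P.real (B k)) (A : Finset ℕ)
    {ω : Ω} (hω : {k | ω ∈ B k}.Finite) :
    occur B ω - occurMean P B = centredSum P B A ω +
      (occur (fun k => if k ∈ A then ∅ else B k) ω -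
        occurMean P (fun k => if k ∈ A then ∅ else B k)) := by
  have h1 := sum_add_tsum_ite hs A
  have h2 := sum_add_tsum_ite (hasSum_occur hω).summable A
  have h3 : occur (fun k => if k ∈ A then ∅ else B k) ω =
      ∑' k, (if k ∈ A then 0 else (B k).indicator (fun _ => (1 : ℝ)) ω) :=
    tsum_congr fun k => by by_cases hk : k ∈ A <;> simp [hk]
  have h4 : occurMean P (fun k => if k ∈ A then ∅ else B k) =
      ∑' k, (if k ∈ A then 0 else P.real (B k)) :=
    tsum_congr fun k => by by_cases hk : k ∈ A <;> simp [hk]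
  rw [h3, h4, centredSum, Finset.sum_sub_distrib, occur, occurMean, ← h1, ← h2]
  ring

variable [IsProbabilityMeasure P]

lemma occurVar_eq {B : ℕ → Set Ω} (hs : Summable fun k => P.real (B k)) (A : Finset ℕ) :
    varSum P B A + occurVar P (fun k => if k ∈ A then ∅ else B k) = occurVar P B := by
  rw [occurVar, occurVar, ← sum_add_tsum_ite (summable_bernoulliVar hs) A, varSum]
  congr 1
  exact tsum_congr fun k => by by_cases hk : k ∈ A <;> simp [hk]

end Split

section Window

variable {p : ℕ → ℝ} {ℓ : ℝ → ℝ}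

/-- The increment of `ρ` from `c t` to `e c t` is asymptotic to `ℓ (c t)`, and also to `(log (e c) -
log c) ℓ t = ℓ t`. -/
lemma tendsto_auxiliary_ratio (hρ : DeHaanPi (rho p) ℓ) (hℓ : Tendsto ℓ atTop atTop) {c : ℝ}
    (hc : 0 < c) : Tendsto (fun t => ℓ (c * t) / ℓ t) atTop (𝓝 1) := by
  have hct : Tendsto (fun t : ℝ => c * t) atTop atTop := tendsto_id.const_mul_atTop hc
  have h1 := (hρ (Real.exp 1) (Real.exp_pos 1)).comp hct
  have h2 := (hρ (Real.exp 1 * c) (by positivity)).sub (hρ c hc)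
  rw [Real.log_mul (Real.exp_pos 1).ne' hc.ne', add_sub_cancel_right] at h2
  rw [Real.log_exp] at h1 h2
  have h3 := h2.div h1 one_ne_zero
  rw [div_one] at h3
  refine h3.congr' ?_
  filter_upwards [h1.eventually (lt_mem_nhds zero_lt_one), hℓ.eventually_gt_atTop 0,
    hct.eventually (hℓ.eventually_gt_atTop 0)] with t h4 h5 h6
  simp only [Function.comp_apply, Pi.div_apply] at h4 ⊢
  have h7 : rho p (Real.exp 1 * (c * t)) - rho p (c * t) ≠ 0 := fun h => by simp [h] at h4
  rw [mul_assoc, ← sub_div, sub_sub_sub_cancel_right]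
  generalize rho p (Real.exp 1 * (c * t)) - rho p (c * t) = x at h7
  field_simp

lemma tendsto_varK_ratio (hp : IsBoxDistribution p) (hρ : DeHaanPi (rho p) ℓ)
    (hℓ : Tendsto ℓ atTop atTop) {j : ℕ} (hj : 1 ≤ j) {c : ℝ} (hc : 0 < c) :
    Tendsto (fun t => varK p j (c * t) / varK p j t) atTop (𝓝 1) := by
  have hct : Tendsto (fun t : ℝ => c * t) atTop atTop := tendsto_id.const_mul_atTop hc
  have h1 := tendsto_varK_div hp hρ hℓ hj
  have h2 := ((h1.comp hct).mul (tendsto_auxiliary_ratio hρ hℓ hc)).div h1 (varConst_pos hj).ne'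
  rw [mul_one, div_self (varConst_pos hj).ne'] at h2
  refine h2.congr' ?_
  filter_upwards [hℓ.eventually_gt_atTop 0, hct.eventually (hℓ.eventually_gt_atTop 0)] with t h5 h6
  simp only [Function.comp_apply, Pi.div_apply]
  field_simp

/-- A box rare at time `t` is compared with itself at the later time `t / a`, gaining the small
factor `2 * a`. -/
lemma mul_exp_neg_le_of_le {a y : ℝ} (ha : 0 < a) (hy : 0 ≤ y) (hya : y ≤ a) :
    y * Real.exp (-(y / 2)) ≤ 2 * a * (y / a * Real.exp (-(y / a / 2))) := by
  have h1 : y / a ≤ 1 := (div_le_one ha).2 hya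
  have h2 : 1 / 2 ≤ Real.exp (-(y / a / 2)) := by
    have := Real.add_one_le_exp (-(y / a / 2)); linarith
  calc y * Real.exp (-(y / 2)) ≤ y * 1 := by
        gcongr; exact Real.exp_le_one_iff.2 (by linarith)
    _ = 2 * y * (1 / 2) := by ring
    _ ≤ 2 * y * Real.exp (-(y / a / 2)) := by gcongr
    _ = _ := by field_simp

/-- A box already crowded at time `t` is compared with itself at time `t / 2`; the spare factor `exp
(-(y / 4))` is at most `4 * a`. -/
lemma mul_exp_neg_le_of_lt {a y : ℝ} (ha : 0 < a) (hya : 1 / a < y) :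
    y * Real.exp (-(y / 2)) ≤ 8 * a * (y / 2 * Real.exp (-(y / 2 / 2))) := by
  have hy : 0 < y := (one_div_pos.2 ha).trans hya
  have h1 : Real.exp (-(y / 4)) ≤ 4 * a := by
    rw [Real.exp_neg, inv_le_comm₀ (Real.exp_pos _) (by positivity)]
    have h2 := Real.add_one_le_exp (y / 4)
    have h3 : (4 * a)⁻¹ = 1 / a / 4 := by field_simp
    rw [h3]; linarith
  have h4 : Real.exp (-(y / 2)) = Real.exp (-(y / 4)) * Real.exp (-(y / 2 / 2)) := by
    rw [← Real.exp_add]; ring_nf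
  rw [h4]
  calc y * (Real.exp (-(y / 4)) * Real.exp (-(y / 2 / 2))) ≤
        y * (4 * a * Real.exp (-(y / 2 / 2))) := by gcongr
    _ = _ := by ring

/-- The boxes with `p k * t` far from one contribute little to the variance. -/
lemma exists_window (hp : IsBoxDistribution p) (hρ : DeHaanPi (rho p) ℓ)
    (hℓ : Tendsto ℓ atTop atTop) {j : ℕ} (hj : 1 ≤ j) {κ : ℝ} (hκ : 0 < κ) :
    ∃ a : ℝ, 0 < a ∧ a < 1 ∧ ∀ᶠ t in atTop, ∀ A : Finset ℕ,
      (∀ k ∉ A, p k * t ≤ a ∨ 1 / a < p k * t) →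
      ∑' k, (if k ∈ A then 0 else poisVar j (p k * t)) ≤ κ * varK p j t := by
  obtain ⟨C, hC1, hC⟩ := exists_scaleSum_le_varK hp hρ hℓ hj
  have hCk : 0 < κ / (20 * C) := by positivity
  -- The sums at the two comparison times are at most `2 C V` each, since the variance varies
  -- slowly; with factors `2 a` and `8 a` this totals `20 a C V`.
  set a := min (1 / 2) (κ / (20 * C)) with ha
  have ha0 : 0 < a := lt_min (by norm_num) hCk
  have haC : 20 * a * C ≤ κ := by
    have : a ≤ κ / (20 * C) := min_le_right _ _
    rw [le_div_iff₀ (by positivity)] at this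
    linarith
  refine ⟨a, ha0, (min_le_left _ _).trans_lt (by norm_num), ?_⟩
  have hat : Tendsto (fun t : ℝ => 1 / a * t) atTop atTop :=
    tendsto_id.const_mul_atTop (by positivity)
  have h2t : Tendsto (fun t : ℝ => 1 / 2 * t) atTop atTop :=
    tendsto_id.const_mul_atTop (by positivity)
  filter_upwards [hat.eventually hC, h2t.eventually hC, eventually_ge_atTop 0,
    (tendsto_varK_atTop hp hρ hℓ hj).eventually_gt_atTop 0,
    (tendsto_varK_ratio hp hρ hℓ hj (c := 1 / a) (by positivity)).eventually
      (gt_mem_nhds (show (1 : ℝ) < 2 by norm_num)),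
    (tendsto_varK_ratio hp hρ hℓ hj (c := 1 / 2) (by positivity)).eventually
      (gt_mem_nhds (show (1 : ℝ) < 2 by norm_num))] with t h1 h2 ht hV h3 h4 A hA
  rw [div_lt_iff₀ hV] at h3 h4
  have s1 := summable_scale hp (t := 1 / a * t) (by positivity)
  have s2 := summable_scale hp (t := 1 / 2 * t) (by positivity)
  have hle : ∀ k, (if k ∈ A then 0 else poisVar j (p k * t)) ≤
      2 ^ j * (2 * a) * (p k * (1 / a * t) * Real.exp (-(p k * (1 / a * t) / 2))) +
      2 ^ j * (8 * a) * (p k * (1 / 2 * t) * Real.exp (-(p k * (1 / 2 * t) / 2))) := by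
    intro k
    have hpk := hp.nonneg k
    have hy : 0 ≤ p k * t := by positivity
    have e1 : p k * (1 / a * t) = p k * t / a := by ring
    have e2 : p k * (1 / 2 * t) = p k * t / 2 := by ring
    rw [e1, e2]
    split_ifs with hk
    · positivity
    · refine (poisVar_le hj hy).trans ?_
      rw [mul_assoc (2 ^ j) (2 * a), mul_assoc (2 ^ j) (8 * a), ← mul_add]
      refine mul_le_mul_of_nonneg_left ?_ (by positivity)
      rcases hA k hk with h | h
      · have := mul_exp_neg_le_of_le ha0 hy h
        refine this.trans (le_add_of_nonneg_right (by positivity))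
      · have := mul_exp_neg_le_of_lt ha0 h
        refine this.trans (le_add_of_nonneg_left (by positivity))
  have hsum : Summable fun k => if k ∈ A then 0 else poisVar j (p k * t) := by
    refine (summable_poisVar hp hj ht).of_nonneg_of_le (fun k => ?_) fun k => ?_
    all_goals
      have := poisVar_nonneg j (mul_nonneg (hp.nonneg k) ht)
      split_ifs <;> simp [this]
  calc ∑' k, (if k ∈ A then 0 else poisVar j (p k * t))
      ≤ 2 ^ j * (2 * a) * scaleSum p (1 / a * t) + 2 ^ j * (8 * a) * scaleSum p (1 / 2 * t) := by
        refine (hsum.tsum_le_tsum hle ((s1.mul_left _).add (s2.mul_left _))).trans (le_of_eq ?_)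
        rw [(s1.mul_left _).tsum_add (s2.mul_left _), tsum_mul_left, tsum_mul_left, scaleSum,
          scaleSum]
    _ = 2 * a * (2 ^ j * scaleSum p (1 / a * t)) + 8 * a * (2 ^ j * scaleSum p (1 / 2 * t)) := by
        ring
    _ ≤ 2 * a * (C * (2 * varK p j t)) + 8 * a * (C * (2 * varK p j t)) := by
        have h5 := h1.2.trans (mul_le_mul_of_nonneg_left h3.le (zero_le_one.trans hC1))
        have h6 := h2.2.trans (mul_le_mul_of_nonneg_left h4.le (zero_le_one.trans hC1))
        exact add_le_add (mul_le_mul_of_nonneg_left h5 (by positivity))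
          (mul_le_mul_of_nonneg_left h6 (by positivity))
    _ = 20 * a * C * varK p j t := by ring
    _ ≤ _ := by gcongr

end Window

end Karlin

/-! ### Lower half of the law of the iterated logarithm. -/

namespace Karlin

section

variable {Ω : Type*} [MeasurableSpace Ω] {P : Measure Ω} [IsProbabilityMeasure P]
  {p : ℕ → ℝ} {box : ℕ → Ω → ℕ} {gap : ℕ → Ω → ℝ} {ℓ : ℝ → ℝ}

/-- A lower bound of the order `exp (-L)` for the probability that a sum of independent centred
indicators exceeds nearly `√(2 V L)`, where `V` is close to its variance. -/
lemma measureReal_lt_centredSum_ge_exp {B : ℕ → Set Ω} (hBm : ∀ k, MeasurableSet (B k))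
    (hB : iIndepSet B P) (A : Finset ℕ) {ε V L : ℝ} (hε0 : 0 < ε) (hε1 : ε ≤ 1 / 8) (hV0 : 0 < V)
    (hL0 : 8 / ε ^ 2 < L) (hb : √(2 * V * L) / V < ε ^ 2 / 64)
    (hWV : (1 - ε) * V ≤ varSum P B A) :
    1 / 2 * Real.exp (-L) ≤ P.real {ω | (1 - 5 * ε) * √(2 * V * L) < centredSum P B A ω} := by
  have hLpos : 0 < L := (by positivity : 0 < 8 / ε ^ 2).trans hL0
  set W := varSum P B A with hW
  set b := √(2 * V * L) with hbdef
  have hW0 : 0 < W := lt_of_lt_of_le (mul_pos (by linarith) hV0) hWV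
  -- Chosen so that the exponent `θ² W / 2 * (1 + 3 ε)` of the lower bound is exactly `L`. The loss
  -- moves to the level, which drops to `(1 - 5 ε) √(2 V L)`.
  set θ := √(2 * L / ((1 + 3 * ε) * W)) with hθ
  have hθsq : θ ^ 2 = 2 * L / ((1 + 3 * ε) * W) := Real.sq_sqrt (by positivity)
  have hθ0 : 0 < θ := Real.sqrt_pos.2 (by positivity)
  have hθW : θ ^ 2 * W = 2 * L / (1 + 3 * ε) := by rw [hθsq]; field_simp
  have hbsq : b ^ 2 = 2 * V * L := Real.sq_sqrt (by positivity)
  have hb0 : 0 ≤ b := Real.sqrt_nonneg _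
  clear_value b θ W
  have hθle : θ ≤ ε ^ 2 / 32 := by
    refine le_trans ?_ (show 2 * (b / V) ≤ ε ^ 2 / 32 by linarith)
    refine abs_le_of_sq_le_sq' ?_ (by positivity) |>.2
    rw [hθsq, mul_pow, div_pow, hbsq, div_le_iff₀ (by positivity)]
    have h4 : V / 2 ≤ W := by nlinarith
    have h4' : V / 4 ≤ W := by linarith
    calc 2 * L = 2 ^ 2 * (2 * V * L / V ^ 2) * (1 * (V / 4)) := by
          field_simp; norm_num
      _ ≤ _ := by
        gcongr
        linarith
  have hpr := measureReal_lt_centredSum_ge hBm hB A hε0 (by linarith) hθ0 hθle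
    (by
      rw [← hW, hθW, le_div_iff₀ (by positivity)]
      have : 8 / ε ^ 2 * (1 + 3 * ε) ≤ 8 / ε ^ 2 * 2 := by gcongr; linarith
      linarith)
  rw [← hW, hθW] at hpr
  have h5 : 2 * L / (1 + 3 * ε) / 2 * (1 + 3 * ε) = L := by field_simp
  rw [h5] at hpr
  refine hpr.trans (measureReal_mono (fun ω hω => ?_) (measure_ne_top _ _))
  refine lt_of_le_of_lt ?_ (show (1 - ε) * θ * W < centredSum P B A ω from hω)
  have h7 : (1 - 4 * ε) * b ≤ θ * W := by
    refine abs_le_of_sq_le_sq' ?_ (by positivity) |>.2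
    have h8 : (θ * W) ^ 2 = 2 * L / (1 + 3 * ε) * W := by rw [← hθW]; ring
    rw [mul_pow, hbsq, h8, div_mul_eq_mul_div, le_div_iff₀ (by positivity)]
    have h9 : (1 - 4 * ε) ^ 2 * (1 + 3 * ε) ≤ 1 - ε := by
      have h91 : (1 - 4 * ε) * (1 + 3 * ε) ≤ 1 - ε := by nlinarith
      have h92 : (1 - 4 * ε) * ((1 - 4 * ε) * (1 + 3 * ε)) ≤ 1 * ((1 - 4 * ε) * (1 + 3 * ε)) := by
        refine mul_le_mul_of_nonneg_right (by linarith) ?_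
        exact mul_nonneg (by linarith) (by linarith)
      nlinarith
    calc (1 - 4 * ε) ^ 2 * (2 * V * L) * (1 + 3 * ε) =
          2 * L * ((1 - 4 * ε) ^ 2 * (1 + 3 * ε) * V) := by ring
      _ ≤ 2 * L * ((1 - ε) * V) := by gcongr
      _ ≤ 2 * L * W := by gcongr
  calc (1 - 5 * ε) * b ≤ (1 - ε) * ((1 - 4 * ε) * b) := by
        nlinarith [mul_nonneg (mul_nonneg hε0.le hε0.le) hb0]
    _ ≤ (1 - ε) * (θ * W) := mul_le_mul_of_nonneg_left h7 (by linarith)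
    _ = _ := by ring

/-- The endpoints of the window `(a, 1 / a]` have ratio `exp Δ`, so a time step `Δ` on the
logarithmic scale moves every box of the window out of it. -/
lemma windows_disjoint {a Δ : ℝ} (ha : 0 < a) (hΔ : Real.exp Δ = (1 / a) ^ 2) (hΔ0 : 0 ≤ Δ) :
    Pairwise (Function.onFun Disjoint fun n : ℕ =>
      {k | a < p k * Real.exp (n * Δ) ∧ p k * Real.exp (n * Δ) ≤ 1 / a}) := by
  have key : ∀ n m : ℕ, n < m → ∀ k, a < p k * Real.exp (n * Δ) →
      ¬ p k * Real.exp (m * Δ) ≤ 1 / a := by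
    intro n m hnm k hk h
    have h1 : p k * Real.exp ((n : ℝ) * Δ) * Real.exp Δ ≤ p k * Real.exp (m * Δ) := by
      have hp : 0 < p k := pos_of_mul_pos_left (ha.trans hk) (Real.exp_pos _).le
      rw [mul_assoc, ← Real.exp_add]
      gcongr
      have : (n : ℝ) + 1 ≤ m := by exact_mod_cast hnm
      nlinarith
    have h2 : a * Real.exp Δ < p k * Real.exp (n * Δ) * Real.exp Δ := by gcongr
    have h3 : a * Real.exp Δ = 1 / a := by rw [hΔ]; field_simp
    linarith
  intro n m hnm
  rw [Function.onFun, Set.disjoint_left]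
  rintro k ⟨h1, h2⟩ ⟨h3, h4⟩
  rcases lt_or_gt_of_ne hnm with h | h
  · exact key n m h k h1 h4
  · exact key m n h k h3 h2

namespace IsPoissonizedScheme

/-- Lower half of the law of the iterated logarithm. -/
theorem ae_frequently_ge (hp : IsBoxDistribution p) (h : IsPoissonizedScheme P p box gap)
    (hρ : DeHaanPi (rho p) ℓ) (hℓ : Tendsto ℓ atTop atTop) {j : ℕ} (hj : 1 ≤ j)
    (hs : Tendsto (fun t => Real.log (Real.log t) / varK p j t) atTop (𝓝 0))
    {η : ℝ} (hη : 0 < η) :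
    ∀ᵐ ω ∂P, ∃ᶠ t in atTop, (1 - η) * lilScale (varK p j) t ≤
      occur (fun k => fullEvent box gap j k t) ω - meanK p j t := by
  have hVt := tendsto_varK_atTop hp hρ hℓ hj
  set V := varK p j with hV
  set ε := min (1 / 8) (η / 6) with hε
  have hε0 : 0 < ε := by positivity
  have hε1 : ε ≤ 1 / 8 := min_le_left _ _
  have hεη : 6 * ε ≤ η := by linarith [min_le_right (1 / 8) (η / 6)]
  -- A deviation `-ε * lilScale V` of the boxes outside the window then has exponent `4 log log`,
  -- halved at most by the correction in Bernstein's inequality, hence summable.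
  set κ := ε ^ 2 / 4 with hκ
  have hκ0 : 0 < κ := by positivity
  have hκε : κ ≤ ε := by nlinarith
  obtain ⟨a, ha0, ha1, haw⟩ := exists_window hp hρ hℓ hj hκ0
  set Δ := 2 * Real.log (1 / a) with hΔ
  have hΔ0 : 0 < Δ := mul_pos two_pos (Real.log_pos (by rwa [lt_div_iff₀ ha0, one_mul]))
  have hΔe : Real.exp Δ = (1 / a) ^ 2 := by
    rw [hΔ, two_mul, Real.exp_add, Real.exp_log (by positivity), pow_two]
  set τ : ℕ → ℝ := fun n => Real.exp (n * Δ) with hτ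
  have hτt : Tendsto τ atTop atTop := tendsto_exp_nat_mul hΔ0
  have hτ0 : ∀ n, 0 < τ n := fun n => Real.exp_pos _
  have hLτ : ∀ n, Real.log (Real.log (τ n)) = Real.log (n * Δ) := fun n => by
    rw [hτ, Real.log_exp]
  have hWfin : ∀ n, {k | a < p k * τ n ∧ p k * τ n ≤ 1 / a}.Finite := fun n => by
    refine (finite_setOf_one_div_le hp (τ n / a)).subset fun k hk => ?_
    have hk1 : a < p k * τ n := hk.1
    have hpk : 0 < p k := pos_of_mul_pos_left (ha0.trans hk1) (hτ0 n).le
    refine ⟨hpk, ?_⟩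
    rw [div_le_div_iff₀ hpk ha0]
    linarith
  set A : ℕ → Finset ℕ := fun n => (hWfin n).toFinset with hA
  have hAmem : ∀ n k, k ∈ A n ↔ a < p k * τ n ∧ p k * τ n ≤ 1 / a := fun n k => by
    simp [hA]
  set B : ℕ → ℕ → Set Ω := fun n k => fullEvent box gap j k (τ n) with hB
  have hBm' : ∀ n k, MeasurableSet[fullAlgebra box gap j k] (B n k) :=
    fun n k => measurableSet_fullAlgebra j k (τ n)
  have hBm := fun n => h.measurableSet_of_fullAlgebra (hBm' n)
  have hBi := fun n => h.iIndepSet_of_fullAlgebra hp (hBm' n)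
  have hBs : ∀ n, Summable fun k => P.real (B n k) := fun n =>
    h.summable_fullEvent hp hj (hτ0 n).le
  set B' : ℕ → ℕ → Set Ω := fun n k => if k ∈ A n then ∅ else B n k with hB'
  have hBm2' : ∀ n k, MeasurableSet[fullAlgebra box gap j k] (B' n k) := fun n k => by
    simp only [hB']
    split_ifs
    · exact @MeasurableSet.empty _ (fullAlgebra box gap j k)
    · exact hBm' n k
  have hBs' : ∀ n, Summable fun k => P.real (B' n k) := fun n =>
    (hBs n).of_nonneg_of_le (fun _ => measureReal_nonneg) fun k => by
      by_cases hk : k ∈ A n <;> simp [hB', hk]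
  have hvar : ∀ᶠ n in atTop, occurVar P (B' n) ≤ κ * V (τ n) := by
    filter_upwards [hτt.eventually haw] with n hn
    refine le_trans (le_of_eq (tsum_congr fun k => ?_)) (hn (A n) fun k hk => ?_)
    · by_cases hk : k ∈ A n
      · simp [hB', hk]
      · simp [hB', hk, hB, h.measureReal_fullEvent hp.nonneg j k (hτ0 n).le, poisVar]
    · rw [hAmem, not_and, not_le] at hk
      by_cases hk' : a < p k * τ n
      · exact Or.inr (hk hk')
      · exact Or.inl (not_lt.1 hk')
  -- the contribution of the boxes outside of the window
  have hout : ∀ᵐ ω ∂P, ∀ᶠ n in atTop,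
      ω ∉ {ω | occur (B' n) ω - occurMean P (B' n) ≤ -(ε * lilScale V (τ n))} := by
    refine ae_eventually_notMem_of_le_exp_log (q := 2) (A := 1) hΔ0 (by norm_num) ?_
    have h1 : ∀ᶠ t in atTop, 0 < V t ∧ 0 < Real.log (Real.log t) ∧ lilScale V t / V t < ε / 8 :=
      (hVt.eventually_gt_atTop 0).and ((tendsto_log_log.eventually_gt_atTop 0).and
        ((tendsto_lilScale_div hVt hs).eventually (gt_mem_nhds (by positivity))))
    filter_upwards [hτt.eventually h1, hvar] with n ⟨hV0, hL0, hb⟩ hv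
    rw [← hLτ, one_mul]
    have hb0 : 0 ≤ lilScale V (τ n) := Real.sqrt_nonneg _
    rw [div_lt_iff₀ hV0] at hb
    have hκV : κ * V (τ n) = ε * (ε / 4 * V (τ n)) := by rw [hκ]; ring
    have hx : ε * lilScale V (τ n) ≤ κ * V (τ n) / 2 := by
      rw [hκV, mul_div_assoc]
      gcongr
      linarith
    refine (measureReal_occur_sub_le_neg_le (h.measurableSet_of_fullAlgebra (hBm2' n))
      (h.iIndepSet_of_fullAlgebra hp (hBm2' n)) (hBs' n) hv (by positivity)
      (by positivity) (hx.trans (by linarith [mul_pos hκ0 hV0]))).trans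
      (Real.exp_le_exp.2 (neg_le_neg ?_))
    have h2 : (ε * lilScale V (τ n)) ^ 2 / (2 * (κ * V (τ n))) =
        4 * Real.log (Real.log (τ n)) := by
      rw [mul_pow, lilScale, Real.sq_sqrt (by positivity), hκ]
      field_simp
    have h3 : ε * lilScale V (τ n) / (κ * V (τ n)) ≤ 1 / 2 := by
      rw [div_le_iff₀ (by positivity)]; linarith
    rw [h2]
    nlinarith
  -- the contribution of the window
  set D : ℕ → Set Ω := fun n => {ω | (1 - 5 * ε) * lilScale V (τ n) < centredSum P (B n) (A n) ω}
    with hD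
  have hDm' : ∀ n, MeasurableSet[⨆ k ∈ {k | a < p k * τ n ∧ p k * τ n ≤ 1 / a},
      fullAlgebra box gap j k] (D n) := fun n => by
    refine measurableSet_Ioi.preimage (measurable_centredSum_of_le fun k hk => ?_)
    exact (le_iSup₂_of_le k ((hAmem n k).1 hk) le_rfl :
      fullAlgebra box gap j k ≤ ⨆ k ∈ {k | a < p k * τ n ∧ p k * τ n ≤ 1 / a},
        fullAlgebra box gap j k) _ (hBm' n k)
  have hDm : ∀ n, MeasurableSet (D n) := fun n =>
    measurableSet_Ioi.preimage (measurable_centredSum (hBm n) (A n))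
  have hle : ∀ k, fullAlgebra box gap j k ≤ ‹MeasurableSpace Ω› := fun k => by
    refine MeasurableSpace.generateFrom_le ?_
    rintro _ ⟨t, rfl⟩
    exact (h.measurableSet_fullEvent j k t).compl
  have hDi : iIndepSet D P := iIndepSet_of_disjoint hle (h.iIndep_fullAlgebra hp.nonneg j)
    (windows_disjoint ha0 hΔe hΔ0.le) hDm'
  have hwin : ∀ᵐ ω ∂P, ∃ᶠ n in atTop, ω ∈ D n := by
    -- At the grid times `exp (-log log (τ n)) = 1 / (n * Δ)`, just enough for divergence.
    refine ae_frequently_mem_of_iIndepSet hDm hDi (c := 1 / (2 * Δ)) (by positivity) ?_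
    have h1 : ∀ᶠ t in atTop, 0 < V t ∧ 8 / ε ^ 2 < Real.log (Real.log t) ∧
        lilScale V t / V t < ε ^ 2 / 64 :=
      (hVt.eventually_gt_atTop 0).and ((tendsto_log_log.eventually_gt_atTop _).and
        ((tendsto_lilScale_div hVt hs).eventually (gt_mem_nhds (by positivity))))
    filter_upwards [hτt.eventually h1, hvar, eventually_gt_atTop 0] with n ⟨hV0, hL0, hb⟩ hv hn
    have hn0 : (0 : ℝ) < n := by exact_mod_cast hn
    have hsplit := occurVar_eq (hBs n) (A n)
    rw [h.occurVar_fullEvent hp j (hτ0 n).le, ← hV] at hsplit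
    have hpr := measureReal_lt_centredSum_ge_exp (hBm n) (hBi n) (A n) hε0 hε1 hV0 hL0 hb
      (by nlinarith)
    refine (le_of_eq ?_).trans hpr
    rw [hLτ, Real.exp_neg, Real.exp_log (by positivity)]
    field_simp
  filter_upwards [hout, hwin, h.ae_K_eq hj] with ω h1 h2 h3
  refine hτt.frequently ((h2.and_eventually h1).mono fun n ⟨hw, ho⟩ => ?_)
  have hsplit := occur_sub_occurMean_eq (hBs n) (A n) (h3 (τ n)).1
  rw [h.occurMean_fullEvent hp j (hτ0 n).le] at hsplit
  have hw' : (1 - 5 * ε) * lilScale V (τ n) < centredSum P (B n) (A n) ω := hw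
  have ho' : -(ε * lilScale V (τ n)) < occur (B' n) ω - occurMean P (B' n) := not_le.1 ho
  have hb0 : 0 ≤ lilScale V (τ n) := Real.sqrt_nonneg _
  rw [hsplit]
  nlinarith

end IsPoissonizedScheme

end

end Karlin

/-! ### Slowly varying functions and asymptotics of logarithms. -/

namespace Karlin

section SlowVariation

/-- Pointwise convergence on an interval of finite length gives convergence in measure. This is
where measurability is essential. -/
lemma volume_restrict_bad_lt {k : ℝ → ℝ} (hk : Measurable k)
    (h : ∀ u : ℝ, Tendsto (fun s => k (s + u) - k s) atTop (𝓝 0)) {s : ℕ → ℝ}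
    (hs : Tendsto s atTop atTop) :
    ∀ᶠ n in atTop, volume {v ∈ Set.Icc (0 : ℝ) 2 | 1 ≤ |k (s n + v) - k (s n)|} < 1 / 2 := by
  have h1 := tendstoInMeasure_of_tendsto_ae (μ := volume.restrict (Set.Icc (0 : ℝ) 2))
    (f := fun n v => k (s n + v) - k (s n)) (g := fun _ => (0 : ℝ))
    (fun n => ((hk.comp (measurable_const_add _)).sub_const _).aestronglyMeasurable)
    (ae_of_all _ fun v => (h v).comp hs)
  have h2 := (tendstoInMeasure_iff_norm.1 h1) 1 one_pos
  filter_upwards [h2.eventually (gt_mem_nhds (show (0 : ℝ≥0∞) < 1 / 2 by simp))] with n hn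
  rw [Measure.restrict_apply' measurableSet_Icc] at hn
  refine lt_of_le_of_lt (measure_mono fun v hv => ?_) hn
  exact ⟨by simpa using hv.2, hv.1⟩

/-- A weak form of the uniform convergence theorem for slowly varying functions. -/
lemma exists_abs_sub_le_two {k : ℝ → ℝ} (hk : Measurable k)
    (h : ∀ u : ℝ, Tendsto (fun s => k (s + u) - k s) atTop (𝓝 0)) :
    ∃ S : ℝ, ∀ s, S ≤ s → ∀ u ∈ Set.Icc (0 : ℝ) 1, |k (s + u) - k s| ≤ 2 := by
  by_contra! hc
  choose s hs u hu hsu using fun n : ℕ => hc n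
  have hst : Tendsto s atTop atTop :=
    tendsto_atTop_mono hs tendsto_natCast_atTop_atTop
  have hst' : Tendsto (fun n => s n + u n) atTop atTop :=
    tendsto_atTop_mono (fun n => le_add_of_nonneg_right (hu n).1) hst
  obtain ⟨n, h1, h2⟩ := ((volume_restrict_bad_lt hk h hst).and
    (volume_restrict_bad_lt hk h hst')).exists
  set E := {v ∈ Set.Icc (0 : ℝ) 2 | 1 ≤ |k (s n + v) - k (s n)|}
  set F := {v ∈ Set.Icc (0 : ℝ) 2 | 1 ≤ |k (s n + u n + v) - k (s n + u n)|}
  -- If `k` differs by more than `2` at `s n` and `s n + u n`, then its value at `s n + v` is at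
  -- distance at least `1` from one of the two. So two sets of measure less than `1 / 2` cover an
  -- interval of length one.
  have hcover : Set.Icc (1 : ℝ) 2 ⊆ E ∪ (fun v => v + -u n) ⁻¹' F := by
    intro v hv
    by_contra hn
    rw [Set.mem_union, not_or] at hn
    have hu0 := (hu n).1
    have hu1 := (hu n).2
    have h3 : |k (s n + v) - k (s n)| < 1 := by
      by_contra h3
      exact hn.1 ⟨⟨by linarith [hv.1], hv.2⟩, not_lt.1 h3⟩
    have h4 : |k (s n + u n + (v + -u n)) - k (s n + u n)| < 1 := by
      by_contra h4
      exact hn.2 ⟨⟨by linarith [hv.1], by linarith [hv.2]⟩, not_lt.1 h4⟩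
    rw [show s n + u n + (v + -u n) = s n + v by ring] at h4
    have h5 := hsu n
    rw [abs_lt] at h3 h4
    rw [lt_abs] at h5
    rcases h5 with h5 | h5 <;> linarith
  have h3 := (measure_mono hcover).trans (measure_union_le (μ := volume) _ _)
  rw [measure_preimage_add_right, Real.volume_Icc] at h3
  norm_num at h3
  have h4 := h3.trans_lt (ENNReal.add_lt_add h1 h2)
  rw [ENNReal.add_halves] at h4
  exact lt_irrefl _ h4

/-- Unit increments eventually fall below any `ε / 2`, so `k` grows sublinearly along integer steps;
`exists_abs_sub_le_two` controls it in between. -/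
lemma tendsto_div_of_translation {k : ℝ → ℝ} (hk : Measurable k)
    (h : ∀ u : ℝ, Tendsto (fun s => k (s + u) - k s) atTop (𝓝 0)) :
    Tendsto (fun s => k s / s) atTop (𝓝 0) := by
  obtain ⟨S, hS⟩ := exists_abs_sub_le_two hk h
  rw [Metric.tendsto_nhds]
  intro ε hε
  obtain ⟨S', hS'⟩ := eventually_atTop.1
    ((Metric.tendsto_nhds.1 (h 1)) (ε / 2) (by positivity))
  set a := max (max S S') 0 with ha
  have haS : S ≤ a := (le_max_left _ _).trans (le_max_left _ _)
  have haS' : S' ≤ a := (le_max_right _ _).trans (le_max_left _ _)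
  have ha0 : 0 ≤ a := le_max_right _ _
  have hn : ∀ n : ℕ, |k (a + n) - k a| ≤ n * (ε / 2) := by
    intro n
    induction n with
    | zero => simp
    | succ n ih =>
      have h1 := hS' (a + n) (by have : (0 : ℝ) ≤ n := n.cast_nonneg; linarith)
      rw [Real.dist_eq, sub_zero] at h1
      have h2 := abs_add_le (k (a + n + 1) - k (a + n)) (k (a + n) - k a)
      push_cast
      rw [← add_assoc]
      rw [sub_add_sub_cancel] at h2
      linarith
  filter_upwards [eventually_gt_atTop a, eventually_gt_atTop ((|k a| + 2) / (ε / 2))] with s hs1 hs2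
  have hs0 : 0 < s := ha0.trans_lt hs1
  rw [div_lt_iff₀ (by positivity)] at hs2
  have hf1 := Nat.floor_le (show 0 ≤ s - a by linarith)
  have hf2 := Nat.lt_floor_add_one (s - a)
  set n := ⌊s - a⌋₊
  have hn0 : (0 : ℝ) ≤ n := n.cast_nonneg
  have h1 := hS (a + n) (by linarith) (s - (a + n)) ⟨by linarith, by linarith⟩
  rw [add_sub_cancel] at h1
  have h2 := hn n
  rw [Real.dist_eq, sub_zero, abs_div, abs_of_pos hs0, div_lt_iff₀ hs0]
  have h3 : n * (ε / 2) ≤ s * (ε / 2) := by gcongr; linarith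
  have h4 := abs_le.1 h1
  have h5 := abs_le.1 h2
  have h6 := abs_le.1 (le_refl |k a|)
  rw [abs_lt]
  constructor <;> linarith

lemma IsSlowlyVarying.eventually_pos {l : ℝ → ℝ} (hl : IsSlowlyVarying l) :
    ∀ᶠ x in atTop, 0 < l x := by
  obtain ⟨X, hX, -⟩ := hl.pos_measurable
  filter_upwards [eventually_ge_atTop X] with x hx using hX x hx

lemma IsSlowlyVarying.tendsto_log_div_log {l : ℝ → ℝ} (hl : IsSlowlyVarying l) :
    Tendsto (fun x => Real.log (l x) / Real.log x) atTop (𝓝 0) := by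
  obtain ⟨X, hX, hm⟩ := hl.pos_measurable
  -- Slow variation supplies measurability only on a half-line, so the function is cut off there to
  -- be measurable on the whole line.
  set L := (Set.Ici X).indicator l with hL
  have hLm : Measurable L := by
    refine measurable_of_restrict_of_restrict_compl (measurableSet_Ici (a := X)) ?_ ?_
    · have : (Set.Ici X).domRestrict L = fun x : Set.Ici X => l x :=
        funext fun x => Set.indicator_of_mem x.2 _
      rwa [this]
    · have : (Set.Ici X)ᶜ.domRestrict L = fun _ => 0 :=
        funext fun x => Set.indicator_of_notMem x.2 _
      rw [this]
      exact measurable_const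
  have hLl : ∀ x, X ≤ x → L x = l x := fun x hx => Set.indicator_of_mem hx _
  have h := tendsto_div_of_translation (k := fun s => Real.log (L (Real.exp s)))
    (Real.measurable_log.comp (hLm.comp Real.measurable_exp)) fun u => ?_
  · refine (h.comp Real.tendsto_log_atTop).congr' ?_
    filter_upwards [eventually_ge_atTop X, eventually_gt_atTop 0] with x hx hx0
    simp only [Function.comp_apply]
    rw [Real.exp_log hx0, hLl x hx]
  · have h1 := (Real.continuousAt_log one_ne_zero).tendsto.comp
      ((hl.tendsto_ratio (Real.exp u) (Real.exp_pos u)).comp Real.tendsto_exp_atTop)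
    rw [Real.log_one] at h1
    refine h1.congr' ?_
    have hu : Tendsto (fun s => Real.exp (s + u)) atTop atTop :=
      Real.tendsto_exp_atTop.comp (tendsto_atTop_add_const_right _ u tendsto_id)
    filter_upwards [Real.tendsto_exp_atTop.eventually_ge_atTop X, hu.eventually_ge_atTop X]
      with s hs hs'
    simp only [Function.comp_apply]
    rw [hLl _ hs, hLl _ hs', ← Real.exp_add, add_comm u,
      Real.log_div (hX _ hs').ne' (hX _ hs).ne']

end SlowVariation

section LogAsymptotics

variable {f g L : ℝ → ℝ} {c μ : ℝ}

lemma eventually_pos_of_tendsto_div (hc : 0 < c)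
    (h : Tendsto (fun t => f t / g t) atTop (𝓝 c)) (hg : ∀ᶠ t in atTop, 0 < g t) :
    ∀ᶠ t in atTop, 0 < f t := by
  filter_upwards [h.eventually (lt_mem_nhds hc), hg] with t h1 h2
  exact (div_pos_iff_of_pos_right h2).1 h1

lemma tendsto_log_div_of_tendsto_div (hc : 0 < c)
    (h : Tendsto (fun t => f t / g t) atTop (𝓝 c)) (hg : ∀ᶠ t in atTop, 0 < g t)
    (hL : Tendsto L atTop atTop) (hlog : Tendsto (fun t => Real.log (g t) / L t) atTop (𝓝 μ)) :
    Tendsto (fun t => Real.log (f t) / L t) atTop (𝓝 μ) := by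
  have h1 := ((Real.continuousAt_log hc.ne').tendsto.comp h).div_atTop hL
  have h2 := h1.add hlog
  rw [zero_add] at h2
  refine h2.congr' ?_
  filter_upwards [hg, eventually_pos_of_tendsto_div hc h hg] with t hg hf
  simp only [Function.comp_apply]
  rw [Real.log_div hf.ne' hg.ne']
  ring

lemma tendsto_atTop_of_tendsto_log_div (hμ : 0 < μ) (hf : ∀ᶠ t in atTop, 0 < f t)
    (hL : Tendsto L atTop atTop) (hlog : Tendsto (fun t => Real.log (f t) / L t) atTop (𝓝 μ)) :
    Tendsto f atTop atTop := by
  have h1 : Tendsto (fun t => Real.log (f t)) atTop atTop := by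
    refine (hlog.pos_mul_atTop hμ hL).congr' ?_
    filter_upwards [hL.eventually_gt_atTop 0] with t ht
    rw [div_mul_cancel₀ _ ht.ne']
  refine (Real.tendsto_exp_atTop.comp h1).congr' ?_
  filter_upwards [hf] with t ht
  exact Real.exp_log ht

lemma tendsto_log_div_self : Tendsto (fun v : ℝ => Real.log v / v) atTop (𝓝 0) :=
  Real.isLittleO_log_id_atTop.tendsto_div_nhds_zero

lemma tendsto_log_log_div_self :
    Tendsto (fun v : ℝ => Real.log (Real.log v) / v) atTop (𝓝 0) := by
  have h := (tendsto_log_div_self.comp Real.tendsto_log_atTop).mul tendsto_log_div_self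
  rw [zero_mul] at h
  refine h.congr' ?_
  filter_upwards [Real.tendsto_log_atTop.eventually_gt_atTop 0] with v hv
  simp only [Function.comp_apply]
  field_simp

end LogAsymptotics

section Limsup

/-- The tolerances `1 / (n + 1)` are countable, so that the almost sure bounds hold on one common
event. In `EReal` the limsup needs no boundedness check. -/
lemma limsup_div_eq {X b N : ℝ → ℝ} {r : ℝ} (hN : ∀ᶠ t in atTop, 0 < N t)
    (hr : Tendsto (fun t => b t / N t) atTop (𝓝 r))
    (h1 : ∀ n : ℕ, ∀ᶠ t in atTop, X t ≤ (1 + 1 / ((n : ℝ) + 1)) * b t)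
    (h2 : ∀ n : ℕ, ∃ᶠ t in atTop, (1 - 1 / ((n : ℝ) + 1)) * b t ≤ X t) :
    limsup (fun t => ((X t / N t : ℝ) : EReal)) atTop = (r : EReal) := by
  have hn := tendsto_one_div_add_atTop_nhds_zero_nat (𝕜 := ℝ)
  refine le_antisymm (EReal.le_of_forall_lt_iff_le.1 fun z hz => ?_)
    (EReal.ge_of_forall_gt_iff_ge.1 fun z hz => ?_)
  · rw [EReal.coe_lt_coe_iff] at hz
    have h3 : Tendsto (fun n : ℕ => (1 + 1 / ((n : ℝ) + 1)) * r) atTop (𝓝 r) := by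
      simpa using (hn.const_add 1).mul_const r
    obtain ⟨n, hn⟩ := (h3.eventually (gt_mem_nhds hz)).exists
    refine limsup_le_of_le (h := ?_)
    filter_upwards [hN, h1 n, (hr.const_mul (1 + 1 / ((n : ℝ) + 1))).eventually
      (gt_mem_nhds hn)] with t hN hX ht
    rw [EReal.coe_le_coe_iff]
    calc X t / N t ≤ (1 + 1 / ((n : ℝ) + 1)) * b t / N t := by gcongr
      _ = (1 + 1 / ((n : ℝ) + 1)) * (b t / N t) := mul_div_assoc _ _ _
      _ ≤ z := ht.le
  · rw [EReal.coe_lt_coe_iff] at hz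
    have h3 : Tendsto (fun n : ℕ => (1 - 1 / ((n : ℝ) + 1)) * r) atTop (𝓝 r) := by
      simpa using (hn.const_sub 1).mul_const r
    obtain ⟨n, hn⟩ := (h3.eventually (lt_mem_nhds hz)).exists
    refine le_limsup_of_frequently_le ((h2 n).and_eventually (hN.and
      ((hr.const_mul (1 - 1 / ((n : ℝ) + 1))).eventually (lt_mem_nhds hn))) |>.mono ?_)
    rintro t ⟨hX, hN, ht⟩
    rw [EReal.coe_le_coe_iff]
    calc z ≤ (1 - 1 / ((n : ℝ) + 1)) * (b t / N t) := ht.le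
      _ = (1 - 1 / ((n : ℝ) + 1)) * b t / N t := (mul_div_assoc _ _ _).symm
      _ ≤ X t / N t := by gcongr

end Limsup

end Karlin

/-! ### From `log log t` to functions of the variance. -/

namespace Karlin

section

variable {Ω : Type*} [MeasurableSpace Ω] {P : Measure Ω} [IsProbabilityMeasure P]
  {p : ℕ → ℝ} {box : ℕ → Ω → ℕ} {gap : ℕ → Ω → ℝ} {ℓ : ℝ → ℝ}

/-- The law of the iterated logarithm, normalised by a function `Ψ` of the variance which is
asymptotically a multiple of `log log t`. -/
theorem IsPoissonizedScheme.ae_limsup_eq (hp : IsBoxDistribution p)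
    (h : IsPoissonizedScheme P p box gap) (hρ : DeHaanPi (rho p) ℓ)
    (hℓ : Tendsto ℓ atTop atTop) {j : ℕ} (hj : 1 ≤ j) {Ψ : ℝ → ℝ} {μ : ℝ} (hμ : 0 < μ)
    (hΨ : Tendsto (fun t => Ψ (varK p j t) / Real.log (Real.log t)) atTop (𝓝 μ))
    (hΨ' : Tendsto (fun v => Ψ v / v) atTop (𝓝 0)) :
    ∀ᵐ ω ∂P, limsup (fun t : ℝ => (((K box gap j t ω - ∫ ω', K box gap j t ω' ∂P) /
      √(variance (K box gap j t) P * Ψ (variance (K box gap j t) P)) : ℝ) : EReal)) atTop =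
      ((√(2 / μ) : ℝ) : EReal) := by
  have hVt := tendsto_varK_atTop hp hρ hℓ hj
  set V := varK p j with hV
  have hLt := tendsto_log_log
  have hΨpos : ∀ᶠ t in atTop, 0 < Ψ (V t) :=
    eventually_pos_of_tendsto_div hμ hΨ (hLt.eventually_gt_atTop 0)
  -- The deviations are moderate only if `log log t = o(V t)`. This follows because `Ψ (V t)` is of
  -- order `log log t` and `Ψ v = o(v)`.
  have hs : Tendsto (fun t => Real.log (Real.log t) / V t) atTop (𝓝 0) := by
    have h1 := (hΨ'.comp hVt).div hΨ hμ.ne'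
    rw [zero_div] at h1
    refine h1.congr' ?_
    filter_upwards [hΨpos, hVt.eventually_gt_atTop 0, hLt.eventually_gt_atTop 0] with t h1 h2 h3
    simp only [Pi.div_apply, Function.comp_apply]
    field_simp
  have hr : Tendsto (fun t => lilScale V t / √(V t * Ψ (V t))) atTop (𝓝 √(2 / μ)) := by
    have h1 := ((tendsto_const_nhds (x := (2 : ℝ))).div hΨ hμ.ne').sqrt
    refine h1.congr' ?_
    filter_upwards [hΨpos, hVt.eventually_gt_atTop 0, hLt.eventually_gt_atTop 0] with t h1 h2 h3
    rw [lilScale, ← Real.sqrt_div' _ (by positivity)]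
    congr 1
    simp only [Pi.div_apply]
    field_simp
  have hub : ∀ᵐ ω ∂P, ∀ n : ℕ, ∀ᶠ t in atTop,
      occur (fun k => fullEvent box gap j k t) ω - meanK p j t ≤
        (1 + 1 / ((n : ℝ) + 1)) * lilScale V t :=
    ae_all_iff.2 fun n => h.ae_eventually_le hp hρ hℓ hj hs (by positivity)
  have hlb : ∀ᵐ ω ∂P, ∀ n : ℕ, ∃ᶠ t in atTop, (1 - 1 / ((n : ℝ) + 1)) * lilScale V t ≤
      occur (fun k => fullEvent box gap j k t) ω - meanK p j t :=
    ae_all_iff.2 fun n => h.ae_frequently_ge hp hρ hℓ hj hs (by positivity)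
  filter_upwards [hub, hlb, h.ae_K_eq hj] with ω h1 h2 h3
  have hN : ∀ᶠ t in atTop, 0 < √(V t * Ψ (V t)) := by
    filter_upwards [hΨpos, hVt.eventually_gt_atTop 0] with t h1 h2
    positivity
  rw [← limsup_div_eq hN hr h1 h2]
  refine limsup_congr ?_
  filter_upwards [eventually_ge_atTop 0] with t ht
  rw [(h.integral_variance_K hp hj ht).1, (h.integral_variance_K hp hj ht).2, (h3 t).2]
  rfl

/-- The slowly varying factor is invisible on the logarithmic scale: `log (l x) = o(log x)`, used at
`x = log t`. -/
lemma auxiliary_powerlog {β : ℝ} {l : ℝ → ℝ} (hl : IsSlowlyVarying l)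
    (h : ℓ ~[atTop] fun t => Real.log t ^ β * l (Real.log t)) :
    (∀ᶠ t in atTop, 0 < ℓ t) ∧
      Tendsto (fun t => Real.log (ℓ t) / Real.log (Real.log t)) atTop (𝓝 β) := by
  have hlpos : ∀ᶠ t in atTop, 0 < l (Real.log t) :=
    Real.tendsto_log_atTop.eventually hl.eventually_pos
  have hg : ∀ᶠ t in atTop, 0 < Real.log t ^ β * l (Real.log t) := by
    filter_upwards [hlpos, Real.tendsto_log_atTop.eventually_gt_atTop 0] with t h1 h2
    positivity
  have hdiv := (isEquivalent_iff_tendsto_one (hg.mono fun t ht => ht.ne')).1 h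
  refine ⟨eventually_pos_of_tendsto_div one_pos hdiv hg,
    tendsto_log_div_of_tendsto_div one_pos hdiv hg tendsto_log_log ?_⟩
  have h1 := (hl.tendsto_log_div_log.comp Real.tendsto_log_atTop).const_add β
  rw [add_zero] at h1
  refine h1.congr' ?_
  filter_upwards [hlpos, Real.tendsto_log_atTop.eventually_gt_atTop 0,
    tendsto_log_log.eventually_gt_atTop 0] with t h1 h2 h3
  rw [Real.log_mul (by positivity) h1.ne', Real.log_rpow h2, add_div, Function.comp_apply]
  field_simp

lemma auxiliary_exp {σ lam : ℝ} (hσ : 0 < σ) (hlam : 0 < lam)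
    (h : ℓ ~[atTop] fun t => Real.exp (σ * Real.log t ^ lam)) :
    Tendsto (fun t => ℓ t / Real.exp (σ * Real.log t ^ lam)) atTop (𝓝 1) ∧
      Tendsto (fun t => σ * Real.log t ^ lam) atTop atTop ∧
      Tendsto (fun t => Real.log (σ * Real.log t ^ lam) / Real.log (Real.log t)) atTop
        (𝓝 lam) := by
  refine ⟨(isEquivalent_iff_tendsto_one (Eventually.of_forall fun t =>
    (Real.exp_pos _).ne')).1 h,
    ((tendsto_rpow_atTop hlam).comp Real.tendsto_log_atTop).const_mul_atTop hσ, ?_⟩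
  have h1 := ((tendsto_log_log.const_div_atTop (Real.log σ)).add_const lam)
  rw [zero_add] at h1
  refine h1.congr' ?_
  filter_upwards [Real.tendsto_log_atTop.eventually_gt_atTop 0,
    tendsto_log_log.eventually_gt_atTop 0] with t h2 h3
  rw [Real.log_mul hσ.ne' (by positivity), Real.log_rpow h2, add_div]
  field_simp

end

end Karlin

theorem theorem3p1 {Ω : Type*} [MeasurableSpace Ω] (P : Measure Ω) [IsProbabilityMeasure P]
    (p : ℕ → ℝ) (hp : Karlin.IsBoxDistribution p)
    (box : ℕ → Ω → ℕ) (gap : ℕ → Ω → ℝ) (hscheme : Karlin.IsPoissonizedScheme P p box gap)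
    (ℓ : ℝ → ℝ) (hρ : Karlin.DeHaanPi (Karlin.rho p) ℓ) :
    (∀ (β : ℝ) (l : ℝ → ℝ), 0 < β → Karlin.IsSlowlyVarying l →
      ℓ ~[atTop] (fun t => Real.log t ^ β * l (Real.log t)) →
      Tendsto ℓ atTop atTop ∧
      ∀ j : ℕ, 1 ≤ j → ∀ᵐ ω ∂P,
        limsup (fun t : ℝ =>
          (((Karlin.K box gap j t ω - ∫ ω', Karlin.K box gap j t ω' ∂P) /
            √(variance (Karlin.K box gap j t) P *
              Real.log (variance (Karlin.K box gap j t) P)) : ℝ) : EReal)) atTop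
          = ((√(2 / β) : ℝ) : EReal)) ∧
    (∀ σ lam : ℝ, 0 < σ → 0 < lam → lam < 1 →
      ℓ ~[atTop] (fun t => Real.exp (σ * Real.log t ^ lam)) →
      Tendsto ℓ atTop atTop ∧
      ∀ j : ℕ, 1 ≤ j → ∀ᵐ ω ∂P,
        limsup (fun t : ℝ =>
          (((Karlin.K box gap j t ω - ∫ ω', Karlin.K box gap j t ω' ∂P) /
            √(variance (Karlin.K box gap j t) P *
              Real.log (Real.log (variance (Karlin.K box gap j t) P))) : ℝ) : EReal)) atTop
          = ((√(2 / lam) : ℝ) : EReal)) ∧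
    (Tendsto ℓ atTop atTop → ∀ j : ℕ, 1 ≤ j →
      (fun t => ∫ ω, Karlin.K box gap j t ω ∂P) ~[atTop] Karlin.rho p ∧
      (fun t => variance (Karlin.K box gap j t) P) ~[atTop]
        (fun t => (Real.log 2 - ∑ k ∈ Finset.Ico 1 j,
          (Nat.factorial (2 * k - 1) : ℝ) / ((Nat.factorial k : ℝ) ^ 2 * 2 ^ (2 * k))) * ℓ t)) := by
  refine ⟨fun β l hβ hl h => ?_, fun σ lam hσ hlam _ h => ?_, fun hℓ j hj => ?_⟩
  · obtain ⟨hpos, hlog⟩ := Karlin.auxiliary_powerlog hl h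
    have hℓ := Karlin.tendsto_atTop_of_tendsto_log_div hβ hpos Karlin.tendsto_log_log hlog
    refine ⟨hℓ, fun j hj => hscheme.ae_limsup_eq hp hρ hℓ hj hβ ?_ Karlin.tendsto_log_div_self⟩
    exact Karlin.tendsto_log_div_of_tendsto_div (Karlin.varConst_pos hj)
      (Karlin.tendsto_varK_div hp hρ hℓ hj) hpos Karlin.tendsto_log_log hlog
  · obtain ⟨hdiv, hlin, hlog⟩ := Karlin.auxiliary_exp hσ hlam h
    have hexp : ∀ᶠ t in atTop, 0 < Real.exp (σ * Real.log t ^ lam) :=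
      Eventually.of_forall fun t => Real.exp_pos _
    have hone : Tendsto (fun t => Real.log (Real.exp (σ * Real.log t ^ lam)) /
        (σ * Real.log t ^ lam)) atTop (𝓝 1) := by
      refine tendsto_const_nhds.congr' ?_
      filter_upwards [hlin.eventually_gt_atTop 0] with t ht
      rw [Real.log_exp, div_self ht.ne']
    have hpos := Karlin.eventually_pos_of_tendsto_div one_pos hdiv hexp
    have hlogℓ := Karlin.tendsto_log_div_of_tendsto_div one_pos hdiv hexp hlin hone
    have hℓ := Karlin.tendsto_atTop_of_tendsto_log_div one_pos hpos hlin hlogℓ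
    refine ⟨hℓ, fun j hj => hscheme.ae_limsup_eq hp hρ hℓ hj hlam
      (Ψ := fun v => Real.log (Real.log v)) ?_ Karlin.tendsto_log_log_div_self⟩
    have hlogV := Karlin.tendsto_log_div_of_tendsto_div (Karlin.varConst_pos hj)
      (Karlin.tendsto_varK_div hp hρ hℓ hj) hpos hlin hlogℓ
    -- A second logarithm: `hlogV` says that `log V` is asymptotic to `σ (log t) ^ lam`, whose
    -- logarithm is asymptotic to `lam * log log t`.
    exact Karlin.tendsto_log_div_of_tendsto_div one_pos hlogV (hlin.eventually_gt_atTop 0)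
      Karlin.tendsto_log_log hlog
  · rw [← Karlin.varConst_eq hj]
    have hc := Karlin.varConst_pos hj
    constructor
    · refine isEquivalent_of_tendsto_one
        ((Karlin.tendsto_meanK_div hp hρ hℓ hj).congr' ?_)
      filter_upwards [eventually_ge_atTop 0] with t ht
      rw [Pi.div_apply, (hscheme.integral_variance_K hp hj ht).1]
    · have h1 := (Karlin.tendsto_varK_div hp hρ hℓ hj).div_const (Karlin.varConst j)
      rw [div_self hc.ne'] at h1
      refine isEquivalent_of_tendsto_one (h1.congr' ?_)
      filter_upwards [eventually_ge_atTop 0] with t ht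
      rw [Pi.div_apply, (hscheme.integral_variance_K hp hj ht).2, div_div, mul_comm]
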